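/- **Setting.** Let $\mu>0$, and let $F(\mathbf u)=f(|\mathbf u|)=\tfrac12 g(|\mathbf u|)^2$ where $g\ge 0$ is locally Lipschitz on $[0,\infty)$ with $g(0)=g(1)=0$ and $\int_0^1 g=1$; $f\in C^\infty([0,\infty))$, $f>0$ on $(0,\infty)\setminus\{1\}$; for some $s_0\in(0,1)$, $f'>0$ on $(0,s_0)$ and $f'<0$ on $(s_0,1)$; $f'(0)=f'(1)=0$ and $f''(0),f''(1)>0$. Let $\phi\in C^\infty(\mathbb R)$ be even, non-increasing on $[0,1]$, positive on $(-1,1)$, zero for $|z|\ge1$, with $1-4z^2\le\phi(z)\le 1-\tfrac12z^2$ for $|z|\le\tfrac12$. Let $I_0\subset\mathbb R^2$ be a smooth simple closed curve with inner unit normal $\mathbf n$. Let $d_{I_0}$ be the signed distance to $I_0$, positive in the region enclosed by $I_0$ and negative outside. Let $\delta_0\in(0,1)$ be such that the nearest point projection onto $I_0$ is well defined and smooth on $\{|d_{I_0}|<4\delta_0\}$. Put $\boldsymbol\xi=\phi(d_{I_0}/\delta_0)\nabla d_{I_0}$. For a bounded domain $\Omega\subset\mathbb R^2$ with $I_0\subset\Omega$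 and $\operatorname{dist}(I_0,\partial\Omega)\ge4\delta_0$ (neither smoothness of $\partial\Omega$ nor simple connectedness is required), put $\Omega_0^\pm=\{x\in\Omega: d_{I_0}(x)\gtrless0\}$ and $I_0(\delta)=\{x\in\Omega:|d_{I_0}(x)|<\delta\}$. For $\mathbf u\in H^1(\Omega;\mathbb R^2)$ with $|\mathbf u|\le1$ a.e. and $0<\varepsilon\le1$, let $$A_\varepsilon(\mathbf u)=\int_\Omega\Big(\tfrac\varepsilon2\mu|\operatorname{div}\mathbf u|^2+\tfrac\varepsilon2|\nabla\mathbf u|^2+\tfrac1\varepsilon F(\mathbf u)\Big)dx,\qquad \psi[\mathbf u](x)=\int_0^{|\mathbf u(x)|}g(s)\,ds,$$ $$E_\varepsilon[\mathbf u|I_0]=\int_\Omega\tfrac\varepsilon2\mu|\operatorname{div}\mathbf u|^2dx+\int_\Omega\Big(\tfrac\varepsilon2|\nabla\mathbf u|^2+\tfrac1\varepsilon F(\mathbf u)-\boldsymbol\xi\cdot\nabla\psi[\mathbf u]\Big)dx .$$ **Proposition.** With $\mu,f,g,\phi,I_0,\delta_0$ fixed, there is a heteroclinic profile $\theta:\mathbb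 R\to(0,1)$, that is, a $C^2$ solution of $-\theta''+f'(\theta)=0$ with $\theta(-\infty)=0$ and $\theta(+\infty)=1$, and for every $M$ there is a constant $c_1>0$ such that the following holds. For every $\Omega$ as above and every $\mathbf u^{in}\in H^1(\Omega;\mathbb S^1)$ with $\|\mathbf u^{in}\|_{H^1(\Omega)}\le M$ whose trace on $I_0$ satisfies $\mathbf u^{in}|_{I_0}\cdot\mathbf n=0$ a.e. on $I_0$, there exist functions $\mathbf u^{in}_\varepsilon\in H^1(\Omega)\cap L^\infty(\Omega)$, $0<\varepsilon\le1$, with $\psi[\mathbf u^{in}_\varepsilon]\in H^1(\Omega)$, such that for every $\varepsilon\in(0,1]$: 1. $\mathbf u^{in}_\varepsilon=\mathbf u^{in}$ in $\Omega_0^+\setminus I_0(\delta_0)$ and $\mathbf u^{in}_\varepsilon=0$ in $\Omega_0^-\setminus I_0(\delta_0)$; 2. $\mathbf u^{in}_\varepsilon=\theta(d_{I_0}/\varepsilon)\,\mathbf u^{in}$ in $I_0(\delta_0/2)$; 3. $A_\varepsilon(\mathbf u^{in}_\varepsilon)\le c_1$ and $\|\mathbf u^{in}_\varepsilon\|_{L^\infty(\Omega)}\le1$;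 4. $E_\varepsilon[\mathbf u^{in}_\varepsilon|I_0]+\displaystyle\int_{I_0(\delta_0)}\big|\psi[\mathbf u^{in}_\varepsilon]-\mathbf 1_{\Omega_0^+}\big|\,|d_{I_0}|\,dx\le c_1\varepsilon$. -/

import Mathlib

open MeasureTheory Set Filter Topology
open scoped ContDiff ENNReal RealInnerProductSpace

noncomputable section

namespace AnisoGL

/-- The Euclidean plane `ℝ²`. -/
abbrev Plane := EuclideanSpace ℝ (Fin 2)

/-! ### Sobolev functions on an open set of the plane -/

section Sobolev

variable {V : Type*} [NormedAddCommGroup V] [NormedSpace ℝ V]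

/-- `G` is a weak (distributional) derivative of `u` on the open set `Ω`:
`∫_Ω (∂_v φ) u = - ∫_Ω φ (G v)` for every test function `φ ∈ C_c^∞(Ω)` and every direction `v`. -/
def IsWeakGrad (Ω : Set Plane) (u : Plane → V) (G : Plane → Plane →L[ℝ] V) : Prop :=
  LocallyIntegrableOn u Ω ∧ LocallyIntegrableOn G Ω ∧
    ∀ φ : Plane → ℝ, ContDiff ℝ ∞ φ → HasCompactSupport φ → tsupport φ ⊆ Ω → ∀ v : Plane,
      ∫ x in Ω, fderiv ℝ φ x v • u x = -∫ x in Ω, φ x • G x v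

/-- `u ∈ H¹(Ω; V)`. -/
def MemH1 (Ω : Set Plane) (u : Plane → V) : Prop :=
  MemLp u 2 (volume.restrict Ω) ∧
    ∃ G : Plane → Plane →L[ℝ] V, IsWeakGrad Ω u G ∧ MemLp G 2 (volume.restrict Ω)

open Classical in
/-- The weak derivative of `u` on `Ω`, which is unique up to null sets of `Ω`
(and is set to `0` if `u` is not weakly differentiable). -/
def weakGrad (Ω : Set Plane) (u : Plane → V) : Plane → Plane →L[ℝ] V :=
  if h : ∃ G : Plane → Plane →L[ℝ] V, IsWeakGrad Ω u G then h.choose else 0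

end Sobolev

/-- The squared Frobenius norm `|A|² = ∑ᵢⱼ Aᵢⱼ²`. -/
def frobSq (A : Plane →L[ℝ] Plane) : ℝ :=
  ∑ i : Fin 2, ∑ j : Fin 2, (A (EuclideanSpace.single j 1) i) ^ 2

/-- The trace `∑ᵢ Aᵢᵢ`; for `A = ∇u` this is `div u`. -/
def divOf (A : Plane →L[ℝ] Plane) : ℝ :=
  ∑ i : Fin 2, A (EuclideanSpace.single i 1) i

/-- The norm of `H¹(Ω; ℝ²)`. -/
def h1Norm (Ω : Set Plane) (u : Plane → Plane) : ℝ :=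
  Real.sqrt ((∫ x in Ω, ‖u x‖ ^ 2) + ∫ x in Ω, frobSq (weakGrad Ω u x))

/-- `u ∈ H¹(Ω; 𝕊¹)`. -/
def MemH1Circle (Ω : Set Plane) (u : Plane → Plane) : Prop :=
  MemH1 Ω u ∧ ∀ᵐ x ∂(volume.restrict Ω), ‖u x‖ = 1

/-! ### The curve, its interior, its normal, its signed distance -/

/-- `γ` is a regular `1`-periodic smooth parametrization of a simple closed curve. -/
structure IsSmoothSimpleClosedCurve (γ : ℝ → Plane) : Prop where
  smooth : ContDiff ℝ ∞ γ
  periodic : Function.Periodic γ 1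
  regular : ∀ t, deriv γ t ≠ 0
  simple : InjOn γ (Ico 0 1)

/-- The region enclosed by `I`: the points of the complement of `I` whose connected component
in the complement of `I` is bounded. -/
def enclosed (I : Set Plane) : Set Plane :=
  {x | x ∉ I ∧ Bornology.IsBounded (connectedComponentIn Iᶜ x)}

/-- `n` is the inner unit normal vector along the closed curve `γ`. -/
structure IsInnerNormal (γ n : ℝ → Plane) : Prop where
  unit : ∀ t, ‖n t‖ = 1
  orthogonal : ∀ t, ⟪n t, deriv γ t⟫ = 0
  inward : ∀ t, ∀ᶠ r in 𝓝[>] (0 : ℝ), γ t + r • n t ∈ enclosed (range γ)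

open Classical in
/-- The signed distance `d_I` to `I`, positive in the enclosed region, negative outside. -/
def signedDistTo (I : Set Plane) (x : Plane) : ℝ :=
  if x ∈ enclosed I then Metric.infDist x I else -Metric.infDist x I

/-- `Ω⁺ = {x ∈ Ω : d_I(x) > 0}`. -/
def plusRegion (Ω I : Set Plane) : Set Plane := {x ∈ Ω | 0 < signedDistTo I x}

/-- `Ω⁻ = {x ∈ Ω : d_I(x) < 0}`. -/
def minusRegion (Ω I : Set Plane) : Set Plane := {x ∈ Ω | signedDistTo I x < 0}

/-- The open `δ`-neighbourhood `I(δ) = {x ∈ Ω : |d_I(x)| < δ}`. -/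
def tube (Ω I : Set Plane) (δ : ℝ) : Set Plane := {x ∈ Ω | |signedDistTo I x| < δ}

/-- The nearest point projection onto `I` is well defined and smooth on the open neighbourhood of
radius `r` of `I`. -/
def HasSmoothProjection (I : Set Plane) (r : ℝ) : Prop :=
  ∃ P : Plane → Plane, ContDiffOn ℝ ∞ P {x | Metric.infDist x I < r} ∧
    ∀ x, Metric.infDist x I < r →
      P x ∈ I ∧ dist x (P x) = Metric.infDist x I ∧
        ∀ y ∈ I, dist x y = Metric.infDist x I → y = P x

/-- `w` is the trace of `u ∈ H¹(Ω; ℝ²)` on the closed curve `γ` contained in `Ω`, written in the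
parameter of the curve: the restriction map from functions smooth in `Ω` to the curve,
extended by continuity from `H¹(Ω)` to `L²` of the curve, sends `u` to `w`.
(As `|γ'|` is bounded above and below, `L²` in the parameter and in arc length agree.) -/
def IsTraceOn (Ω : Set Plane) (γ : ℝ → Plane) (u : Plane → Plane) (w : ℝ → Plane) : Prop :=
  MemLp w 2 (volume.restrict (Ioc 0 1)) ∧
    ∃ v : ℕ → Plane → Plane,
      (∀ k, ContDiffOn ℝ ∞ (v k) Ω) ∧
      Tendsto (fun k => eLpNorm (fun x => v k x - u x) 2 (volume.restrict Ω)) atTop (𝓝 0) ∧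
      Tendsto (fun k => eLpNorm (fun x => fderiv ℝ (v k) x - weakGrad Ω u x) 2
        (volume.restrict Ω)) atTop (𝓝 0) ∧
      Tendsto (fun k => eLpNorm (fun t => v k (γ t) - w t) 2 (volume.restrict (Ioc 0 1)))
        atTop (𝓝 0)

/-! ### The potential, the cut-off profile, the heteroclinic profile -/

/-- Structural assumptions on the double equal-well potential `F(u) = f(|u|) = g(|u|)² / 2`,
including the normalization `∫₀¹ g = 1`. Only values on `[0, ∞)` matter, and derivatives at `0`
are one-sided. -/
structure IsPotential (f g : ℝ → ℝ) : Prop where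
  f_eq : ∀ s, 0 ≤ s → f s = g s ^ 2 / 2
  g_nonneg : ∀ s, 0 ≤ s → 0 ≤ g s
  g_lipschitz : LocallyLipschitzOn (Ici 0) g
  g_zero : g 0 = 0
  g_one : g 1 = 0
  f_smooth : ContDiffOn ℝ ∞ f (Ici 0)
  f_pos : ∀ s, 0 < s → s ≠ 1 → 0 < f s
  f_mono : ∃ s₀ ∈ Ioo (0 : ℝ) 1,
    (∀ s ∈ Ioo 0 s₀, 0 < derivWithin f (Ici 0) s) ∧
      ∀ s ∈ Ioo s₀ 1, derivWithin f (Ici 0) s < 0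
  f_deriv_zero : derivWithin f (Ici 0) 0 = 0
  f_deriv_one : derivWithin f (Ici 0) 1 = 0
  f_deriv2_zero : 0 < iteratedDerivWithin 2 f (Ici 0) 0
  f_deriv2_one : 0 < iteratedDerivWithin 2 f (Ici 0) 1
  normalization : ∫ s in (0 : ℝ)..1, g s = 1

/-- The even smooth profile used to cut off the extended normal field. -/
structure IsCutoffProfile (φ : ℝ → ℝ) : Prop where
  smooth : ContDiff ℝ ∞ φ
  even : ∀ z, φ (-z) = φ z
  antitone : AntitoneOn φ (Icc 0 1)
  pos : ∀ z, |z| < 1 → 0 < φ z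
  zero : ∀ z, 1 ≤ |z| → φ z = 0
  lower : ∀ z, |z| ≤ 1 / 2 → 1 - 4 * z ^ 2 ≤ φ z
  upper : ∀ z, |z| ≤ 1 / 2 → φ z ≤ 1 - z ^ 2 / 2

/-- `θ : ℝ → (0,1)` solves `-θ'' + f'(θ) = 0`, `θ(-∞) = 0`, `θ(+∞) = 1`. -/
structure IsHeteroclinic (f θ : ℝ → ℝ) : Prop where
  smooth : ContDiff ℝ 2 θ
  mem : ∀ z, θ z ∈ Ioo (0 : ℝ) 1
  ode : ∀ z, -deriv (deriv θ) z + derivWithin f (Ici 0) (θ z) = 0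
  atBot : Tendsto θ atBot (𝓝 0)
  atTop : Tendsto θ atTop (𝓝 1)

/-! ### The energies -/

/-- `A_ε(u) = ∫_Ω (ε/2) μ |div u|² + (ε/2) |∇u|² + (1/ε) F(u)`, with `F(u) = f(|u|)`. -/
def energy (Ω : Set Plane) (μ : ℝ) (f : ℝ → ℝ) (ε : ℝ) (u : Plane → Plane) : ℝ :=
  ∫ x in Ω, (ε / 2 * μ * divOf (weakGrad Ω u x) ^ 2 + ε / 2 * frobSq (weakGrad Ω u x)
    + 1 / ε * f ‖u x‖)

/-- `ψ(x) = ∫₀^{|u(x)|} g(s) ds`. -/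
def psi (g : ℝ → ℝ) (u : Plane → Plane) (x : Plane) : ℝ :=
  ∫ s in (0 : ℝ)..‖u x‖, g s

/-- The extended normal field `ξ = φ(d_I / δ₀) ∇d_I`. -/
def xi (I : Set Plane) (φ : ℝ → ℝ) (δ₀ : ℝ) (x : Plane) : Plane :=
  φ (signedDistTo I x / δ₀) • gradient (signedDistTo I) x

/-- The modulated energy
`E_ε[u | I] = ∫_Ω (ε/2) μ |div u|² + ∫_Ω ((ε/2) |∇u|² + (1/ε) F(u) - ξ · ∇ψ)`. -/
def modulatedEnergy (Ω I : Set Plane) (μ : ℝ) (f g φ : ℝ → ℝ) (δ₀ ε : ℝ)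
    (u : Plane → Plane) : ℝ :=
  (∫ x in Ω, ε / 2 * μ * divOf (weakGrad Ω u x) ^ 2) +
    ∫ x in Ω, (ε / 2 * frobSq (weakGrad Ω u x) + 1 / ε * f ‖u x‖
      - weakGrad Ω (psi g u) x (xi I φ δ₀ x))

/-- `∫_{I(δ₀)} |ψ - 1_{Ω⁺}| |d_I| dx`. -/
def bulkError (Ω I : Set Plane) (g : ℝ → ℝ) (δ₀ : ℝ) (u : Plane → Plane) : ℝ :=
  ∫ x in tube Ω I δ₀,
    |psi g u x - (plusRegion Ω I).indicator (fun _ => (1 : ℝ)) x| * |signedDistTo I x|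

end AnisoGL

end

open AnisoGL

noncomputable section

open scoped NNReal

namespace AnisoGL

section

/-! ### The potential near its wells -/

/-! The competitor is `p(d) u`, where `d` is the signed distance and `p` equals `θ(r/ε)` for `|r| ≤
δ₀/2` and the indicator of `r > 0` for `|r| ≥ δ₀`. Since `|u| = 1`, `u` is orthogonal to its own
derivatives and the cross term disappears: `|∇(p(d)u)|² = p²|∇u|² + p'²`. Also `ψ` is then a
function of `d` alone, and `|∇d| = 1` almost everywhere, so `ξ·∇ψ = φ(d/δ₀) g(p) p'`. The modulated
density therefore splits into at most `(ε/2)|∇u|²`, the anisotropic term, and the one-dimensional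
defect `(ε/2)p'² + f(p)/ε - φ g(p) p'`.

The profile is chosen to solve `θ' = g(θ)`, not only the second-order equation. In the inner region
the defect is then exactly `(1 - φ) g(p)²/ε`. The factor `1 - φ ≤ 4(r/δ₀)²` against an exponentially
decaying `g(p)²/ε` leaves `O(ε)`; in the outer region everything is exponentially small. The tails
come from `g` being comparable to `s(1-s)` on `[0,1]` (`IsPotential.exists_bounds`,
`IsPotential.exists_heteroclinic`, `IsPotential.exists_layerProfile`).

The delicate term is the divergence, which contains `p' u·∇d`. Here `ε p'²` is bounded by a multiple
of the weight `ε⁻¹ exp(-c|d|/ε)`, whose mass near the curve is only `O(1)`. The tangential trace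
supplies the missing power of `ε`: along a normal line, `u·N` starts from `0`, so `|u·N|²` at
distance `r` is at most `|r|` times the gradient energy of that line, and the weight integrated
against `|r|` is `O(ε)` (`IsSmoothSimpleClosedCurve.exists_trace_bound`). This is proved for smooth
approximations in normal coordinates and passed to the limit.

The distance is treated as a 1-Lipschitz function, differentiable almost everywhere by Rademacher,
whose gradient off the curve is the normal up to sign (`gradient_signedDistTo`). The pieces meet in
`IsLayerProfile.weakGrad_competitor` and `IsLayerProfile.energy_le`; `u` enters the constants only
through a bound on `∫|∇u|²`. -/

lemma eventually_quadratic_le {F F' : ℝ → ℝ} {A a : ℝ} (ha : 0 < a) (hA : 0 < A)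
    (hF : ∀ s ∈ Ico 0 a, HasDerivWithinAt F (F' s) (Ici 0) s) (hF0 : F 0 = 0) (hF'0 : F' 0 = 0)
    (hF' : HasDerivWithinAt F' A (Ici 0) 0) :
    ∀ᶠ s in 𝓝[>] (0 : ℝ), A / 4 * s ^ 2 ≤ F s := by
  -- The slope of `F'` at `0` is `A`, so half of it survives nearby; integrating this, in the form
  -- of monotonicity of `F - (A/4)s²`, gives the claim.
  have h1 : ∀ᶠ s in 𝓝[>] (0 : ℝ), A / 2 * s ≤ F' s := by
    have := (hasDerivWithinAt_iff_tendsto_slope' (by simp)).1 (hF'.mono Ioi_subset_Ici_self)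
    filter_upwards [this.eventually (lt_mem_nhds (show A / 2 < A by linarith)), self_mem_nhdsWithin]
      with s hs hs0
    rw [slope_def_field, hF'0, sub_zero, sub_zero, lt_div_iff₀ hs0] at hs
    exact hs.le
  obtain ⟨b, hb, hb'⟩ := mem_nhdsGT_iff_exists_Ioo_subset.1 h1
  have hb0 : (0 : ℝ) < b := hb
  have hm : MonotoneOn (fun s => F s - A / 4 * s ^ 2) (Ico 0 (min a b)) := by
    have hd : ∀ s ∈ Ico 0 (min a b), HasDerivWithinAt (fun s => F s - A / 4 * s ^ 2)
        (F' s - A / 2 * s) (Ici 0) s := by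
      intro s hs
      have := (hF s ⟨hs.1, hs.2.trans_le (min_le_left _ _)⟩).sub
        (((hasDerivAt_pow 2 s).const_mul (A / 4)).hasDerivWithinAt (s := Ici 0))
      refine this.congr_deriv ?_
      simp; ring
    refine monotoneOn_of_hasDerivWithinAt_nonneg (f' := fun s => F' s - A / 2 * s)
      (convex_Ico _ _) (fun s hs => ?_)
      (fun s hs => ?_) (fun s hs => ?_)
    · exact (hd s hs).continuousWithinAt.mono Ico_subset_Ici_self
    · exact (hd s (interior_subset hs)).mono (interior_subset.trans Ico_subset_Ici_self)
    · rw [interior_Ico] at hs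
      have := hb' ⟨hs.1, hs.2.trans_le (min_le_right _ _)⟩
      simp only [mem_ofPred_eq] at this
      linarith
  filter_upwards [Ioo_mem_nhdsGT (show 0 < min a b by positivity)] with s hs
  have := hm ⟨le_rfl, by positivity⟩ ⟨hs.1.le, hs.2⟩ hs.1.le
  simp only [hF0] at this
  linarith

/-- The bounds near the two ends leave a compact middle interval, where the extreme value theorem
applies. -/
lemma exists_bounds_Ioo {q : ℝ → ℝ} (hq : ContinuousOn q (Ioo 0 1)) (hpos : ∀ s ∈ Ioo (0 : ℝ) 1, 0 < q s)
    {c₀ C₀ c₁ C₁ : ℝ} (hc₀ : 0 < c₀) (hc₁ : 0 < c₁)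
    (h0 : ∀ᶠ s in 𝓝[>] (0 : ℝ), c₀ ≤ q s ∧ q s ≤ C₀)
    (h1 : ∀ᶠ s in 𝓝[<] (1 : ℝ), c₁ ≤ q s ∧ q s ≤ C₁) :
    ∃ c C : ℝ, 0 < c ∧ ∀ s ∈ Ioo (0 : ℝ) 1, c ≤ q s ∧ q s ≤ C := by
  obtain ⟨a, ha, ha'⟩ := mem_nhdsGT_iff_exists_Ioo_subset.1 h0
  obtain ⟨b, hb, hb'⟩ := mem_nhdsLT_iff_exists_Ioo_subset.1 h1
  have ha0 : (0 : ℝ) < a := ha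
  have hb0 : b < (1 : ℝ) := hb
  obtain ⟨a₁, ha₁, ha₁'⟩ := exists_between (show 0 < min a (1 / 2) by positivity)
  obtain ⟨b₁, hb₁, hb₁'⟩ := exists_between (show max b (1 / 2) < 1 by simp; constructor <;> linarith)
  rw [lt_min_iff] at ha₁'
  rw [max_lt_iff] at hb₁
  have hsub : Icc a₁ b₁ ⊆ Ioo 0 1 := fun s hs => ⟨ha₁.trans_le hs.1, hs.2.trans_lt hb₁'⟩
  have hne : (Icc a₁ b₁).Nonempty := nonempty_Icc.2 (by linarith)
  obtain ⟨m, hm, hm'⟩ := isCompact_Icc.exists_isMinOn hne (hq.mono hsub)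
  obtain ⟨M, hM, hM'⟩ := isCompact_Icc.exists_isMaxOn hne (hq.mono hsub)
  refine ⟨min (q m) (min c₀ c₁), max (q M) (max C₀ C₁), ?_, fun s hs => ?_⟩
  · have := hpos m (hsub hm)
    positivity
  by_cases h : s < a₁
  · have := ha' ⟨hs.1, h.trans ha₁'.1⟩
    exact ⟨by simp [this.1], by simp [this.2]⟩
  by_cases h' : b₁ < s
  · have := hb' ⟨hb₁.1.trans h', hs.2⟩
    exact ⟨by simp [this.1], by simp [this.2]⟩
  · have hs' : s ∈ Icc a₁ b₁ := ⟨not_lt.1 h, not_lt.1 h'⟩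
    have h1 : q m ≤ q s := hm' hs'
    have h2 : q s ≤ q M := hM' hs'
    exact ⟨by simp [h1], by simp [h2]⟩

namespace IsPotential

variable {f g : ℝ → ℝ}

lemma g_continuousOn (h : IsPotential f g) : ContinuousOn g (Ici 0) :=
  h.g_lipschitz.continuousOn

lemma g_pos (h : IsPotential f g) {s : ℝ} (hs : s ∈ Ioo (0 : ℝ) 1) : 0 < g s := by
  have h1 := h.f_pos s hs.1 hs.2.ne
  rw [h.f_eq s hs.1.le] at h1
  refine (h.g_nonneg s hs.1.le).lt_of_ne fun h0 => ?_
  simp [← h0] at h1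

/-- Nondegeneracy `f''(0) > 0` makes `f` at least quadratic at the well, and `g = √(2f)` is then at
least linear. -/
lemma eventually_lower_zero (h : IsPotential f g) :
    ∃ c : ℝ, 0 < c ∧ ∀ᶠ s in 𝓝[>] (0 : ℝ), c * s ≤ g s := by
  have hA := h.f_deriv2_zero
  set A := iteratedDerivWithin 2 f (Ici 0) 0 with hAdef
  have hd : DifferentiableOn ℝ (derivWithin f (Ici 0)) (Ici 0) :=
    (h.f_smooth.derivWithin (uniqueDiffOn_Ici 0) (m := 1) (by norm_cast)).differentiableOn
      (by norm_num)
  have h2 : HasDerivWithinAt (derivWithin f (Ici 0)) A (Ici 0) 0 := by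
    rw [hAdef, iteratedDerivWithin_succ, iteratedDerivWithin_one]
    exact (hd 0 (by simp)).hasDerivWithinAt
  have := eventually_quadratic_le one_pos hA (fun s hs =>
    ((h.f_smooth.differentiableOn (by norm_num)) s hs.1).hasDerivWithinAt)
    (by simp [h.f_eq 0 le_rfl, h.g_zero]) h.f_deriv_zero h2
  refine ⟨Real.sqrt (A / 2), by positivity, ?_⟩
  filter_upwards [this, self_mem_nhdsWithin] with s hs hs0
  have hs0' : 0 ≤ s := le_of_lt hs0
  rw [h.f_eq s hs0'] at hs
  refine abs_le_of_sq_le_sq' ?_ (h.g_nonneg s hs0') |>.2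
  rw [mul_pow, Real.sq_sqrt (by positivity)]
  linarith

/-- The argument at the well `0` applied to the reflected potential `s ↦ f(1 - s)`. -/
lemma eventually_lower_one (h : IsPotential f g) :
    ∃ c : ℝ, 0 < c ∧ ∀ᶠ s in 𝓝[<] (1 : ℝ), c * (1 - s) ≤ g s := by
  have hA := h.f_deriv2_one
  set A := iteratedDerivWithin 2 f (Ici 0) 1 with hAdef
  have hd : DifferentiableOn ℝ (derivWithin f (Ici 0)) (Ici 0) :=
    (h.f_smooth.derivWithin (uniqueDiffOn_Ici 0) (m := 1) (by norm_cast)).differentiableOn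
      (by norm_num)
  have hn : ∀ s : ℝ, 0 < s → Ici (0 : ℝ) ∈ 𝓝 s := fun s hs => Ici_mem_nhds hs
  have h2 : HasDerivAt (derivWithin f (Ici 0)) A 1 := by
    rw [hAdef, iteratedDerivWithin_succ, iteratedDerivWithin_one]
    exact (hd 1 (by simp)).hasDerivWithinAt.hasDerivAt (hn 1 one_pos)
  have := eventually_quadratic_le (F := fun s => f (1 - s))
    (F' := fun s => -derivWithin f (Ici 0) (1 - s)) one_pos hA (fun s hs => by
      have h3 : HasDerivAt f (derivWithin f (Ici 0) (1 - s)) (1 - s) :=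
        ((h.f_smooth.differentiableOn (by norm_num)) (1 - s)
          (by simp; linarith [hs.2])).hasDerivWithinAt.hasDerivAt (hn _ (by linarith [hs.2]))
      simpa using (h3.comp_const_sub 1 s).hasDerivWithinAt)
    (by simp [h.f_eq 1 zero_le_one, h.g_one]) (by simp [h.f_deriv_one]) (by
      have h3 : HasDerivAt (derivWithin f (Ici 0)) A (1 - 0) := by simpa using h2
      simpa using (h3.comp_const_sub 1 0).fun_neg.hasDerivWithinAt)
  refine ⟨Real.sqrt (A / 2), by positivity, ?_⟩
  have ht : Tendsto (fun s : ℝ => 1 - s) (𝓝[<] 1) (𝓝[>] 0) := by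
    refine tendsto_nhdsWithin_iff.2 ⟨?_, ?_⟩
    · exact ((continuous_const.sub continuous_id).tendsto' 1 0 (by simp)).mono_left
        nhdsWithin_le_nhds
    · filter_upwards [self_mem_nhdsWithin] with s hs
      simpa using hs
  filter_upwards [ht.eventually this, Ioo_mem_nhdsLT (show (0 : ℝ) < 1 by norm_num)] with s hs hs0
  rw [sub_sub_cancel, h.f_eq s hs0.1.le] at hs
  refine abs_le_of_sq_le_sq' ?_ (h.g_nonneg s hs0.1.le) |>.2
  rw [mul_pow, Real.sq_sqrt (by positivity)]
  linarith

/-- `g` is comparable to `s (1 - s)` on `[0, 1]`. -/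
lemma exists_bounds (h : IsPotential f g) :
    ∃ c C : ℝ, 0 < c ∧ ∀ s ∈ Icc (0 : ℝ) 1, c * (s * (1 - s)) ≤ g s ∧ g s ≤ C * (s * (1 - s)) := by
  obtain ⟨c₀, hc₀, h0⟩ := h.eventually_lower_zero
  obtain ⟨c₁, hc₁, h1⟩ := h.eventually_lower_one
  -- The upper bounds at both wells use only that `g` is locally Lipschitz and vanishes there.
  have hu0 : ∃ K : ℝ, 0 ≤ K ∧ ∀ᶠ s in 𝓝[>] (0 : ℝ), g s ≤ K * s := by
    obtain ⟨K, t, ht, hK⟩ := h.g_lipschitz (show (0 : ℝ) ∈ Ici 0 by simp)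
    refine ⟨K, K.2, ?_⟩
    filter_upwards [nhdsWithin_mono 0 Ioi_subset_Ici_self ht, self_mem_nhdsWithin] with s hs hs0
    have := hK.dist_le_mul s hs 0 (mem_of_mem_nhdsWithin (by simp) ht)
    have hs0' : 0 < s := hs0
    rw [h.g_zero, Real.dist_eq, Real.dist_eq, sub_zero, sub_zero, abs_of_pos hs0'] at this
    exact (le_abs_self _).trans this
  have hu1 : ∃ K : ℝ, 0 ≤ K ∧ ∀ᶠ s in 𝓝[<] (1 : ℝ), g s ≤ K * (1 - s) := by
    obtain ⟨K, t, ht, hK⟩ := h.g_lipschitz (show (1 : ℝ) ∈ Ici 0 by simp)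
    refine ⟨K, K.2, ?_⟩
    have ht' : t ∈ 𝓝 (1 : ℝ) := by
      rwa [nhdsWithin_eq_nhds.2 (Ici_mem_nhds one_pos)] at ht
    filter_upwards [mem_nhdsWithin_of_mem_nhds ht', self_mem_nhdsWithin] with s hs hs0
    have := hK.dist_le_mul s hs 1 (mem_of_mem_nhds ht')
    have hs0' : s < 1 := hs0
    rw [h.g_one, Real.dist_eq, Real.dist_eq, sub_zero, abs_sub_comm, 
      abs_of_pos (sub_pos.2 hs0')] at this
    exact (le_abs_self _).trans this
  obtain ⟨K₀, hK₀, hu0⟩ := hu0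
  obtain ⟨K₁, hK₁, hu1⟩ := hu1
  -- The factor 2 in the upper constants pays for the factor of `s(1-s)` that is at least `1/2` near
  -- the end considered.
  obtain ⟨c, C, hc, hb⟩ := exists_bounds_Ioo (q := fun s => g s / (s * (1 - s))) (C₀ := 2 * K₀)
    (C₁ := 2 * K₁)
    (by
      refine (h.g_continuousOn.mono fun s hs => hs.1.le).div (by fun_prop) fun s hs => ?_
      exact (mul_pos hs.1 (sub_pos.2 hs.2)).ne')
    (fun s hs => div_pos (h.g_pos hs) (mul_pos hs.1 (sub_pos.2 hs.2))) hc₀ hc₁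
    (by
      filter_upwards [h0, hu0, Ioo_mem_nhdsGT (show (0 : ℝ) < 1 / 2 by norm_num)] with s h2 h3 hs
      have h4 : 0 < s * (1 - s) := mul_pos hs.1 (by linarith [hs.2])
      rw [le_div_iff₀ h4, div_le_iff₀ h4]
      constructor
      · nlinarith [mul_pos hc₀ (mul_pos hs.1 hs.1)]
      · nlinarith [mul_nonneg hK₀ (mul_nonneg hs.1.le (sub_nonneg.2 hs.2.le))])
    (by
      filter_upwards [h1, hu1, Ioo_mem_nhdsLT (show (1 / 2 : ℝ) < 1 by norm_num)] with s h2 h3 hs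
      have hs1 : 0 < 1 - s := by linarith [hs.2]
      have h4 : 0 < s * (1 - s) := mul_pos (by linarith [hs.1]) hs1
      rw [le_div_iff₀ h4, div_le_iff₀ h4]
      constructor
      · nlinarith [mul_pos hc₁ (mul_pos hs1 hs1)]
      · nlinarith [mul_nonneg hK₁ (mul_nonneg hs1.le (sub_nonneg.2 hs.1.le))])
  refine ⟨c, C, hc, fun s hs => ?_⟩
  rcases hs.1.eq_or_lt with rfl | h5
  · simp [h.g_zero]
  rcases hs.2.eq_or_lt with rfl | h6
  · simp [h.g_one]
  have h4 : 0 < s * (1 - s) := mul_pos h5 (by linarith)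
  have := hb s ⟨h5, h6⟩
  rwa [le_div_iff₀ h4, div_le_iff₀ h4] at this

end IsPotential

end

section

/-! ### The heteroclinic profile -/

/-- Separation of variables: the solution is the inverse of `H(x) = ∫₀ˣ 1/k`. Positivity of `k`
makes `H` strictly increasing and `k ≤ C` makes it onto `ℝ`, so no Lipschitz condition on `k` is
needed. -/
lemma exists_global_flow {k : ℝ → ℝ} (hk : Continuous k) {c C : ℝ} (hc : 0 < c)
    (hb : ∀ x, c ≤ k x ∧ k x ≤ C) :
    ∃ l : ℝ → ℝ, l 0 = 0 ∧ ∀ z, HasDerivAt l (k (l z)) z := by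
  have hk0 : ∀ x, 0 < k x := fun x => hc.trans_le (hb x).1
  have hC : 0 < C := (hk0 0).trans_le (hb 0).2
  have hki : Continuous fun x => (k x)⁻¹ := hk.inv₀ fun x => (hk0 x).ne'
  set H : ℝ → ℝ := fun x => ∫ y in (0 : ℝ)..x, (k y)⁻¹ with hH
  have hd : ∀ x, HasDerivAt H (k x)⁻¹ x := fun x =>
    intervalIntegral.integral_hasDerivAt_right (hki.intervalIntegrable _ _)
      (hki.stronglyMeasurableAtFilter _ _) hki.continuousAt
  have hmono : StrictMono H := strictMono_of_deriv_pos fun x => by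
    rw [(hd x).deriv]; exact inv_pos.2 (hk0 x)
  have hmono' : Monotone fun x => H x - C⁻¹ * x := by
    refine monotone_of_deriv_nonneg (fun x => ?_) fun x => ?_
    · exact ((hd x).sub ((hasDerivAt_id x).const_mul C⁻¹)).differentiableAt
    · have := ((hd x).sub ((hasDerivAt_id x).const_mul C⁻¹)).deriv
      change deriv (fun x => H x - C⁻¹ * x) x = _ at this
      rw [this, mul_one, sub_nonneg]
      exact inv_anti₀ (hk0 x) (hb x).2
  have hH0 : H 0 = 0 := by simp [hH]
  have hcont : Continuous H := continuous_iff_continuousAt.2 fun x => (hd x).continuousAt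
  have hsurj : Function.Surjective H := by
    refine hcont.surjective ?_ ?_
    · refine tendsto_atTop_mono' atTop ?_ (tendsto_id.const_mul_atTop (inv_pos.2 hC))
      filter_upwards [eventually_ge_atTop 0] with x hx
      have := hmono' hx
      simp only [hH0] at this
      simp; linarith
    · refine tendsto_atBot_mono' atBot ?_ (tendsto_id.const_mul_atBot (inv_pos.2 hC))
      filter_upwards [eventually_le_atBot 0] with x hx
      have := hmono' hx
      simp only [hH0] at this
      simp; linarith
  let e := hmono.orderIsoOfSurjective H hsurj
  have he : ∀ z, H (e.symm z) = z := fun z => e.apply_symm_apply z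
  refine ⟨e.symm, ?_, fun z => ?_⟩
  · exact e.symm_apply_eq.2 hH0.symm
  · have := HasDerivAt.of_local_left_inverse (f := H) (g := e.symm) (a := z)
      e.symm.continuous.continuousAt (hd _) (inv_pos.2 (hk0 _)).ne' (Eventually.of_forall he)
    simpa using this

/-- A heteroclinic solution satisfying the first-order equation, with exponential tails. -/
lemma IsPotential.exists_heteroclinic {f g : ℝ → ℝ} (h : IsPotential f g) :
    ∃ θ : ℝ → ℝ, IsHeteroclinic f θ ∧ (∀ z, HasDerivAt θ (g (θ z)) z) ∧
      ∃ c : ℝ, 0 < c ∧ (∀ z ≤ 0, θ z ≤ Real.exp (-(c * |z|))) ∧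
        ∀ z, 0 ≤ z → 1 - θ z ≤ Real.exp (-(c * |z|)) := by
  obtain ⟨c, C, hc, hb⟩ := h.exists_bounds
  have hσ : ∀ x, Real.sigmoid x ∈ Ioo (0 : ℝ) 1 := fun x =>
    ⟨Real.sigmoid_pos x, Real.sigmoid_lt_one x⟩
  have hσp : ∀ x, 0 < Real.sigmoid x * (1 - Real.sigmoid x) := fun x =>
    mul_pos (hσ x).1 (sub_pos.2 (hσ x).2)
  -- With `θ = sigmoid ∘ l`, the equation `θ' = g(θ)` becomes `l' = k(l)`; comparability of `g` with
  -- `s(1-s)` says exactly that `k` lies between two constants, the lower one positive.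
  set k : ℝ → ℝ := fun x => g (Real.sigmoid x) / (Real.sigmoid x * (1 - Real.sigmoid x)) with hk
  have hkc : Continuous k := by
    refine Continuous.div (h.g_continuousOn.comp_continuous continuous_sigmoid
      fun x => (hσ x).1.le) ?_ fun x => (hσp x).ne'
    exact continuous_sigmoid.mul (continuous_const.sub continuous_sigmoid)
  obtain ⟨l, hl0, hl⟩ := exists_global_flow hkc hc (C := C) fun x => by
    have := hb _ ⟨(hσ x).1.le, (hσ x).2.le⟩
    rwa [hk, le_div_iff₀ (hσp x), div_le_iff₀ (hσp x)]
  have hkb : ∀ x, c ≤ k x := fun x => by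
    have := (hb _ ⟨(hσ x).1.le, (hσ x).2.le⟩).1
    rwa [hk, le_div_iff₀ (hσp x)]
  -- Together with `l 0 = 0` this gives `l z ≥ cz` for `z ≥ 0` and `l z ≤ cz` for `z ≤ 0`; the bound
  -- `sigmoid ≤ exp` turns it into exponential tails on both sides.
  have hmono : Monotone fun z => l z - c * z := by
    refine monotone_of_deriv_nonneg (fun x => ?_) fun x => ?_
    · exact ((hl x).sub ((hasDerivAt_id x).const_mul c)).differentiableAt
    · have := ((hl x).sub ((hasDerivAt_id x).const_mul c)).deriv
      change deriv (fun z => l z - c * z) x = _ at this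
      rw [this, mul_one, sub_nonneg]
      exact hkb _
  set θ : ℝ → ℝ := fun z => Real.sigmoid (l z) with hθ
  have hθd : ∀ z, HasDerivAt θ (g (θ z)) z := fun z => by
    refine ((Real.hasDerivAt_sigmoid (l z)).comp z (hl z)).congr_deriv ?_
    simp only [hk, hθ]
    field_simp [(hσ (l z)).1.ne', (sub_pos.2 (hσ (l z)).2).ne']
  have hle : ∀ x, Real.sigmoid x ≤ Real.exp x := fun x => by
    have := Real.sigmoid_mul_rexp_neg (-x)
    rw [neg_neg] at this
    rw [← this]
    exact mul_le_of_le_one_left (Real.exp_pos x).le (Real.sigmoid_le_one _)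
  have hneg : ∀ z ≤ 0, θ z ≤ Real.exp (-(c * |z|)) := fun z hz => by
    refine (hle _).trans (Real.exp_le_exp.2 ?_)
    have := hmono hz
    simp only [hl0] at this
    rw [abs_of_nonpos hz]; linarith
  have hpos : ∀ z, 0 ≤ z → 1 - θ z ≤ Real.exp (-(c * |z|)) := fun z hz => by
    rw [hθ, ← Real.sigmoid_neg]
    refine (hle _).trans (Real.exp_le_exp.2 ?_)
    have := hmono hz
    simp only [hl0] at this
    rw [abs_of_nonneg hz]; linarith
  -- `g` is only Lipschitz, but `f` is smooth and positive along `θ`, so the right-hand side of the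
  -- equation is smooth through this formula and regularity can be bootstrapped.
  have hg : ∀ z, g (θ z) = Real.sqrt (2 * f (θ z)) := fun z => by
    rw [h.f_eq _ (hσ _).1.le, mul_div_cancel₀ _ two_ne_zero,
      Real.sqrt_sq (h.g_nonneg _ (hσ _).1.le)]
  have hfp : ∀ z, 0 < f (θ z) := fun z => h.f_pos _ (hσ _).1 (hσ _).2.ne
  have hθ' : deriv θ = fun z => Real.sqrt (2 * f (θ z)) := funext fun z => by
    rw [(hθd z).deriv, hg]
  have hfs : ∀ z, ContDiffAt ℝ ∞ f (θ z) := fun z =>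
    h.f_smooth.contDiffAt (Ici_mem_nhds (hσ (l z)).1)
  have hs : ∀ m : ℕ, ContDiff ℝ m θ → ContDiff ℝ (m + 1) θ := fun m hm => by
    refine contDiff_succ_iff_deriv.2 ⟨fun z => (hθd z).differentiableAt, by simp, ?_⟩
    rw [hθ']
    refine contDiff_iff_contDiffAt.2 fun z => ContDiffAt.sqrt ?_ (by have := hfp z; positivity)
    exact contDiffAt_const.mul (((hfs z).of_le (by exact_mod_cast le_top)).comp z hm.contDiffAt)
  have hc0 : ContDiff ℝ (0 : ℕ) θ := by
    exact_mod_cast contDiff_zero.2 (continuous_iff_continuousAt.2 fun z => (hθd z).continuousAt)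
  have hc1 : ContDiff ℝ (1 : ℕ) θ := by exact_mod_cast hs 0 hc0
  have ht : ∀ b : ℝ, 0 < b → Tendsto (fun z : ℝ => Real.exp (-(c * z))) atTop (𝓝 0) := fun _ _ =>
    Real.tendsto_exp_neg_atTop_nhds_zero.comp (tendsto_id.const_mul_atTop hc)
  refine ⟨θ, ⟨?_, fun z => hσ _, fun z => ?_, ?_, ?_⟩, hθd, c, hc, hneg, hpos⟩
  · exact_mod_cast hs 1 hc1
  · have hfd : HasDerivAt f (derivWithin f (Ici 0) (θ z)) (θ z) := by
      rw [derivWithin_of_mem_nhds (Ici_mem_nhds (hσ (l z)).1)]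
      exact ((hfs z).differentiableAt (by norm_num)).hasDerivAt
    -- Differentiating `θ' = √(2f(θ))` once more gives `f'(θ)θ'/√(2f(θ)) = f'(θ)`.
    have := ((hfd.comp z (hθd z)).const_mul 2).sqrt
      (by have := hfp z; simp only [Function.comp]; positivity)
    simp only [Function.comp_def] at this
    rw [hθ', this.deriv]
    have h1 := hfp z
    have h2 : 0 < Real.sqrt (2 * f (θ z)) := by positivity
    rw [hg]
    field_simp
    ring
  · have h0 : Tendsto (fun z : ℝ => Real.exp (-(c * |z|))) atBot (𝓝 0) :=
      (ht 1 one_pos).comp tendsto_abs_atBot_atTop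
    refine tendsto_of_tendsto_of_tendsto_of_le_of_le' tendsto_const_nhds h0
      (Eventually.of_forall fun z => (hσ _).1.le) ?_
    filter_upwards [eventually_le_atBot 0] with z hz using hneg z hz
  · have h0 : Tendsto (fun z : ℝ => 1 - Real.exp (-(c * |z|))) atTop (𝓝 1) := by
      simpa using ((ht 1 one_pos).comp tendsto_abs_atTop_atTop).const_sub 1
    refine tendsto_of_tendsto_of_tendsto_of_le_of_le' h0 tendsto_const_nhds ?_
      (Eventually.of_forall fun z => (hσ _).2.le)
    filter_upwards [eventually_ge_atTop 0] with z hz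
    linarith [hpos z hz]

/-! ### The transition layer profile -/

lemma IsCutoffProfile.mem_Icc {φ : ℝ → ℝ} (h : IsCutoffProfile φ) (z : ℝ) : φ z ∈ Icc (0 : ℝ) 1 := by
  have h1 : ∀ z, φ z = φ |z| := fun z => by
    rcases abs_choice z with h2 | h2 <;> rw [h2]
    rw [h.even]
  rcases le_or_gt 1 |z| with hz | hz
  · simp [h.zero z hz]
  · refine ⟨(h.pos z hz).le, ?_⟩
    rw [h1]
    refine (h.antitone ⟨le_rfl, zero_le_one⟩ ⟨abs_nonneg z, hz.le⟩ (abs_nonneg z)).trans ?_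
    simpa using h.upper 0 (by simp)

/-- The device that trades exponential decay for powers of `ε`: it is applied with `y = |r|/ε` and
with `y = 1/ε`. -/
lemma mul_exp_neg_le {c y : ℝ} (hc : 0 < c) : y * Real.exp (-(c * y)) ≤ 1 / c := by
  have h1 := Real.add_one_le_exp (c * y)
  rw [Real.exp_neg, ← div_eq_mul_inv, div_le_div_iff₀ (Real.exp_pos _) hc]
  linarith

/-- The properties of the truncated profile `h`, which interpolates between `θ (r / ε)` for
`|r| ≤ δ / 2` and the indicator function of `r > 0` for `|r| ≥ δ`. -/
structure IsLayerProfile (f g φ θ : ℝ → ℝ) (δ c K ε : ℝ) (h : ℝ → ℝ) : Prop where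
  contDiff : ContDiff ℝ 1 h
  mem : ∀ r, h r ∈ Icc (0 : ℝ) 1
  inner : ∀ r, |r| ≤ δ / 2 → h r = θ (r / ε)
  outer_pos : ∀ r, δ ≤ r → h r = 1
  outer_neg : ∀ r ≤ -δ, h r = 0
  deriv_outer : ∀ r, δ ≤ |r| → deriv h r = 0
  deriv_le : ∀ r, |deriv h r| ≤ K / ε * Real.exp (-(c * |r / ε|))
  potential_le : ∀ r, f (h r) ≤ K * Real.exp (-(c * |r / ε|))
  defect_le : ∀ r, ε / 2 * deriv h r ^ 2 + 1 / ε * f (h r) - φ (r / δ) * (g (h r) * deriv h r)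
    ≤ K * ε
  bulk_le : ∀ r, |(∫ s in (0 : ℝ)..h r, g s) - if 0 < r then 1 else 0| * |r| ≤ K * ε

/-- The profile is `η θ(·/ε) + (1-η) S` with a bump `η` and a smooth step `S`, both independent of
`ε`. Everything follows from one fact: `θ(r/ε)` and the glued profile differ from the indicator of
`r > 0` by at most `exp(-c|r|/ε)`. -/
lemma IsPotential.exists_layerProfile {f g φ θ : ℝ → ℝ} (h : IsPotential f g)
    (hφ : IsCutoffProfile φ) (hθ : IsHeteroclinic f θ) (hθd : ∀ z, HasDerivAt θ (g (θ z)) z)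
    {c : ℝ} (hc : 0 < c) (hneg : ∀ z ≤ 0, θ z ≤ Real.exp (-(c * |z|)))
    (hpos : ∀ z, 0 ≤ z → 1 - θ z ≤ Real.exp (-(c * |z|))) {δ : ℝ} (hδ : 0 < δ) :
    ∃ K : ℝ, 0 < K ∧ ∀ ε : ℝ, 0 < ε → ε ≤ 1 → ∃ p : ℝ → ℝ, IsLayerProfile f g φ θ δ c K ε p := by
  obtain ⟨c', C, hc', hb⟩ := h.exists_bounds
  have hC : 0 < C := by
    have := hb (1 / 2) ⟨by norm_num, by norm_num⟩
    norm_num at this; linarith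
  let η : ContDiffBump (0 : ℝ) := ⟨δ / 2, δ, by linarith, by linarith⟩
  have hη1 : ∀ r : ℝ, |r| ≤ δ / 2 → η r = 1 := fun r hr =>
    η.one_of_mem_closedBall (by simpa [η] using hr)
  have hη0 : ∀ r : ℝ, δ ≤ |r| → η r = 0 := fun r hr =>
    η.zero_of_le_dist (by simpa [η] using hr)
  -- The extremal values of `η` force its derivative to vanish at the transition points `|r| = δ/2`
  -- and `|r| = δ` as well, so no boundary case has to be treated apart.
  have hηd1 : ∀ r : ℝ, |r| ≤ δ / 2 → deriv η r = 0 := fun r hr =>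
    IsLocalMax.deriv_eq_zero (Eventually.of_forall fun x => by rw [hη1 r hr]; exact η.le_one)
  have hηd0 : ∀ r : ℝ, δ ≤ |r| → deriv η r = 0 := fun r hr =>
    IsLocalMin.deriv_eq_zero (Eventually.of_forall fun x => by rw [hη0 r hr]; exact η.nonneg)
  have hηs : ContDiff ℝ 1 η := η.contDiff
  obtain ⟨B, hB⟩ : ∃ B, ∀ r, ‖deriv η r‖ ≤ B :=
    (hηs.continuous_deriv le_rfl).bounded_above_of_compact_support η.hasCompactSupport.deriv
  have hB0 : 0 ≤ B := (norm_nonneg _).trans (hB 0)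
  -- The transition of `S` takes place inside `|r| < δ/2`, where its coefficient `1 - η` is zero. So
  -- `S` acts as the indicator while keeping the glued profile `C¹`, and `(1-η)S'` vanishes
  -- identically.
  set S : ℝ → ℝ := fun r => Real.smoothTransition ((r + δ / 2) / δ) with hS
  have hS1 : ∀ r, δ / 2 ≤ r → S r = 1 := fun r hr =>
    Real.smoothTransition.one_of_one_le (by rw [le_div_iff₀ hδ]; linarith)
  have hS0 : ∀ r, r ≤ -(δ / 2) → S r = 0 := fun r hr =>
    Real.smoothTransition.zero_of_nonpos (div_nonpos_of_nonpos_of_nonneg (by linarith) hδ.le)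
  have hSm : ∀ r, S r ∈ Icc (0 : ℝ) 1 := fun r =>
    ⟨Real.smoothTransition.nonneg _, Real.smoothTransition.le_one _⟩
  have hSs : ContDiff ℝ 1 S := Real.smoothTransition.contDiff.comp (by fun_prop)
  have hSd : ∀ r, δ / 2 ≤ |r| → deriv S r = 0 := fun r hr => by
    rcases le_abs.1 hr with hr | hr
    · exact IsLocalMax.deriv_eq_zero
        (Eventually.of_forall fun x => by rw [hS1 r hr]; exact (hSm x).2)
    · exact IsLocalMin.deriv_eq_zero
        (Eventually.of_forall fun x => by rw [hS0 r (by linarith)]; exact (hSm x).1)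
  set K₁ := B + C with hK₁
  -- One summand for each bound: derivative, potential, defect in the outer region, defect in the
  -- inner region, bulk term.
  refine ⟨K₁ + C ^ 2 + (K₁ ^ 2 + C ^ 2 + C * K₁) * (4 / (c * δ)) ^ 2 + 4 * C ^ 2 / δ ^ 2 * (1 / c) ^ 2
    + C * (1 / c), by positivity, fun ε hε hε1 => ?_⟩
  set K := K₁ + C ^ 2 + (K₁ ^ 2 + C ^ 2 + C * K₁) * (4 / (c * δ)) ^ 2
    + 4 * C ^ 2 / δ ^ 2 * (1 / c) ^ 2 + C * (1 / c) with hK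
  have hKa : K₁ ≤ K := by rw [hK]; have : 0 < K₁ := by positivity
                          have : 0 < C ^ 2 + (K₁ ^ 2 + C ^ 2 + C * K₁) * (4 / (c * δ)) ^ 2
                            + 4 * C ^ 2 / δ ^ 2 * (1 / c) ^ 2 + C * (1 / c) := by positivity
                          linarith
  have hKb : C ^ 2 ≤ K := by
    have : 0 < K₁ + (K₁ ^ 2 + C ^ 2 + C * K₁) * (4 / (c * δ)) ^ 2
      + 4 * C ^ 2 / δ ^ 2 * (1 / c) ^ 2 + C * (1 / c) := by positivity
    linarith
  have hKc : (K₁ ^ 2 + C ^ 2 + C * K₁) * (4 / (c * δ)) ^ 2 ≤ K := by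
    have : 0 < K₁ + C ^ 2 + 4 * C ^ 2 / δ ^ 2 * (1 / c) ^ 2 + C * (1 / c) := by positivity
    linarith
  have hKd : 4 * C ^ 2 / δ ^ 2 * (1 / c) ^ 2 ≤ K := by
    have : 0 < K₁ + C ^ 2 + (K₁ ^ 2 + C ^ 2 + C * K₁) * (4 / (c * δ)) ^ 2 + C * (1 / c) := by
      positivity
    linarith
  have hKe : C * (1 / c) ≤ K := by
    have : 0 < K₁ + C ^ 2 + (K₁ ^ 2 + C ^ 2 + C * K₁) * (4 / (c * δ)) ^ 2
      + 4 * C ^ 2 / δ ^ 2 * (1 / c) ^ 2 := by positivity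
    linarith
  set p : ℝ → ℝ := fun r => η r * θ (r / ε) + (1 - η r) * S r with hp
  have hmem : ∀ r, p r ∈ Icc (0 : ℝ) 1 := fun r => by
    have h1 := η.nonneg' r
    have h2 := η.le_one (x := r)
    have h3 := hθ.mem (r / ε)
    have h4 := hSm r
    constructor
    · have := mul_nonneg h1 h3.1.le
      have := mul_nonneg (sub_nonneg.2 h2) h4.1
      simp only [hp]; linarith
    · have := mul_le_of_le_one_right h1 h3.2.le
      have := mul_le_of_le_one_right (sub_nonneg.2 h2) h4.2
      simp only [hp]; linarith
  set E : ℝ → ℝ := fun r => Real.exp (-(c * |r / ε|)) with hE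
  have hE0 : ∀ r, 0 < E r := fun r => Real.exp_pos _
  have hE1 : ∀ r, E r ≤ 1 := fun r => Real.exp_le_one_iff.2 (by simp; positivity)
  have hsgn : ∀ r, |θ (r / ε) - if 0 < r then 1 else 0| ≤ E r := fun r => by
    have h3 := hθ.mem (r / ε)
    split_ifs with hr
    · rw [abs_sub_comm, abs_of_nonneg (by linarith [h3.2])]
      exact hpos _ (by positivity)
    · rw [sub_zero, abs_of_pos h3.1]
      exact hneg _ (div_nonpos_of_nonpos_of_nonneg (not_lt.1 hr) hε.le)
  have hSsgn : ∀ r, δ / 2 ≤ |r| → S r = if 0 < r then 1 else 0 := fun r hr => by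
    rcases le_abs.1 hr with hr | hr
    · rw [hS1 r hr, if_pos (by linarith)]
    · rw [hS0 r (by linarith), if_neg (by linarith)]
  have hpsgn : ∀ r, |p r - if 0 < r then 1 else 0| ≤ E r := fun r => by
    have h1 := η.nonneg' r
    have h2 := η.le_one (x := r)
    rcases le_total |r| (δ / 2) with hr | hr
    · simpa [hp, hη1 r hr] using hsgn r
    · simp only [hp]
      rw [hSsgn r hr]
      have : η r * θ (r / ε) + (1 - η r) * (if 0 < r then 1 else 0) - (if 0 < r then 1 else 0)
        = η r * (θ (r / ε) - if 0 < r then 1 else 0) := by ring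
      rw [this, abs_mul, abs_of_nonneg h1]
      exact (mul_le_of_le_one_left (abs_nonneg _) h2).trans (hsgn r)
  -- For values in `[0,1]`, `s(1-s)` is at most the distance from `s` to either well; hence `g(p)`
  -- inherits the exponential decay.
  have hpp : ∀ r, p r * (1 - p r) ≤ E r := fun r => by
    have h1 := hmem r
    refine le_trans ?_ (hpsgn r)
    split_ifs
    · rw [abs_sub_comm, abs_of_nonneg (by linarith [h1.2])]
      exact mul_le_of_le_one_left (by linarith [h1.2]) h1.2
    · rw [sub_zero, abs_of_nonneg h1.1]
      exact mul_le_of_le_one_right h1.1 (by linarith [h1.1])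
  have hgp : ∀ r, g (p r) ≤ C * E r := fun r =>
    (hb _ (hmem r)).2.trans (mul_le_mul_of_nonneg_left (hpp r) hC.le)
  have hgp0 : ∀ r, 0 ≤ g (p r) := fun r => h.g_nonneg _ (hmem r).1
  have hEE : ∀ r, E r ^ 2 ≤ E r := fun r => by
    rw [sq]; exact mul_le_of_le_one_left (hE0 r).le (hE1 r)
  have hgp2 : ∀ r, g (p r) ^ 2 ≤ C ^ 2 * E r ^ 2 := fun r => by
    rw [← mul_pow]; exact pow_le_pow_left₀ (hgp0 r) (hgp r) 2
  have hfp : ∀ r, f (p r) ≤ C ^ 2 * E r := fun r => by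
    rw [h.f_eq _ (hmem r).1]
    nlinarith [hgp2 r, hEE r, sq_nonneg (g (p r)), mul_le_mul_of_nonneg_left (hEE r) (sq_nonneg C)]
  have hgθ : ∀ r, g (θ (r / ε)) ≤ C * E r := fun r => by
    have h3 := hθ.mem (r / ε)
    refine (hb _ ⟨h3.1.le, h3.2.le⟩).2.trans (mul_le_mul_of_nonneg_left ?_ hC.le)
    refine le_trans ?_ (hsgn r)
    split_ifs
    · rw [abs_sub_comm, abs_of_nonneg (by linarith [h3.2])]
      exact mul_le_of_le_one_left (by linarith [h3.2]) h3.2.le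
    · rw [sub_zero, abs_of_nonneg h3.1.le]
      exact mul_le_of_le_one_right h3.1.le (by linarith [h3.1])
  have hθs : ContDiff ℝ 1 fun r => θ (r / ε) :=
    (hθ.smooth.of_le (by norm_num)).comp (by fun_prop)
  have hpd : ∀ r, deriv p r = deriv η r * (θ (r / ε) - S r) + η r * (g (θ (r / ε)) / ε) := fun r => by
    have h1 : HasDerivAt η (deriv η r) r := (hηs.differentiable one_ne_zero r).hasDerivAt
    have h2 : HasDerivAt S (deriv S r) r := (hSs.differentiable one_ne_zero r).hasDerivAt
    have h3 : HasDerivAt (fun r => θ (r / ε)) (g (θ (r / ε)) / ε) r := by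
      simpa [div_eq_mul_inv, Function.comp_def] using
        (hθd (r / ε)).comp r ((hasDerivAt_id r).div_const ε)
    have h4 := ((h1.mul h3).add ((h1.const_sub 1).mul h2)).deriv
    change deriv p r = _ at h4
    rw [h4]
    have h5 : (1 - η r) * deriv S r = 0 := by
      rcases le_total |r| (δ / 2) with hr | hr
      · rw [hη1 r hr]; ring
      · rw [hSd r hr]; ring
    linear_combination h5
  have hpdin : ∀ r, |r| ≤ δ / 2 → deriv p r = g (p r) / ε := fun r hr => by
    rw [hpd, hηd1 r hr, hp]; simp [hη1 r hr]
  have hpdle : ∀ r, |deriv p r| ≤ K₁ / ε * E r := fun r => by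
    have h0 := η.nonneg' r
    have h0' := η.le_one (x := r)
    have h3 := hθ.mem (r / ε)
    have hg0 := h.g_nonneg _ h3.1.le
    rw [hpd]
    have h1 : |deriv η r * (θ (r / ε) - S r)| ≤ B / ε * E r := by
      have hBE : B * E r ≤ B / ε * E r := by
        refine mul_le_mul_of_nonneg_right ?_ (hE0 r).le
        rw [le_div_iff₀ hε]; exact mul_le_of_le_one_right hB0 hε1
      rcases le_total |r| (δ / 2) with hr | hr
      · rw [hηd1 r hr, zero_mul, abs_zero]; have := hE0 r; positivity
      · rw [abs_mul, hSsgn r hr]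
        exact (mul_le_mul (hB r) (hsgn r) (abs_nonneg _) hB0).trans hBE
    have h2 : |η r * (g (θ (r / ε)) / ε)| ≤ C / ε * E r := by
      rw [abs_of_nonneg (by positivity), div_mul_eq_mul_div]
      exact (mul_le_of_le_one_left (by positivity) h0').trans
        (div_le_div_of_nonneg_right (hgθ r) hε.le)
    calc _ ≤ _ := abs_add_le _ _
      _ ≤ B / ε * E r + C / ε * E r := add_le_add h1 h2
      _ = K₁ / ε * E r := by rw [hK₁]; ring
  have hyE : ∀ r, |r / ε| * E r ≤ 1 / c := fun r => mul_exp_neg_le hc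
  refine ⟨p, ?_, hmem, fun r hr => ?_, fun r hr => ?_, fun r hr => ?_, fun r hr => ?_, fun r => ?_,
    fun r => ?_, fun r => ?_, fun r => ?_⟩
  · exact (hηs.mul hθs).add ((contDiff_const.sub hηs).mul hSs)
  · simp [hp, hη1 r hr]
  · simp [hp, hη0 r (hr.trans (le_abs_self r)), hS1 r (by linarith)]
  · simp [hp, hη0 r ((le_neg.1 hr).trans (neg_le_abs r)), hS0 r (by linarith)]
  · simp [hpd, hη0 r hr, hηd0 r hr]
  · refine (hpdle r).trans ?_
    have := hE0 r
    change _ ≤ K / ε * E r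
    gcongr
  · exact (hfp r).trans (mul_le_mul_of_nonneg_right hKb (hE0 r).le)
  · have hφm := hφ.mem_Icc (r / δ)
    rcases le_total |r| (δ / 2) with hr | hr
    -- Inner region: equipartition. With `p' = g(p)/ε` the three terms collapse to `(1-φ) g(p)²/ε`,
    -- and the quadratic bound on `1-φ` is absorbed as `(|r|/ε · E)² ε`.
    · rw [hpdin r hr, h.f_eq _ (hmem r).1]
      have h1 : ε / 2 * (g (p r) / ε) ^ 2 + 1 / ε * (g (p r) ^ 2 / 2)
          - φ (r / δ) * (g (p r) * (g (p r) / ε)) = (1 - φ (r / δ)) * (g (p r) ^ 2 / ε) := by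
        field_simp; ring
      rw [h1]
      have h2 : |r / δ| ≤ 1 / 2 := by rw [abs_div, abs_of_pos hδ, div_le_iff₀ hδ]; linarith
      have h3 : 1 - φ (r / δ) ≤ 4 * (r / δ) ^ 2 := by linarith [hφ.lower _ h2]
      calc _ ≤ 4 * (r / δ) ^ 2 * (C ^ 2 * E r ^ 2 / ε) :=
            mul_le_mul h3 (div_le_div_of_nonneg_right (hgp2 r) hε.le) (by positivity) (by positivity)
        _ = 4 * C ^ 2 / δ ^ 2 * (|r / ε| * E r) ^ 2 * ε := by
            rw [mul_pow, sq_abs]; field_simp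
        _ ≤ 4 * C ^ 2 / δ ^ 2 * (1 / c) ^ 2 * ε := by
            have := hE0 r
            gcongr
            exact hyE r
        _ ≤ K * ε := mul_le_mul_of_nonneg_right hKd hε.le
    -- Outer region: no cancellation is needed. Each term is a multiple of `E/ε`, which is `O(ε)`
    -- once `|r| ≥ δ/2`.
    · have h1 : ε / 2 * deriv p r ^ 2 ≤ K₁ ^ 2 * (E r / ε) := by
        have h2 : deriv p r ^ 2 ≤ (K₁ / ε * E r) ^ 2 := by
          rw [← sq_abs]; exact pow_le_pow_left₀ (abs_nonneg _) (hpdle r) 2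
        calc ε / 2 * deriv p r ^ 2 ≤ ε / 2 * (K₁ / ε * E r) ^ 2 := by gcongr
          _ = K₁ ^ 2 * (E r ^ 2 / ε) / 2 := by field_simp
          _ ≤ K₁ ^ 2 * (E r ^ 2 / ε) := half_le_self (by positivity)
          _ ≤ _ := by gcongr; exact hEE r
      have h2 : 1 / ε * f (p r) ≤ C ^ 2 * (E r / ε) := by
        calc 1 / ε * f (p r) ≤ 1 / ε * (C ^ 2 * E r) := by gcongr; exact hfp r
          _ = _ := by field_simp
      have h3 : -(φ (r / δ) * (g (p r) * deriv p r)) ≤ C * K₁ * (E r / ε) := by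
        refine (neg_le_abs _).trans ?_
        rw [abs_mul, abs_mul, abs_of_nonneg hφm.1, abs_of_nonneg (hgp0 r)]
        refine (mul_le_of_le_one_left (mul_nonneg (hgp0 r) (abs_nonneg _)) hφm.2).trans ?_
        calc _ ≤ C * 1 * (K₁ / ε * E r) := by
              refine mul_le_mul ((hgp r).trans ?_) (hpdle r) (abs_nonneg _) (by positivity)
              gcongr; exact hE1 r
          _ = _ := by ring
      have h4 : E r / ε ≤ (4 / (c * δ)) ^ 2 * ε := by
        -- Writing the decay as a square yields two factors `1/ε · exp(-cδ/(4ε))`, each bounded,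
        -- with one power of `ε` left over.
        have h5 : E r ≤ Real.exp (-(c * δ / 4 * (1 / ε))) ^ 2 := by
          rw [← Real.exp_nat_mul]
          refine Real.exp_le_exp.2 ?_
          have : δ / 2 * (1 / ε) ≤ |r / ε| := by
            rw [abs_div, abs_of_pos hε, mul_one_div]; gcongr
          have := mul_le_mul_of_nonneg_left this hc.le
          push_cast
          linarith
        have h6 := mul_exp_neg_le (c := c * δ / 4) (y := 1 / ε) (by positivity)
        calc E r / ε ≤ Real.exp (-(c * δ / 4 * (1 / ε))) ^ 2 / ε := by gcongr
          _ = (1 / ε * Real.exp (-(c * δ / 4 * (1 / ε)))) ^ 2 * ε := by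
            rw [mul_pow]; field_simp
          _ ≤ (1 / (c * δ / 4)) ^ 2 * ε := by gcongr
          _ = _ := by field_simp
      calc _ ≤ (K₁ ^ 2 + C ^ 2 + C * K₁) * (E r / ε) := by linarith
        _ ≤ (K₁ ^ 2 + C ^ 2 + C * K₁) * ((4 / (c * δ)) ^ 2 * ε) := by gcongr
        _ = (K₁ ^ 2 + C ^ 2 + C * K₁) * (4 / (c * δ)) ^ 2 * ε := by ring
        _ ≤ K * ε := mul_le_mul_of_nonneg_right hKc hε.le
  · have hgi : ∀ a b, a ∈ Icc (0 : ℝ) 1 → b ∈ Icc (0 : ℝ) 1 → IntervalIntegrable g volume a b :=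
      fun a b ha hb => (h.g_continuousOn.mono
        (fun s hs => (le_inf ha.1 hb.1).trans hs.1)).intervalIntegrable
    have hle : ∀ a b, a ∈ Icc (0 : ℝ) 1 → b ∈ Icc (0 : ℝ) 1 → |∫ s in a..b, g s| ≤ C * |b - a| := by
      intro a b ha hb'
      rw [← Real.norm_eq_abs]
      refine intervalIntegral.norm_integral_le_of_norm_le_const fun s hs => ?_
      have hs' : s ∈ Icc (0 : ℝ) 1 :=
        ⟨(le_inf ha.1 hb'.1).trans hs.1.le, hs.2.trans (sup_le ha.2 hb'.2)⟩
      rw [Real.norm_eq_abs, abs_of_nonneg (h.g_nonneg s hs'.1)]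
      refine (hb s hs').2.trans (mul_le_of_le_one_right hC.le ?_)
      nlinarith [hs'.1, hs'.2]
    -- The normalization `∫₀¹ g = 1` makes the target value on the positive side the integral up to
    -- the well `1`; the error is then the integral of `g` between `p` and a well.
    have h1 : |(∫ s in (0 : ℝ)..p r, g s) - if 0 < r then 1 else 0| ≤ C * E r := by
      have h2 := hpsgn r
      refine le_trans ?_ (mul_le_mul_of_nonneg_left h2 hC.le)
      split_ifs
      · have h3 := intervalIntegral.integral_add_adjacent_intervals
          (hgi 0 (p r) (by simp) (hmem r)) (hgi (p r) 1 (hmem r) (by simp))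
        have h4 := hle (p r) 1 (hmem r) (by simp)
        rw [h.normalization] at h3
        rwa [show (∫ s in (0 : ℝ)..p r, g s) - 1 = -∫ s in p r..1, g s by linarith, abs_neg,
          abs_sub_comm]
      · simpa using hle 0 (p r) (by simp) (hmem r)
    calc _ ≤ C * E r * |r| := mul_le_mul_of_nonneg_right h1 (abs_nonneg _)
      _ = C * (|r / ε| * E r) * ε := by rw [abs_div, abs_of_pos hε]; field_simp
      _ ≤ C * (1 / c) * ε := by gcongr; exact hyE r
      _ ≤ K * ε := mul_le_mul_of_nonneg_right hKe hε.le

end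

section

/-! ### The signed distance -/

lemma abs_signedDistTo (I : Set Plane) (x : Plane) : |signedDistTo I x| = Metric.infDist x I := by
  unfold signedDistTo
  split_ifs <;> simp [abs_of_nonneg Metric.infDist_nonneg]

/-- The segment from `x` to `y` must meet `I`, since otherwise it would lie in one component of the
complement and `y` would be enclosed too. Distances add at the crossing point. -/
lemma infDist_add_infDist_le {I : Set Plane} {x y : Plane} (hx : x ∈ enclosed I)
    (hy : y ∉ enclosed I) : Metric.infDist x I + Metric.infDist y I ≤ dist x y := by
  by_cases h : ∃ z ∈ segment ℝ x y, z ∈ I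
  · obtain ⟨z, hz, hzI⟩ := h
    rw [← dist_add_dist_of_mem_segment hz, dist_comm z y]
    exact add_le_add (Metric.infDist_le_dist_of_mem hzI) (Metric.infDist_le_dist_of_mem hzI)
  · push Not at h
    refine absurd ?_ hy
    have hs : segment ℝ x y ⊆ Iᶜ := fun z hz => h z hz
    have hsub := (convex_segment x y).isPreconnected.subset_connectedComponentIn
      (left_mem_segment ℝ x y) hs
    refine ⟨hs (right_mem_segment ℝ x y), ?_⟩
    rw [← connectedComponentIn_eq (hsub (right_mem_segment ℝ x y))]
    exact hx.2

/-- On one side this is the Lipschitz bound for the distance; across `I` the two distances add up,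
which is the preceding crossing argument. -/
lemma lipschitzWith_signedDistTo (I : Set Plane) : LipschitzWith 1 (signedDistTo I) := by
  refine LipschitzWith.of_le_add fun x y => ?_
  have h1 : Metric.infDist x I ≤ Metric.infDist y I + dist x y :=
    Metric.infDist_le_infDist_add_dist
  have h2 : Metric.infDist y I ≤ Metric.infDist x I + dist y x :=
    Metric.infDist_le_infDist_add_dist
  rw [dist_comm y x] at h2
  have h3 := Metric.infDist_nonneg (x := x) (s := I)
  have h4 := Metric.infDist_nonneg (x := y) (s := I)
  have h5 := dist_nonneg (x := x) (y := y)
  unfold signedDistTo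
  split_ifs with hx hy hy
  · exact h1
  · linarith [infDist_add_infDist_le hx hy]
  · linarith
  · linarith

/-- Moving straight towards a nearest point decreases the distance at unit speed: the nearest point
bounds it above, the triangle inequality below. -/
lemma infDist_sub_smul {I : Set Plane} {x y : Plane} (hy : y ∈ I)
    (hxy : dist x y = Metric.infDist x I) {s : ℝ} (hs : s ∈ Icc (0 : ℝ) 1) :
    Metric.infDist (x - s • (x - y)) I = (1 - s) * Metric.infDist x I := by
  refine le_antisymm ?_ ?_
  · refine (Metric.infDist_le_dist_of_mem hy).trans ?_
    rw [dist_eq_norm, show x - s • (x - y) - y = (1 - s) • (x - y) by module, norm_smul,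
      Real.norm_of_nonneg (sub_nonneg.2 hs.2), ← dist_eq_norm, hxy]
  · have h1 : Metric.infDist x I ≤ Metric.infDist (x - s • (x - y)) I + dist x (x - s • (x - y)) :=
      Metric.infDist_le_infDist_add_dist
    rw [dist_eq_norm x (x - _), sub_sub_cancel, norm_smul, Real.norm_of_nonneg hs.1,
      ← dist_eq_norm, hxy] at h1
    linarith

/-- Where it is differentiable off the curve, the signed distance has gradient `± (x - y) / |x - y|`
for a nearest point `y`. -/
lemma gradient_signedDistTo {I : Set Plane} {x y : Plane} (hy : y ∈ I)
    (hxy : dist x y = Metric.infDist x I) (hpos : 0 < Metric.infDist x I)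
    (hd : DifferentiableAt ℝ (signedDistTo I) x) :
    ∃ σ : ℝ, σ ^ 2 = 1 ∧
      gradient (signedDistTo I) x = (σ / Metric.infDist x I) • (x - y) := by
  set d := signedDistTo I with hdd
  set ρ := Metric.infDist x I with hρ
  -- By continuity the sign of `d` is constant near a point off the curve.
  obtain ⟨σ, hσ, hev⟩ : ∃ σ : ℝ, σ ^ 2 = 1 ∧ ∀ᶠ z in 𝓝 x, d z = σ * Metric.infDist z I := by
    have hc : ContinuousAt d x := (lipschitzWith_signedDistTo I).continuous.continuousAt
    have habs := abs_signedDistTo I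
    rcases lt_or_gt_of_ne (show d x ≠ 0 from fun h0 => by
      have := habs x; rw [← hdd, h0, abs_zero] at this; exact hpos.ne this) with h | h
    · refine ⟨-1, by norm_num, ?_⟩
      filter_upwards [hc.eventually (gt_mem_nhds h)] with z hz
      rw [← habs z, ← hdd, abs_of_neg hz]; ring
    · refine ⟨1, by norm_num, ?_⟩
      filter_upwards [hc.eventually (lt_mem_nhds h)] with z hz
      rw [← habs z, ← hdd, abs_of_pos hz]; ring
  refine ⟨σ, hσ, ?_⟩
  -- The derivative towards `y` is computed twice, by the chain rule and from the explicit distance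
  -- on the segment. It is one-sided because the explicit formula holds only for `s` in `[0,1]`.
  have hline : HasDerivWithinAt (fun s : ℝ => d (x - s • (x - y))) (-(fderiv ℝ d x (x - y)))
      (Ici 0) 0 := by
    have h1 : HasDerivAt (fun s : ℝ => x - s • (x - y)) (-(x - y)) 0 := by
      simpa using ((hasDerivAt_id (0 : ℝ)).smul_const (x - y)).const_sub x
    have h2 : HasFDerivAt d (fderiv ℝ d x) (x - (0 : ℝ) • (x - y)) := by
      simpa using hd.hasFDerivAt
    simpa [Function.comp_def] using (h2.comp_hasDerivAt 0 h1).hasDerivWithinAt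
  have hline' : HasDerivWithinAt (fun s : ℝ => d (x - s • (x - y))) (-(σ * ρ)) (Ici 0) 0 := by
    have h1 : HasDerivWithinAt (fun s : ℝ => σ * ((1 - s) * ρ)) (-(σ * ρ)) (Ici 0) 0 := by
      have := (((hasDerivAt_id (0 : ℝ)).const_sub 1).mul_const ρ).const_mul σ
      simpa using this.hasDerivWithinAt
    have ht : Tendsto (fun s : ℝ => x - s • (x - y)) (𝓝 0) (𝓝 x) :=
      Continuous.tendsto' (by fun_prop) _ _ (by simp)
    refine h1.congr_of_eventuallyEq ?_ ?_
    · filter_upwards [nhdsWithin_le_nhds (ht.eventually hev),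
        Icc_mem_nhdsGE (show (0 : ℝ) < 1 by norm_num)] with s hs hs1
      rw [hs, infDist_sub_smul hy hxy hs1]
    · have := hev.self_of_nhds
      simpa using this
  have hslope : fderiv ℝ d x (x - y) = σ * ρ := by
    have := (uniqueDiffOn_Ici (0 : ℝ) 0 (by simp)).eq_deriv _ hline hline'
    linarith
  have hn : ‖gradient d x‖ ≤ 1 := by
    rw [gradient, LinearIsometryEquiv.norm_map]
    exact_mod_cast norm_fderiv_le_of_lipschitz ℝ (lipschitzWith_signedDistTo I)
  have hin : ⟪gradient d x, x - y⟫ = σ * ρ := by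
    rw [gradient, InnerProductSpace.toDual_symm_apply, hslope]
  have hxyn : ‖x - y‖ = ρ := by rw [← dist_eq_norm, hxy]
  have hσ' : (σ / ρ) ^ 2 * ρ ^ 2 = 1 := by field_simp; exact hσ
  -- The gradient has norm at most `1` and attains slope `±1` in the unit direction `(x-y)/ρ`:
  -- equality in Cauchy–Schwarz fixes it.
  have h0 : ‖gradient d x - (σ / ρ) • (x - y)‖ ^ 2 ≤ 0 := by
    rw [norm_sub_sq_real, inner_smul_right, hin, norm_smul, mul_pow, hxyn, Real.norm_eq_abs, sq_abs,
      hσ', show σ / ρ * (σ * ρ) = σ ^ 2 by field_simp, hσ]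
    nlinarith [norm_nonneg (gradient d x)]
  have h1 : ‖gradient d x - (σ / ρ) • (x - y)‖ = 0 := by
    have := norm_nonneg (gradient d x - (σ / ρ) • (x - y)); nlinarith
  exact sub_eq_zero.1 (norm_eq_zero.1 h1)

/-! ### Normal coordinates along a curve -/

/-- The unit normal `J γ' / |γ'|`. -/
def unitNormal (γ : ℝ → Plane) (t : ℝ) : Plane :=
  ‖deriv γ t‖⁻¹ • WithLp.toLp 2 ![-(deriv γ t 1), deriv γ t 0]

/-- The normal coordinates `(t, r) ↦ γ(t) + r N(t)`. -/
def normalCoord (γ : ℝ → Plane) (p : ℝ × ℝ) : Plane := γ p.1 + p.2 • unitNormal γ p.1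

namespace IsSmoothSimpleClosedCurve

variable {γ : ℝ → Plane}

lemma norm_sq_deriv (t : ℝ) : ‖deriv γ t‖ ^ 2 = deriv γ t 0 ^ 2 + deriv γ t 1 ^ 2 := by
  rw [EuclideanSpace.norm_sq_eq, Fin.sum_univ_two]; simp

lemma norm_unitNormal (h : IsSmoothSimpleClosedCurve γ) (t : ℝ) : ‖unitNormal γ t‖ = 1 := by
  have h0 : 0 < ‖deriv γ t‖ := norm_pos_iff.2 (h.regular t)
  have h1 : ‖(WithLp.toLp 2 ![-(deriv γ t 1), deriv γ t 0] : Plane)‖ ^ 2 = ‖deriv γ t‖ ^ 2 := by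
    rw [norm_sq_deriv, EuclideanSpace.norm_sq_eq, Fin.sum_univ_two]; simp; ring
  have h2 := (pow_left_inj₀ (norm_nonneg _) (norm_nonneg _) two_ne_zero).1 h1
  rw [unitNormal, norm_smul, norm_inv, norm_norm, h2, inv_mul_cancel₀ h0.ne']

lemma inner_unitNormal_deriv (t : ℝ) : ⟪unitNormal γ t, deriv γ t⟫ = 0 := by
  rw [unitNormal, inner_smul_left, PiLp.inner_apply, Fin.sum_univ_two]
  simp; right; ring

/-- In dimension two the orthogonal complement of `γ'` is the line spanned by the unit normal. -/
lemma eq_inner_smul_unitNormal (h : IsSmoothSimpleClosedCurve γ) {t : ℝ} {v : Plane}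
    (hv : ⟪v, deriv γ t⟫ = 0) : v = ⟪v, unitNormal γ t⟫ • unitNormal γ t := by
  have h0 : 0 < ‖deriv γ t‖ := norm_pos_iff.2 (h.regular t)
  have h1 := norm_sq_deriv (γ := γ) t
  rw [PiLp.inner_apply, Fin.sum_univ_two] at hv
  simp only [RCLike.inner_apply, conj_trivial] at hv
  have h2 : ⟪v, unitNormal γ t⟫ = ‖deriv γ t‖⁻¹ * (-(deriv γ t 1) * v 0 + deriv γ t 0 * v 1) := by
    rw [unitNormal, inner_smul_right, PiLp.inner_apply, Fin.sum_univ_two]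
    simp
  rw [h2, unitNormal, smul_smul]
  have h3 : ‖deriv γ t‖⁻¹ * ‖deriv γ t‖⁻¹ = (‖deriv γ t‖ ^ 2)⁻¹ := by rw [sq, mul_inv]
  have h4 : ‖deriv γ t‖ ^ 2 ≠ 0 := by positivity
  rw [mul_right_comm, h3]
  ext i
  fin_cases i
  · simp
    field_simp
    rw [h1]
    linear_combination (deriv γ t 0) * hv
  · simp
    field_simp
    rw [h1]
    linear_combination (deriv γ t 1) * hv

lemma contDiff_unitNormal (h : IsSmoothSimpleClosedCurve γ) : ContDiff ℝ 1 (unitNormal γ) := by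
  have hd : ContDiff ℝ 1 (deriv γ) := by
    have : ContDiff ℝ (1 + 1) γ := h.smooth.of_le (by norm_cast)
    exact (contDiff_succ_iff_deriv.1 this).2.2
  refine ContDiff.smul ((hd.norm ℝ h.regular).inv fun t => norm_ne_zero_iff.2 (h.regular t)) ?_
  rw [contDiff_euclidean] 
  have hc := contDiff_euclidean.1 hd
  intro i
  fin_cases i
  · simpa using (hc 1).neg
  · simpa using hc 0

lemma contDiff_normalCoord (h : IsSmoothSimpleClosedCurve γ) : ContDiff ℝ 1 (normalCoord γ) := by
  have h1 : ContDiff ℝ 1 γ := h.smooth.of_le (by norm_cast)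
  exact (h1.comp contDiff_fst).add (contDiff_snd.smul (h.contDiff_unitNormal.comp contDiff_fst))

lemma image_Ioc (h : IsSmoothSimpleClosedCurve γ) : γ '' Ioc 0 1 = range γ := by
  simpa using h.periodic.image_Ioc one_pos 0

lemma isCompact_range (h : IsSmoothSimpleClosedCurve γ) : IsCompact (range γ) :=
  h.periodic.compact_of_continuous one_ne_zero h.smooth.continuous

/-- Every point of the plane has normal coordinates `(t, r)` with `|r|` its distance to the
curve. -/
lemma exists_normalCoord (h : IsSmoothSimpleClosedCurve γ) (x : Plane) :
    ∃ t ∈ Ioc (0 : ℝ) 1, ∃ r : ℝ, |r| = Metric.infDist x (range γ) ∧ normalCoord γ (t, r) = x := by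
  obtain ⟨y, hy, hxy⟩ := h.isCompact_range.exists_infDist_eq_dist (range_nonempty γ) x
  rw [← h.image_Ioc] at hy
  obtain ⟨t, ht, rfl⟩ := hy
  have hd : HasDerivAt γ (deriv γ t) t := (h.smooth.differentiable (by norm_num) t).hasDerivAt
  -- First-order minimality of the squared distance makes `x - γ(t)` orthogonal to the curve.
  have hmin : IsLocalMin (fun s => ‖x - γ s‖ ^ 2) t := Eventually.of_forall fun s => by
    have : ‖x - γ t‖ ≤ ‖x - γ s‖ := by
      rw [← dist_eq_norm, ← dist_eq_norm, ← hxy]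
      exact Metric.infDist_le_dist_of_mem (mem_range_self s)
    exact pow_le_pow_left₀ (norm_nonneg _) this 2
  have hz := hmin.hasDerivAt_eq_zero (hd.const_sub x).norm_sq
  have horth : ⟪x - γ t, deriv γ t⟫ = 0 := by
    rw [inner_neg_right] at hz; linarith
  have hx := h.eq_inner_smul_unitNormal horth
  refine ⟨t, ht, ⟪x - γ t, unitNormal γ t⟫, ?_, ?_⟩
  · rw [hxy, dist_eq_norm]
    conv_rhs => rw [hx, norm_smul, h.norm_unitNormal, mul_one, Real.norm_eq_abs]
  · simp only [normalCoord]
    rw [← hx]; abel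

/-- When `|r|` is the true distance, `γ(t)` is a nearest point, so the gradient is the normal at `t`
up to sign. Squaring removes the sign, and the orientation of the curve never has to be determined.
-/
lemma sq_inner_gradient (h : IsSmoothSimpleClosedCurve γ) {t r : ℝ}
    (hr : |r| = Metric.infDist (normalCoord γ (t, r)) (range γ)) (hr0 : r ≠ 0)
    (hd : DifferentiableAt ℝ (signedDistTo (range γ)) (normalCoord γ (t, r))) (v : Plane) :
    ⟪v, gradient (signedDistTo (range γ)) (normalCoord γ (t, r))⟫ ^ 2 = ⟪v, unitNormal γ t⟫ ^ 2 := by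
  have hsub : normalCoord γ (t, r) - γ t = r • unitNormal γ t := by simp [normalCoord]
  obtain ⟨σ, hσ, hg⟩ := gradient_signedDistTo (mem_range_self t) (by
    rw [dist_eq_norm, hsub, norm_smul, h.norm_unitNormal, mul_one, Real.norm_eq_abs, hr])
    (by rw [← hr]; exact abs_pos.2 hr0) hd
  rw [hg, hsub, inner_smul_right, inner_smul_right, ← hr]
  have : |r| ^ 2 = r ^ 2 := sq_abs r
  have h1 : (|r|) ≠ 0 := abs_ne_zero.2 hr0
  rw [mul_pow, mul_pow, div_pow, hσ, this]
  field_simp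

lemma norm_gradient (h : IsSmoothSimpleClosedCurve γ) {x : Plane}
    (hx : 0 < Metric.infDist x (range γ)) (hd : DifferentiableAt ℝ (signedDistTo (range γ)) x) :
    ‖gradient (signedDistTo (range γ)) x‖ = 1 := by
  obtain ⟨y, hy, hxy⟩ := h.isCompact_range.exists_infDist_eq_dist (range_nonempty γ) x
  obtain ⟨σ, hσ, hg⟩ := gradient_signedDistTo hy hxy.symm hx hd
  have h1 : ‖gradient (signedDistTo (range γ)) x‖ ^ 2 = 1 := by
    rw [hg, norm_smul, ← dist_eq_norm, ← hxy, mul_pow, Real.norm_eq_abs, sq_abs, div_pow, hσ]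
    field_simp
  nlinarith [norm_nonneg (gradient (signedDistTo (range γ)) x)]

/-- Both are unit normals, so they are nonzero multiples of each other. -/
lemma inner_unitNormal_eq_zero (h : IsSmoothSimpleClosedCurve γ) {n : ℝ → Plane}
    (hn : IsInnerNormal γ n) {t : ℝ} {w : Plane} (hw : ⟪w, n t⟫ = 0) : ⟪w, unitNormal γ t⟫ = 0 := by
  have h1 := h.eq_inner_smul_unitNormal (hn.orthogonal t)
  have h2 := hn.unit t
  rw [h1, inner_smul_right] at hw
  rcases mul_eq_zero.1 hw with h3 | h3
  · rw [h1, h3] at h2; simp at h2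
  · exact h3

end IsSmoothSimpleClosedCurve

end

section

/-! ### Comparison of integrals in normal coordinates -/

/-- The plane as `ℝ × ℝ`. -/
def planeEquiv : Plane ≃L[ℝ] ℝ × ℝ :=
  (EuclideanSpace.equiv (Fin 2) ℝ).trans (ContinuousLinearEquiv.finTwoArrow ℝ ℝ)

lemma measurePreserving_planeEquiv : MeasurePreserving planeEquiv :=
  (volume_preserving_finTwoArrow ℝ).comp (PiLp.volume_preserving_ofLp (Fin 2))

/-- The integrals over `A` and over `Φ(A)` are comparable up to the factor `C`. -/
def ComparableOn (Φ : ℝ × ℝ → Plane) (C : ℝ≥0) (U : Set (ℝ × ℝ)) : Prop :=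
  ∀ A ⊆ U, MeasurableSet A → ∀ H : Plane → ℝ≥0∞,
    ∫⁻ x in Φ '' A, H x ≤ C * ∫⁻ p in A, H (Φ p) ∧ ∫⁻ p in A, H (Φ p) ≤ C * ∫⁻ x in Φ '' A, H x

lemma ComparableOn.mono {Φ : ℝ × ℝ → Plane} {C : ℝ≥0} {U V : Set (ℝ × ℝ)}
    (h : ComparableOn Φ C U) (hVU : V ⊆ U) : ComparableOn Φ C V :=
  fun A hA => h A (hA.trans hVU)

/-- Constants add by subadditivity of the integral over the two images, which may overlap. This is
why injectivity is required only locally. -/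
lemma ComparableOn.union {Φ : ℝ × ℝ → Plane} {C D : ℝ≥0} {U V : Set (ℝ × ℝ)}
    (hU : ComparableOn Φ C U) (hV : ComparableOn Φ D V) (hm : MeasurableSet U) :
    ComparableOn Φ (C + D) (U ∪ V) := by
  intro A hA hAm H
  have h1 := hU (A ∩ U) inter_subset_right (hAm.inter hm) H
  have h2 := hV (A \ U) (fun x hx => (hA hx.1).resolve_left hx.2) (hAm.diff hm) H
  have hAe : A = A ∩ U ∪ A \ U := (inter_union_sdiff A U).symm
  constructor
  · calc ∫⁻ x in Φ '' A, H x = ∫⁻ x in Φ '' (A ∩ U) ∪ Φ '' (A \ U), H x := by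
          rw [← image_union, ← hAe]
      _ ≤ (∫⁻ x in Φ '' (A ∩ U), H x) + ∫⁻ x in Φ '' (A \ U), H x := lintegral_union_le _ _ _
      _ ≤ C * (∫⁻ p in A ∩ U, H (Φ p)) + D * ∫⁻ p in A \ U, H (Φ p) := add_le_add h1.1 h2.1
      _ ≤ C * (∫⁻ p in A, H (Φ p)) + D * ∫⁻ p in A, H (Φ p) := by
          gcongr
          · exact inter_subset_left
          · exact sdiff_subset
      _ = _ := by push_cast; ring
  · calc ∫⁻ p in A, H (Φ p) = ∫⁻ p in A ∩ U ∪ A \ U, H (Φ p) := by rw [← hAe]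
      _ ≤ (∫⁻ p in A ∩ U, H (Φ p)) + ∫⁻ p in A \ U, H (Φ p) := lintegral_union_le _ _ _
      _ ≤ C * (∫⁻ x in Φ '' (A ∩ U), H x) + D * ∫⁻ x in Φ '' (A \ U), H x := add_le_add h1.2 h2.2
      _ ≤ C * (∫⁻ x in Φ '' A, H x) + D * ∫⁻ x in Φ '' A, H x := by
          gcongr
          · exact inter_subset_left
          · exact sdiff_subset
      _ = _ := by push_cast; ring

/-- The inverse function theorem gives local injectivity, and continuity keeps the Jacobian between
half and twice its value at `a`; the rest is the change of variables formula. -/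
lemma exists_comparableOn_nhds {Φ : ℝ × ℝ → Plane} (hΦ : ContDiff ℝ 1 Φ) {a : ℝ × ℝ}
    (ha : Function.Injective (fderiv ℝ Φ a)) : ∃ U ∈ 𝓝 a, ∃ C : ℝ≥0, ComparableOn Φ C U := by
  set Ψ : ℝ × ℝ → ℝ × ℝ := fun p => planeEquiv (Φ p) with hΨ
  have hΨs : ContDiff ℝ 1 Ψ := planeEquiv.contDiff.comp hΦ
  have hΨd : ∀ p, HasFDerivAt Ψ (fderiv ℝ Ψ p) p := fun p =>
    (hΨs.differentiable one_ne_zero p).hasFDerivAt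
  have hinj : Function.Injective (fderiv ℝ Ψ a) := by
    have : fderiv ℝ Ψ a = (planeEquiv : Plane →L[ℝ] ℝ × ℝ).comp (fderiv ℝ Φ a) :=
      planeEquiv.comp_fderiv
    rw [this]
    exact planeEquiv.injective.comp ha
  let L : (ℝ × ℝ) ≃ₗ[ℝ] ℝ × ℝ := LinearEquiv.ofInjectiveEndo (fderiv ℝ Ψ a).toLinearMap hinj
  let L' : (ℝ × ℝ) ≃L[ℝ] ℝ × ℝ := L.toContinuousLinearEquiv
  have hL' : (L' : ℝ × ℝ →L[ℝ] ℝ × ℝ) = fderiv ℝ Ψ a := by ext <;> rfl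
  have hdet : (fderiv ℝ Ψ a).det ≠ 0 := by
    rw [← hL']
    exact (LinearEquiv.isUnit_det' L).ne_zero
  have hstrict : HasStrictFDerivAt Ψ (L' : ℝ × ℝ →L[ℝ] ℝ × ℝ) a := by
    rw [hL']
    exact hΨs.contDiffAt.hasStrictFDerivAt one_ne_zero
  have hinjU : ∀ᶠ V in (𝓝 a).smallSets, InjOn Ψ V := by
    let R := hstrict.toOpenPartialHomeomorph Ψ
    have : R.source ∈ 𝓝 a := R.open_source.mem_nhds hstrict.mem_toOpenPartialHomeomorph_source
    filter_upwards [eventually_smallSets.2 ⟨_, this, fun V hV => hV⟩] with V hV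
    exact R.injOn.mono hV
  obtain ⟨V, hV, hVinj⟩ := eventually_smallSets.1 hinjU
  set J : ℝ × ℝ → ℝ := fun p => |(fderiv ℝ Ψ p).det| with hJ
  have hJc : Continuous J :=
    (ContinuousLinearMap.continuous_det.comp (hΨs.continuous_fderiv one_ne_zero)).abs
  have hJa : 0 < J a := abs_pos.2 hdet
  -- The sum dominates both the Jacobian and its reciprocal on the chosen neighbourhood.
  set C : ℝ≥0 := Real.toNNReal (2 * J a + (J a / 2)⁻¹) with hC
  refine ⟨V ∩ {p | J a / 2 < J p ∧ J p < 2 * J a}, Filter.inter_mem hV ?_, C, ?_⟩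
  · exact (hJc.continuousAt.eventually (lt_mem_nhds (by linarith))).and
      (hJc.continuousAt.eventually (gt_mem_nhds (by linarith)))
  intro A hA hAm H
  have hcv : ∫⁻ x in Φ '' A, H x = ∫⁻ p in A, ENNReal.ofReal (J p) * H (Φ p) := by
    have h1 := lintegral_image_eq_lintegral_abs_det_fderiv_mul volume hAm
      (fun p _ => (hΨd p).hasFDerivWithinAt) (hVinj A fun p hp => (hA hp).1)
      (fun q => H (planeEquiv.symm q))
    have h2 := measurePreserving_planeEquiv.setLIntegral_comp_emb
      planeEquiv.toHomeomorph.measurableEmbedding (fun q => H (planeEquiv.symm q)) (Φ '' A)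
    rw [image_image] at h2
    simp only [ContinuousLinearEquiv.symm_apply_apply] at h2
    rw [h2, h1]
    simp [hΨ, hJ]
  have hCb : ∀ p ∈ A, ENNReal.ofReal (J p) ≤ C ∧ 1 ≤ C * ENNReal.ofReal (J p) := by
    intro p hp
    have h1 := (hA hp).2
    have hCe : (C : ℝ≥0∞) = ENNReal.ofReal (2 * J a + (J a / 2)⁻¹) := rfl
    have h3 : 0 < J a / 2 := by positivity
    rw [hCe]
    constructor
    · exact ENNReal.ofReal_le_ofReal (by have : 0 < (J a / 2)⁻¹ := by positivity
                                         linarith [h1.2])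
    · rw [← ENNReal.ofReal_mul (by positivity), ← ENNReal.ofReal_one]
      refine ENNReal.ofReal_le_ofReal ?_
      calc (1 : ℝ) = (J a / 2)⁻¹ * (J a / 2) := (inv_mul_cancel₀ h3.ne').symm
        _ ≤ (2 * J a + (J a / 2)⁻¹) * J p :=
          mul_le_mul (by linarith) h1.1.le h3.le (by positivity)
  rw [hcv]
  constructor
  · rw [← lintegral_const_mul' _ _ ENNReal.coe_ne_top]
    refine setLIntegral_mono' hAm fun p hp => ?_
    gcongr
    exact (hCb p hp).1
  · rw [← lintegral_const_mul' _ _ ENNReal.coe_ne_top]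
    refine setLIntegral_mono' hAm fun p hp => ?_
    rw [← mul_assoc]
    calc H (Φ p) = 1 * H (Φ p) := (one_mul _).symm
      _ ≤ _ := by gcongr; exact (hCb p hp).2

namespace IsSmoothSimpleClosedCurve

variable {γ : ℝ → Plane}

/-- On the curve itself the partial derivatives are `γ'` and the unit normal, which are orthogonal
and nonzero. -/
lemma injective_fderiv_normalCoord (h : IsSmoothSimpleClosedCurve γ) (t : ℝ) :
    Function.Injective (fderiv ℝ (normalCoord γ) (t, 0)) := by
  have hD : HasFDerivAt (normalCoord γ) (fderiv ℝ (normalCoord γ) (t, 0)) (t, 0) :=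
    (h.contDiff_normalCoord.differentiable one_ne_zero _).hasFDerivAt
  have h1 : fderiv ℝ (normalCoord γ) (t, 0) (1, 0) = deriv γ t := by
    have hl : HasDerivAt (fun s : ℝ => ((s, 0) : ℝ × ℝ)) (1, 0) t :=
      (hasDerivAt_id t).prodMk (hasDerivAt_const t 0)
    have := hD.comp_hasDerivAt t hl
    have h2 : (normalCoord γ ∘ fun s : ℝ => ((s, 0) : ℝ × ℝ)) = γ := by
      ext1 s; simp [normalCoord]
    rw [h2] at this
    exact this.deriv.symm
  have h2 : fderiv ℝ (normalCoord γ) (t, 0) (0, 1) = unitNormal γ t := by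
    have hl : HasDerivAt (fun s : ℝ => ((t, s) : ℝ × ℝ)) (0, 1) 0 :=
      (hasDerivAt_const _ t).prodMk (hasDerivAt_id (0 : ℝ))
    have h3 := hD.comp_hasDerivAt (0 : ℝ) hl
    have h4 : HasDerivAt (normalCoord γ ∘ fun s : ℝ => ((t, s) : ℝ × ℝ)) (unitNormal γ t) 0 := by
      simpa [normalCoord, Function.comp_def] using
        ((hasDerivAt_id (0 : ℝ)).smul_const (unitNormal γ t)).const_add (γ t)
    exact h3.unique h4
  refine (injective_iff_map_eq_zero _).2 fun p hp => ?_
  have h3 : p = p.1 • ((1, 0) : ℝ × ℝ) + p.2 • ((0, 1) : ℝ × ℝ) := by ext <;> simp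
  rw [h3, map_add, map_smul, map_smul, h1, h2] at hp
  have h4 := congrArg (fun v => ⟪unitNormal γ t, v⟫) hp
  have h5 := congrArg (fun v => ⟪deriv γ t, v⟫) hp
  have h6 := inner_unitNormal_deriv (γ := γ) t
  simp only [inner_add_right, inner_smul_right, h6, real_inner_comm (unitNormal γ t) (deriv γ t),
    real_inner_self_eq_norm_sq, h.norm_unitNormal, inner_zero_right] at h4 h5
  have h7 : ‖deriv γ t‖ ≠ 0 := norm_ne_zero_iff.2 (h.regular t)
  ext
  · simpa [h7] using h5
  · simpa using h4

/-- Compactness of `[0,1]` patches the local comparisons: constants add and widths take the minimum.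
Global injectivity of the normal coordinates is not used. -/
lemma exists_comparableOn (h : IsSmoothSimpleClosedCurve γ) :
    ∃ C : ℝ≥0, ∃ ρ : ℝ, 0 < ρ ∧
      ComparableOn (normalCoord γ) C (Icc 0 1 ×ˢ Ioo (-ρ) ρ) := by
  suffices hs : ∃ S : Set ℝ, IsOpen S ∧ Icc (0 : ℝ) 1 ⊆ S ∧ ∃ C : ℝ≥0, ∃ ρ : ℝ, 0 < ρ ∧
      ComparableOn (normalCoord γ) C (S ×ˢ Ioo (-ρ) ρ) by
    obtain ⟨S, _, hS, C, ρ, hρ, hC⟩ := hs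
    exact ⟨C, ρ, hρ, hC.mono (prod_mono_left hS)⟩
  refine isCompact_Icc.induction_on (p := fun T : Set ℝ => ∃ S : Set ℝ, IsOpen S ∧ T ⊆ S ∧
    ∃ C : ℝ≥0, ∃ ρ : ℝ, 0 < ρ ∧ ComparableOn (normalCoord γ) C (S ×ˢ Ioo (-ρ) ρ)) ?_ ?_ ?_ ?_
  · refine ⟨∅, isOpen_empty, le_rfl, 0, 1, one_pos, fun A hA _ H => ?_⟩
    have : A = ∅ := by simpa using hA
    simp [this]
  · rintro s t hst ⟨S, hS, hS', hC⟩
    exact ⟨S, hS, hst.trans hS', hC⟩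
  · rintro s t ⟨S, hS, hS', C, ρ, hρ, hC⟩ ⟨T, hT, hT', D, τ, hτ, hD⟩
    refine ⟨S ∪ T, hS.union hT, union_subset_union hS' hT', C + D, min ρ τ, by positivity, ?_⟩
    rw [union_prod]
    have hsub : ∀ σ, min ρ τ ≤ σ → Ioo (-min ρ τ) (min ρ τ) ⊆ Ioo (-σ) σ := fun σ hσ =>
      Ioo_subset_Ioo (neg_le_neg hσ) hσ
    exact (hC.mono (prod_mono_right (hsub _ (min_le_left _ _)))).union
      (hD.mono (prod_mono_right (hsub _ (min_le_right _ _)))) (hS.measurableSet.prod measurableSet_Ioo)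
  · intro t _
    obtain ⟨U, hU, C, hC⟩ := exists_comparableOn_nhds h.contDiff_normalCoord
      (h.injective_fderiv_normalCoord t)
    obtain ⟨ε, hε, hεU⟩ := Metric.mem_nhds_iff.1 hU
    refine ⟨Ioo (t - ε) (t + ε), mem_nhdsWithin_of_mem_nhds (Ioo_mem_nhds (by linarith) (by linarith)),
      Ioo (t - ε) (t + ε), isOpen_Ioo, le_rfl, C, ε, hε, hC.mono ?_⟩
    rintro ⟨s, r⟩ ⟨hs, hr⟩
    refine hεU ?_
    rw [← ball_prod_same, Real.ball_eq_Ioo, Real.ball_eq_Ioo]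
    exact ⟨hs, by simpa using hr⟩

end IsSmoothSimpleClosedCurve

end

section

/-! ### Trace estimates near the curve -/

lemma ennreal_add_sq_le (a b : ℝ≥0∞) : (a + b) ^ 2 ≤ 2 * a ^ 2 + 2 * b ^ 2 := by
  induction a with
  | top => simp
  | coe a =>
    induction b with
    | top => simp
    | coe b =>
      norm_cast
      rw [← mul_add]
      exact add_sq_le

lemma sq_lintegral_le {α : Type*} [MeasurableSpace α] {μ : Measure α} {b : α → ℝ≥0∞}
    (hb : AEMeasurable b μ) : (∫⁻ x, b x ∂μ) ^ 2 ≤ μ univ * ∫⁻ x, b x ^ 2 ∂μ := by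
  have h := ENNReal.lintegral_mul_le_Lp_mul_Lq μ Real.HolderConjugate.two_two
    (aemeasurable_const (b := (1 : ℝ≥0∞))) hb
  simp only [Pi.mul_apply, one_mul, ENNReal.one_rpow, lintegral_const] at h
  have h2 : ∀ x : ℝ≥0∞, (x ^ (1 / 2 : ℝ)) ^ 2 = x := fun x => by
    rw [← ENNReal.rpow_natCast, ← ENNReal.rpow_mul]; norm_num
  calc _ ≤ _ := pow_le_pow_left₀ zero_le h 2
    _ = _ := by
      rw [mul_pow, h2, h2]
      simp

/-- Fundamental theorem of calculus and Cauchy–Schwarz on the interval between `0` and `r`. The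
factor `|r|` is the origin of the gain of one power of `ε` in the divergence term. -/
lemma enorm_sub_sq_le {V : ℝ → Plane} {b : ℝ → ℝ≥0∞} {ρ r : ℝ} (hr : |r| < ρ)
    (hV : ContDiffOn ℝ 1 V (Ioo (-ρ) ρ)) (hb : Measurable b)
    (hVb : ∀ s ∈ Ioo (-ρ) ρ, ‖deriv V s‖ₑ ≤ b s) :
    ‖V r - V 0‖ₑ ^ 2 ≤ ENNReal.ofReal |r| * ∫⁻ s in Ioo (-ρ) ρ, b s ^ 2 := by
  have hρ : 0 < ρ := (abs_nonneg r).trans_lt hr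
  have key : ∀ x y : ℝ, -ρ < x → y < ρ → x ≤ y →
      ‖V y - V x‖ₑ ^ 2 ≤ ENNReal.ofReal (y - x) * ∫⁻ s in Ioo (-ρ) ρ, b s ^ 2 := by
    intro x y hx hy hxy
    have hsub : Icc x y ⊆ Ioo (-ρ) ρ := Icc_subset_Ioo hx hy
    calc ‖V y - V x‖ₑ ^ 2 ≤ (∫⁻ s in Icc x y, ‖deriv V s‖ₑ) ^ 2 := by
          gcongr
          exact enorm_sub_le_lintegral_deriv_of_contDiffOn_Icc (hV.mono hsub) hxy
      _ ≤ (∫⁻ s in Icc x y, b s) ^ 2 := by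
          gcongr 1
          exact setLIntegral_mono' measurableSet_Icc fun s hs => hVb s (hsub hs)
      _ ≤ _ := sq_lintegral_le hb.aemeasurable
      _ ≤ _ := by
          rw [Measure.restrict_apply_univ, Real.volume_Icc]
          gcongr
  rcases le_total 0 r with h | h
  · rw [abs_of_nonneg h] at hr ⊢
    simpa using key 0 r (by linarith) hr h
  · rw [abs_of_nonpos h] at hr ⊢
    rw [← enorm_neg, neg_sub]
    simpa using key r 0 (by linarith) hρ h

namespace IsSmoothSimpleClosedCurve

variable {γ : ℝ → Plane}

lemma infDist_normalCoord_le (h : IsSmoothSimpleClosedCurve γ) (t r : ℝ) :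
    Metric.infDist (normalCoord γ (t, r)) (range γ) ≤ |r| := by
  refine (Metric.infDist_le_dist_of_mem (mem_range_self t)).trans ?_
  simp [normalCoord, dist_eq_norm, norm_smul, h.norm_unitNormal]

lemma volume_range (h : IsSmoothSimpleClosedCurve γ) : volume (range γ) = 0 := by
  obtain ⟨C, ρ, hρ, hC⟩ := h.exists_comparableOn
  have h1 := (hC (Icc 0 1 ×ˢ {0}) (prod_mono_right (by simpa using hρ))
    (measurableSet_Icc.prod (measurableSet_singleton 0)) (fun _ => 1)).1
  have h2 : range γ ⊆ normalCoord γ '' (Icc 0 1 ×ˢ {0}) := by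
    rw [← h.image_Ioc]
    rintro _ ⟨t, ht, rfl⟩
    exact ⟨(t, 0), ⟨Ioc_subset_Icc_self ht, rfl⟩, by simp [normalCoord]⟩
  have h3 : volume (Icc (0 : ℝ) 1 ×ˢ ({0} : Set ℝ)) = 0 := by
    rw [Measure.volume_eq_prod, Measure.prod_prod]; simp
  refine measure_mono_null h2 (le_antisymm ?_ zero_le)
  simpa [h3] using h1

/-- Parameters `(t, r)` in which `|r|` is the distance to the curve and the signed distance is
differentiable. -/
def goodCoord (γ : ℝ → Plane) (ρ : ℝ) : Set (ℝ × ℝ) :=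
  (Ioc 0 1 ×ˢ Ioo (-ρ) ρ) ∩ {p | |p.2| = Metric.infDist (normalCoord γ p) (range γ) ∧ p.2 ≠ 0 ∧
    DifferentiableAt ℝ (signedDistTo (range γ)) (normalCoord γ p)}

lemma measurableSet_goodCoord (h : IsSmoothSimpleClosedCurve γ) (ρ : ℝ) :
    MeasurableSet (goodCoord γ ρ) := by
  have hc := h.contDiff_normalCoord.continuous
  refine (measurableSet_Ioc.prod measurableSet_Ioo).inter (MeasurableSet.inter ?_
    (MeasurableSet.inter ?_ ?_))
  · exact measurableSet_eq_fun (by fun_prop)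
      ((Metric.continuous_infDist_pt _).comp hc).measurable
  · exact (measurableSet_eq_fun measurable_snd measurable_const).compl
  · exact hc.measurable (measurableSet_of_differentiableAt ℝ _)

/-- Every point has coordinates realizing its distance; Rademacher's theorem and the vanishing area
of the curve discard the rest. -/
lemma ae_mem_image_goodCoord (h : IsSmoothSimpleClosedCurve γ) (ρ : ℝ) :
    ∀ᵐ x : Plane, Metric.infDist x (range γ) < ρ → x ∈ normalCoord γ '' goodCoord γ ρ := by
  filter_upwards [(lipschitzWith_signedDistTo (range γ)).ae_differentiableAt (μ := volume),
    compl_mem_ae_iff.2 h.volume_range] with x hx hx' hρ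
  obtain ⟨t, ht, r, hr, rfl⟩ := h.exists_normalCoord x
  refine ⟨(t, r), ⟨⟨ht, abs_lt.1 (hr ▸ hρ)⟩, hr, fun h0 => hx' ?_, hx⟩, rfl⟩
  simp only at h0
  exact ⟨t, by simp [normalCoord, h0]⟩

/-- Only good parameters need to be controlled, because their image already covers almost all of the
tube. -/
lemma setLIntegral_near_le (h : IsSmoothSimpleClosedCurve γ) {C : ℝ≥0} {ρ : ℝ}
    (hC : ComparableOn (normalCoord γ) C (Icc 0 1 ×ˢ Ioo (-ρ) ρ)) {H : Plane → ℝ≥0∞}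
    {F : ℝ × ℝ → ℝ≥0∞} (hHF : ∀ p ∈ goodCoord γ ρ, H (normalCoord γ p) ≤ F p) :
    ∫⁻ x in {x | Metric.infDist x (range γ) < ρ}, H x ≤ C * ∫⁻ p in Ioc 0 1 ×ˢ Ioo (-ρ) ρ, F p := by
  have hsub : goodCoord γ ρ ⊆ Ioc 0 1 ×ˢ Ioo (-ρ) ρ := inter_subset_left
  calc _ ≤ ∫⁻ x in normalCoord γ '' goodCoord γ ρ, H x :=
        lintegral_mono_set' (h.ae_mem_image_goodCoord ρ)
    _ ≤ C * ∫⁻ p in goodCoord γ ρ, H (normalCoord γ p) :=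
        (hC _ (hsub.trans (prod_mono_left Ioc_subset_Icc_self)) (h.measurableSet_goodCoord ρ) H).1
    _ ≤ C * ∫⁻ p in goodCoord γ ρ, F p := by
        gcongr 1
        exact setLIntegral_mono' (h.measurableSet_goodCoord ρ) hHF
    _ ≤ _ := by gcongr

/-- Integrals over a thin tube of functions of the distance. -/
lemma setLIntegral_infDist_le (h : IsSmoothSimpleClosedCurve γ) {C : ℝ≥0} {ρ : ℝ}
    (hC : ComparableOn (normalCoord γ) C (Icc 0 1 ×ˢ Ioo (-ρ) ρ)) {k : ℝ → ℝ≥0∞}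
    (hk : Measurable k) :
    ∫⁻ x in {x | Metric.infDist x (range γ) < ρ}, k (Metric.infDist x (range γ))
      ≤ C * ∫⁻ r in Ioo (-ρ) ρ, k |r| := by
  refine (h.setLIntegral_near_le hC (F := fun p => k |p.2|) fun p hp => by rw [← hp.2.1]).trans ?_
  gcongr 1
  rw [Measure.volume_eq_prod, setLIntegral_prod _ (by fun_prop)]
  simp

/-- The weighted trace inequality for smooth functions. -/
lemma setLIntegral_trace_le (h : IsSmoothSimpleClosedCurve γ) {C : ℝ≥0} {ρ : ℝ}
    (hC : ComparableOn (normalCoord γ) C (Icc 0 1 ×ˢ Ioo (-ρ) ρ)) (hρ : 0 < ρ) {k : ℝ → ℝ≥0∞}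
    (hk : Measurable k) {Ω : Set Plane} (hΩo : IsOpen Ω)
    (hΩ : ∀ x, Metric.infDist x (range γ) < ρ → x ∈ Ω) {v : Plane → Plane}
    (hv : ContDiffOn ℝ ∞ v Ω) :
    ∫⁻ x in {x | Metric.infDist x (range γ) < ρ},
        k (Metric.infDist x (range γ)) * ‖⟪v x, gradient (signedDistTo (range γ)) x⟫‖ₑ ^ 2
      ≤ 2 * C * (∫⁻ r in Ioo (-ρ) ρ, k |r|) * (∫⁻ t in Ioc (0 : ℝ) 1, ‖⟪v (γ t), unitNormal γ t⟫‖ₑ ^ 2)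
        + 2 * C ^ 2 * (∫⁻ r in Ioo (-ρ) ρ, k |r| * ENNReal.ofReal |r|)
          * ∫⁻ x in Ω, ‖fderiv ℝ v x‖ₑ ^ 2 := by
  set N := unitNormal γ with hN
  have hΦc := h.contDiff_normalCoord.continuous
  have hNc : Continuous N := h.contDiff_unitNormal.continuous
  set b : ℝ × ℝ → ℝ≥0∞ := fun p => ‖fderiv ℝ v (normalCoord γ p)‖ₑ with hb
  have hbm : Measurable b := ((measurable_fderiv ℝ v).comp hΦc.measurable).enorm
  set B : ℝ → ℝ≥0∞ := fun t => ∫⁻ s in Ioo (-ρ) ρ, b (t, s) ^ 2 with hB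
  have hBm : Measurable B := (hbm.pow_const 2).lintegral_prod_right'
  set Q : ℝ → ℝ≥0∞ := fun t => ‖⟪v (γ t), N t⟫‖ₑ ^ 2 with hQ
  have hmemΩ : ∀ t, ∀ s ∈ Ioo (-ρ) ρ, normalCoord γ (t, s) ∈ Ω := fun t s hs =>
    hΩ _ ((h.infDist_normalCoord_le t s).trans_lt (abs_lt.2 hs))
  have hQm : Measurable Q := by
    have hvc : Continuous fun t => v (γ t) := hv.continuousOn.comp_continuous h.smooth.continuous
      fun t => by simpa [normalCoord] using hmemΩ t 0 ⟨by linarith, hρ⟩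
    exact ((hvc.inner hNc).measurable.enorm).pow_const 2
  -- The normal component at height `r` is its value on the curve plus the increment along the
  -- normal line, which is bounded by `|r|` times the gradient energy `B` of that line.
  have hpt : ∀ p ∈ goodCoord γ ρ, k (Metric.infDist (normalCoord γ p) (range γ)) *
      ‖⟪v (normalCoord γ p), gradient (signedDistTo (range γ)) (normalCoord γ p)⟫‖ₑ ^ 2
      ≤ 2 * (Q p.1 * k |p.2|) + 2 * (B p.1 * (k |p.2| * ENNReal.ofReal |p.2|)) := by
    rintro ⟨t, r⟩ ⟨⟨ht, hr⟩, hrd, hr0, hd⟩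
    have e1 : ‖⟪v (normalCoord γ (t, r)), gradient (signedDistTo (range γ)) (normalCoord γ (t, r))⟫‖ₑ ^ 2
        = ‖⟪v (normalCoord γ (t, r)), N t⟫‖ₑ ^ 2 := by
      rw [← enorm_pow, ← enorm_pow, h.sq_inner_gradient hrd hr0 hd]
    have e2 : ‖⟪v (normalCoord γ (t, r)), N t⟫‖ₑ
        ≤ ‖⟪v (γ t), N t⟫‖ₑ + ‖v (normalCoord γ (t, r)) - v (γ t)‖ₑ := by
      have : ⟪v (normalCoord γ (t, r)), N t⟫
          = ⟪v (γ t), N t⟫ + ⟪v (normalCoord γ (t, r)) - v (γ t), N t⟫ := by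
        rw [← inner_add_left]; congr 1; abel
      rw [this]
      refine (enorm_add_le _ _).trans (add_le_add_right ?_ _)
      rw [enorm_le_iff_norm_le]
      simpa [hN, h.norm_unitNormal] using
        norm_inner_le_norm (𝕜 := ℝ) (v (normalCoord γ (t, r)) - v (γ t)) (N t)
    have hline : ∀ s, HasDerivAt (fun s => normalCoord γ (t, s)) (N t) s := fun s => by
      simpa [normalCoord] using ((hasDerivAt_id s).smul_const (N t)).const_add (γ t)
    have e3 : ‖v (normalCoord γ (t, r)) - v (γ t)‖ₑ ^ 2 ≤ ENNReal.ofReal |r| * B t := by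
      have := enorm_sub_sq_le (V := fun s => v (normalCoord γ (t, s))) (b := fun s => b (t, s))
        (ρ := ρ) (r := r) (abs_lt.2 hr) ?_ (hbm.comp measurable_prodMk_left) ?_
      · simpa [normalCoord] using this
      · refine (hv.of_le (by norm_cast)).comp (t := Ω) (ContDiff.contDiffOn ?_) (fun s hs => hmemΩ t s hs)
        exact h.contDiff_normalCoord.comp (by fun_prop)
      · intro s hs
        have hvd : HasFDerivAt v (fderiv ℝ v (normalCoord γ (t, s))) (normalCoord γ (t, s)) :=
          ((hv.contDiffAt (hΩo.mem_nhds (hmemΩ t s hs))).differentiableAt (by norm_num)).hasFDerivAt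
        have hd' := hvd.comp_hasDerivAt s (hline s)
        have : deriv (fun s => v (normalCoord γ (t, s))) s
          = fderiv ℝ v (normalCoord γ (t, s)) (N t) := hd'.deriv
        rw [this, hb, enorm_le_iff_norm_le]
        simpa [hN, h.norm_unitNormal] using
          (fderiv ℝ v (normalCoord γ (t, s))).le_opNorm (N t)
    rw [e1, ← hrd]
    calc _ ≤ k |r| * (2 * Q t + 2 * (ENNReal.ofReal |r| * B t)) := by
          gcongr
          refine (pow_le_pow_left₀ zero_le e2 2).trans ((ennreal_add_sq_le _ _).trans ?_)
          gcongr
      _ = _ := by ring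
  refine (h.setLIntegral_near_le hC hpt).trans ?_
  have hkm : Measurable fun r : ℝ => k |r| := by fun_prop
  have hkm' : Measurable fun r : ℝ => k |r| * ENNReal.ofReal |r| := by fun_prop
  rw [Measure.volume_eq_prod, ← Measure.prod_restrict, lintegral_add_left (by fun_prop),
    lintegral_const_mul _ (by fun_prop), lintegral_const_mul _ (by fun_prop),
    lintegral_prod_mul hQm.aemeasurable hkm.aemeasurable,
    lintegral_prod_mul hBm.aemeasurable hkm'.aemeasurable]
  -- Here the comparison of integrals is used in the opposite direction, from parameters back to the
  -- plane.
  have hBint : ∫⁻ t in Ioc (0 : ℝ) 1, B t ≤ C * ∫⁻ x in Ω, ‖fderiv ℝ v x‖ₑ ^ 2 := by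
    calc ∫⁻ t in Ioc (0 : ℝ) 1, B t = ∫⁻ p in Ioc 0 1 ×ˢ Ioo (-ρ) ρ, b p ^ 2 := by
          rw [Measure.volume_eq_prod, setLIntegral_prod _ (by fun_prop)]
      _ ≤ C * ∫⁻ x in normalCoord γ '' (Ioc 0 1 ×ˢ Ioo (-ρ) ρ), ‖fderiv ℝ v x‖ₑ ^ 2 :=
          (hC _ (prod_mono_left Ioc_subset_Icc_self) (measurableSet_Ioc.prod measurableSet_Ioo)
            fun x => ‖fderiv ℝ v x‖ₑ ^ 2).2
      _ ≤ _ := by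
          gcongr
          rintro _ ⟨⟨t, s⟩, ⟨_, hs⟩, rfl⟩
          exact hmemΩ t s hs
  calc _ ≤ (C : ℝ≥0∞) * (2 * ((∫⁻ t in Ioc (0 : ℝ) 1, Q t) * ∫⁻ r in Ioo (-ρ) ρ, k |r|)
        + 2 * ((C * ∫⁻ x in Ω, ‖fderiv ℝ v x‖ₑ ^ 2)
          * ∫⁻ r in Ioo (-ρ) ρ, k |r| * ENNReal.ofReal |r|)) := by gcongr
    _ = _ := by ring

end IsSmoothSimpleClosedCurve

end

section

/-! ### Weak gradients -/

section WeakGrad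

variable {V : Type*} [NormedAddCommGroup V] [NormedSpace ℝ V] {Ω : Set Plane}

lemma integrable_smul_of_locallyIntegrableOn {F : Plane → V} (hF : LocallyIntegrableOn F Ω)
    {φ : Plane → ℝ} (hφ : Continuous φ) (hφc : HasCompactSupport φ) (hφΩ : tsupport φ ⊆ Ω) :
    Integrable fun x => φ x • F x := by
  have h1 : IntegrableOn (fun x => φ x • F x) (tsupport φ) :=
    (hF.integrableOn_compact_subset hφΩ hφc).continuousOn_smul hφ.continuousOn hφc
  exact (integrableOn_iff_integrable_of_support_subset fun x hx =>
    subset_tsupport φ (by intro h0; simp [h0] at hx)).1 h1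

lemma LocallyIntegrableOn.clm_apply {G : Plane → Plane →L[ℝ] V} (hG : LocallyIntegrableOn G Ω)
    (e : Plane) : LocallyIntegrableOn (fun x => G x e) Ω := fun x hx => by
  obtain ⟨s, hs, hi⟩ := hG x hx
  exact ⟨s, hs, (ContinuousLinearMap.apply ℝ V e).integrable_comp hi⟩

lemma clm_ext_plane {A B : Plane →L[ℝ] V}
    (h : ∀ i : Fin 2, A (EuclideanSpace.single i 1) = B (EuclideanSpace.single i 1)) : A = B := by
  refine ContinuousLinearMap.coe_injective ((EuclideanSpace.basisFun (Fin 2) ℝ).toBasis.ext fun i => ?_)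
  simpa using h i

lemma IsWeakGrad.ae_eq [CompleteSpace V] (hΩ : IsOpen Ω) {u : Plane → V}
    {G G' : Plane → Plane →L[ℝ] V} (h : IsWeakGrad Ω u G) (h' : IsWeakGrad Ω u G') :
    G =ᵐ[volume.restrict Ω] G' := by
  have key : ∀ e : Plane, ∀ᵐ x, x ∈ Ω → G x e - G' x e = 0 := by
    intro e
    have hl := LocallyIntegrableOn.clm_apply h.2.1 e
    have hl' := LocallyIntegrableOn.clm_apply h'.2.1 e
    refine hΩ.ae_eq_zero_of_integral_contDiff_smul_eq_zero (hl.sub hl') fun φ hφ hφc hφΩ => ?_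
    have h1 := integrable_smul_of_locallyIntegrableOn hl hφ.continuous hφc hφΩ
    have h2 := integrable_smul_of_locallyIntegrableOn hl' hφ.continuous hφc hφΩ
    have h3 : ∀ F : Plane → V, ∫ x in Ω, φ x • F x = ∫ x, φ x • F x := fun F =>
      setIntegral_eq_integral_of_forall_compl_eq_zero fun x hx => by
        rw [image_eq_zero_of_notMem_tsupport fun hx' => hx (hφΩ hx'), zero_smul]
    have h4 := (h.2.2 φ hφ hφc hφΩ e).symm.trans (h'.2.2 φ hφ hφc hφΩ e)
    rw [neg_inj, h3, h3] at h4
    simp only [smul_sub]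
    rw [integral_sub h1 h2, h4, sub_self]
  refine (ae_restrict_iff' hΩ.measurableSet).2 ?_
  filter_upwards [key (EuclideanSpace.single 0 1), key (EuclideanSpace.single 1 1)] with x h0 h1 hx
  refine clm_ext_plane fun i => ?_
  fin_cases i
  · exact sub_eq_zero.1 (h0 hx)
  · exact sub_eq_zero.1 (h1 hx)

/-- Allows any explicit weak gradient to replace the one picked by choice in `weakGrad`. -/
lemma IsWeakGrad.weakGrad_ae_eq [CompleteSpace V] (hΩ : IsOpen Ω) {u : Plane → V}
    {G : Plane → Plane →L[ℝ] V} (h : IsWeakGrad Ω u G) :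
    weakGrad Ω u =ᵐ[volume.restrict Ω] G := by
  have hex : ∃ G : Plane → Plane →L[ℝ] V, IsWeakGrad Ω u G := ⟨G, h⟩
  rw [weakGrad, dif_pos hex]
  exact hex.choose_spec.ae_eq hΩ h

lemma MemH1.memLp_weakGrad [CompleteSpace V] (hΩ : IsOpen Ω) {u : Plane → V} (h : MemH1 Ω u) :
    MemLp (weakGrad Ω u) 2 (volume.restrict Ω) := by
  obtain ⟨-, G, hG, hG2⟩ := h
  exact (memLp_congr_ae (hG.weakGrad_ae_eq hΩ)).2 hG2

lemma isWeakGrad_of_integrable {u u' : Plane → V}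
    {G : Plane → Plane →L[ℝ] V} (hu : IntegrableOn u Ω) (hG : IntegrableOn G Ω)
    (huu' : u' =ᵐ[volume.restrict Ω] u)
    (h : ∀ φ : Plane → ℝ, ContDiff ℝ ∞ φ → HasCompactSupport φ → tsupport φ ⊆ Ω → ∀ v : Plane,
      ∫ x in Ω, fderiv ℝ φ x v • u x = -∫ x in Ω, φ x • G x v) : IsWeakGrad Ω u' G := by
  refine ⟨IntegrableOn.locallyIntegrableOn (hu.congr huu'.symm), hG.locallyIntegrableOn,
    fun φ h1 h2 h3 v => ?_⟩
  rw [← h φ h1 h2 h3 v]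
  refine integral_congr_ae ?_
  filter_upwards [huu'] with x hx
  rw [hx]

end WeakGrad

/-- Integration by parts of a Lipschitz function against the product of a test function with a
function that is smooth in `Ω`. -/
lemma integral_fderiv_mul_eq {Ω : Set Plane} (hΩ : IsOpen Ω) {a : Plane → ℝ} {K : ℝ≥0}
    (ha : LipschitzWith K a) {w : Plane → ℝ} (hw : ContDiffOn ℝ ∞ w Ω) {φ : Plane → ℝ}
    (hφ : ContDiff ℝ ∞ φ) (hφc : HasCompactSupport φ) (hφΩ : tsupport φ ⊆ Ω) (e : Plane) :
    ∫ x in Ω, fderiv ℝ a x e * (φ x * w x)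
      = -∫ x in Ω, a x * (fderiv ℝ φ x e * w x + φ x * fderiv ℝ w x e) := by
  set G : Plane → ℝ := fun x => φ x * w x with hG
  -- `w` is smooth only in `Ω`, but the product is globally smooth since the support of `φ` lies
  -- inside `Ω`.
  have hGs : ContDiff ℝ ∞ G := by
    refine contDiff_iff_contDiffAt.2 fun x => ?_
    by_cases hx : x ∈ tsupport φ
    · exact hφ.contDiffAt.mul (hw.contDiffAt (hΩ.mem_nhds (hφΩ hx)))
    · have : G =ᶠ[𝓝 x] fun _ => 0 := by
        filter_upwards [(isClosed_tsupport φ).isOpen_compl.mem_nhds hx] with y hy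
        simp [hG, image_eq_zero_of_notMem_tsupport hy]
      exact contDiffAt_const.congr_of_eventuallyEq this
  have hGc : HasCompactSupport G := hφc.mul_right
  obtain ⟨L, hL⟩ := hGs.lipschitzWith_of_hasCompactSupport hGc (by simp)
  have h1 := ha.integral_lineDeriv_mul_eq (μ := volume) hL hGc e
  have h2 : ∫ x, lineDeriv ℝ a x e * G x = ∫ x in Ω, fderiv ℝ a x e * G x := by
    rw [setIntegral_eq_integral_of_forall_compl_eq_zero fun x hx => by
      simp [hG, image_eq_zero_of_notMem_tsupport fun hx' => hx (hφΩ hx')]]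
    refine integral_congr_ae ?_
    filter_upwards [ha.ae_differentiableAt (μ := volume)] with x hx
    rw [hx.lineDeriv_eq_fderiv]
  have h3 : ∫ x, lineDeriv ℝ G x (-e) * a x
      = -∫ x in Ω, a x * (fderiv ℝ φ x e * w x + φ x * fderiv ℝ w x e) := by
    have hsupp : ∀ x, x ∉ Ω → fderiv ℝ G x e * a x = 0 := fun x hx => by
      have : x ∉ tsupport G := fun hx' => hx (hφΩ (tsupport_mul_subset_left hx'))
      rw [image_eq_zero_of_notMem_tsupport (fun h' => this (tsupport_fderiv_subset ℝ h'))]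
      simp
    rw [← integral_neg]
    have h4 : ∀ x, lineDeriv ℝ G x (-e) * a x = -(fderiv ℝ G x e * a x) := fun x => by
      rw [(hGs.differentiable (by simp) x).lineDeriv_eq_fderiv, map_neg]; ring
    simp_rw [h4]
    rw [← setIntegral_eq_integral_of_forall_compl_eq_zero fun x hx => by rw [hsupp x hx, neg_zero]]
    refine setIntegral_congr_fun hΩ.measurableSet fun x hx => ?_
    have hwd : DifferentiableAt ℝ w x :=
      (hw.contDiffAt (hΩ.mem_nhds hx)).differentiableAt (by simp)
    have hφd : DifferentiableAt ℝ φ x := hφ.differentiable (by simp) x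
    have := (hφd.hasFDerivAt.mul hwd.hasFDerivAt).fderiv
    change fderiv ℝ G x = _ at this
    simp only [this]
    simp
    ring
  rw [h2, h3] at h1
  exact h1

/-- Continuity of the `L²` inner product; it carries bilinear identities from smooth approximations
to the limit. -/
lemma tendsto_integral_inner {α E : Type*} [MeasurableSpace α] {μ : Measure α}
    [NormedAddCommGroup E] [InnerProductSpace ℝ E] {F H : ℕ → α → E} {f h : α → E}
    (hF : ∀ k, MemLp (F k) 2 μ) (hH : ∀ k, MemLp (H k) 2 μ) (hf : MemLp f 2 μ) (hh : MemLp h 2 μ)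
    (hFf : Tendsto (fun k => eLpNorm (F k - f) 2 μ) atTop (𝓝 0))
    (hHh : Tendsto (fun k => eLpNorm (H k - h) 2 μ) atTop (𝓝 0)) :
    Tendsto (fun k => ∫ x, ⟪F k x, H k x⟫ ∂μ) atTop (𝓝 (∫ x, ⟪f x, h x⟫ ∂μ)) := by
  have key : ∀ {p q : α → E} (hp : MemLp p 2 μ) (hq : MemLp q 2 μ),
      ⟪hp.toLp p, hq.toLp q⟫ = ∫ x, ⟪p x, q x⟫ ∂μ := fun hp hq => by
    rw [L2.inner_def]
    refine integral_congr_ae ?_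
    filter_upwards [hp.coeFn_toLp, hq.coeFn_toLp] with x h1 h2
    rw [h1, h2]
  have h1 := (Lp.tendsto_Lp_iff_tendsto_eLpNorm'' F hF f hf).2 hFf
  have h2 := (Lp.tendsto_Lp_iff_tendsto_eLpNorm'' H hH h hh).2 hHh
  have h3 := h1.inner (𝕜 := ℝ) h2
  simpa only [key] using h3

lemma memLp_integrable_inner {α E : Type*} [MeasurableSpace α] {μ : Measure α}
    [NormedAddCommGroup E] [InnerProductSpace ℝ E] {p q : α → E} (hp : MemLp p 2 μ)
    (hq : MemLp q 2 μ) : Integrable (fun x => ⟪p x, q x⟫) μ := by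
  refine (L2.integrable_inner (𝕜 := ℝ) (hp.toLp p) (hq.toLp q)).congr ?_
  filter_upwards [hp.coeFn_toLp, hq.coeFn_toLp] with x h1 h2
  rw [h1, h2]

lemma memLp_of_eLpNorm_sub_lt_top {α E : Type*} [MeasurableSpace α] {μ : Measure α}
    [NormedAddCommGroup E] {p : ℝ≥0∞} {F f : α → E} (hF : AEStronglyMeasurable F μ)
    (hf : MemLp f p μ) (h : eLpNorm (F - f) p μ < (⊤ : ℝ≥0∞)) : MemLp F p μ := by
  have h1 : MemLp (F - f) p μ := ⟨hF.sub hf.1, h⟩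
  have h2 := h1.add hf
  rwa [sub_add_cancel] at h2

lemma memLp_bdd_smul {α E : Type*} [MeasurableSpace α] {μ : Measure α} [NormedAddCommGroup E]
    [NormedSpace ℝ E] {p : ℝ≥0∞} {f : α → E} {a : α → ℝ} {B : ℝ} (ha : AEStronglyMeasurable a μ)
    (hB : ∀ x, ‖a x‖ ≤ B) (hf : MemLp f p μ) : MemLp (fun x => a x • f x) p μ :=
  hf.of_le_mul (c := B) (ha.smul hf.1) (Eventually.of_forall fun x => by
    rw [norm_smul]; exact mul_le_mul_of_nonneg_right (hB x) (norm_nonneg _))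

lemma memLp_smul_add_smulRight {α E F : Type*} [MeasurableSpace α] {μ : Measure α}
    [NormedAddCommGroup E] [NormedSpace ℝ E] [NormedAddCommGroup F] [NormedSpace ℝ F] {p : ℝ≥0∞}
    {f : α → F} {G : α → E →L[ℝ] F} {a : α → ℝ} {l : α → E →L[ℝ] ℝ} {A B : ℝ}
    (ha : AEStronglyMeasurable a μ) (hA : ∀ x, ‖a x‖ ≤ A) (hG : MemLp G p μ)
    (hl : AEStronglyMeasurable l μ) (hB : ∀ x, ‖l x‖ ≤ B) (hf : MemLp f p μ) :
    MemLp (fun x => a x • G x + (l x).smulRight (f x)) p μ := by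
  refine (memLp_bdd_smul ha hA hG).add (hf.of_le_mul (c := B) ?_ (Eventually.of_forall fun x => ?_))
  · exact (ContinuousLinearMap.smulRightL ℝ E F).aestronglyMeasurable_comp₂ hl hf.1
  · rw [ContinuousLinearMap.norm_smulRight_apply]
    exact mul_le_mul_of_nonneg_right (hB x) (norm_nonneg _)

/-- A sequence of functions smooth in `Ω` which converges to `u` in `H¹(Ω)`, where `G` is the weak
gradient of `u`. -/
structure SmoothApprox (Ω : Set Plane) (u : Plane → Plane) (G : Plane → Plane →L[ℝ] Plane)
    (v : ℕ → Plane → Plane) : Prop where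
  smooth : ∀ k, ContDiffOn ℝ ∞ (v k) Ω
  memLp : ∀ k, MemLp (v k) 2 (volume.restrict Ω)
  memLp_fderiv : ∀ k, MemLp (fderiv ℝ (v k)) 2 (volume.restrict Ω)
  tendsto : Tendsto (fun k => eLpNorm (v k - u) 2 (volume.restrict Ω)) atTop (𝓝 0)
  tendsto_fderiv : Tendsto (fun k => eLpNorm (fderiv ℝ (v k) - G) 2 (volume.restrict Ω)) atTop (𝓝 0)

lemma exists_smoothApprox {Ω : Set Plane} (hΩ : IsOpen Ω) {γ : ℝ → Plane} {u : Plane → Plane}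
    {w : ℝ → Plane} (hu : MemH1 Ω u) (h : IsTraceOn Ω γ u w) :
    ∃ v, SmoothApprox Ω u (weakGrad Ω u) v ∧
      Tendsto (fun k => eLpNorm (fun t => v k (γ t) - w t) 2 (volume.restrict (Ioc 0 1)))
        atTop (𝓝 0) := by
  obtain ⟨-, v, hv, h1, h2, h3⟩ := h
  have hG := hu.memLp_weakGrad hΩ
  -- The approximating functions are not assumed to be in `L²`. Discarding the terms not yet within
  -- distance `1` of the limit ensures it for the functions and their derivatives.
  obtain ⟨k₁, hk₁⟩ := eventually_atTop.1 (h1.eventually (gt_mem_nhds (show (0 : ℝ≥0∞) < 1 by simp)))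
  obtain ⟨k₂, hk₂⟩ := eventually_atTop.1 (h2.eventually (gt_mem_nhds (show (0 : ℝ≥0∞) < 1 by simp)))
  set N := max k₁ k₂
  have ht : Tendsto (fun k => k + N) atTop atTop := tendsto_add_atTop_nat N
  have hvm : ∀ k, AEStronglyMeasurable (v k) (volume.restrict Ω) := fun k =>
    (hv k).continuousOn.aestronglyMeasurable hΩ.measurableSet
  have hdm : ∀ k, AEStronglyMeasurable (fderiv ℝ (v k)) (volume.restrict Ω) := fun k =>
    (measurable_fderiv ℝ _).aestronglyMeasurable
  refine ⟨fun k => v (k + N), ⟨fun k => hv _, fun k => ?_, fun k => ?_, h1.comp ht, h2.comp ht⟩,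
    h3.comp ht⟩
  · exact memLp_of_eLpNorm_sub_lt_top (hvm _) hu.1 ((hk₁ (k + N) (by omega)).trans ENNReal.one_lt_top)
  · exact memLp_of_eLpNorm_sub_lt_top (hdm _) hG ((hk₂ (k + N) (by omega)).trans ENNReal.one_lt_top)

/-! ### Product rules obtained by smooth approximation -/

section Product

variable {Ω : Set Plane} {u : Plane → Plane} {G : Plane → Plane →L[ℝ] Plane}
  {v : ℕ → Plane → Plane}

lemma memLp_clm_apply {G : Plane → Plane →L[ℝ] Plane} {μ : Measure Plane} (hG : MemLp G 2 μ)
    (e : Plane) : MemLp (fun x => G x e) 2 μ :=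
  (ContinuousLinearMap.apply ℝ Plane e).comp_memLp' hG

lemma SmoothApprox.tendsto_fderiv_apply (h : SmoothApprox Ω u G v) (e : Plane) :
    Tendsto (fun k => eLpNorm ((fun x => fderiv ℝ (v k) x e) - fun x => G x e) 2
      (volume.restrict Ω)) atTop (𝓝 0) := by
  have h1 : Tendsto (fun k => ENNReal.ofReal ‖e‖ * eLpNorm (fderiv ℝ (v k) - G) 2
      (volume.restrict Ω)) atTop (𝓝 0) := by
    simpa only [mul_zero] using ENNReal.Tendsto.const_mul (a := ENNReal.ofReal ‖e‖)
      h.tendsto_fderiv (Or.inr ENNReal.ofReal_ne_top)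
  refine tendsto_of_tendsto_of_tendsto_of_le_of_le tendsto_const_nhds h1 (fun _ => zero_le)
    fun k => ?_
  refine eLpNorm_le_mul_eLpNorm_of_ae_le_mul (Eventually.of_forall fun x => ?_) 2
  rw [mul_comm]
  exact (fderiv ℝ (v k) x - G x).le_opNorm e

lemma memLp_smul_const {μ : Measure Plane} [IsFiniteMeasure μ] {m : Plane → ℝ}
    (hm : AEStronglyMeasurable m μ) {B : ℝ} (hB : ∀ x, ‖m x‖ ≤ B) (c : Plane) :
    MemLp (fun x => m x • c) 2 μ := by
  refine MemLp.of_bound (hm.smul_const c) (B * ‖c‖) (Eventually.of_forall fun x => ?_)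
  rw [norm_smul]
  exact mul_le_mul_of_nonneg_right (hB x) (norm_nonneg c)

lemma eLpNorm_self_sub {α E : Type*} [MeasurableSpace α] [NormedAddCommGroup E] (μ : Measure α)
    (f : α → E) (p : ℝ≥0∞) : Tendsto (fun _ : ℕ => eLpNorm (f - f) p μ) atTop (𝓝 0) := by
  simp

lemma aestronglyMeasurable_fderiv_apply {a : Plane → ℝ} (μ : Measure Plane) (e : Plane) :
    AEStronglyMeasurable (fun x => fderiv ℝ a x e) μ :=
  ((measurable_fderiv_apply_const ℝ a e).stronglyMeasurable).aestronglyMeasurable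

lemma exists_bound_test {φ : Plane → ℝ} (hφ : ContDiff ℝ ∞ φ) (hφc : HasCompactSupport φ)
    (e : Plane) : ∃ B, ∀ x, ‖φ x‖ ≤ B ∧ ‖fderiv ℝ φ x e‖ ≤ B := by
  obtain ⟨B₁, hB₁⟩ := hφ.continuous.bounded_above_of_compact_support hφc
  obtain ⟨B₂, hB₂⟩ := ((hφ.continuous_fderiv (by simp)).clm_apply
    (continuous_const (y := e))).bounded_above_of_compact_support (hφc.fderiv_apply (𝕜 := ℝ) e)
  exact ⟨max B₁ B₂, fun x => ⟨(hB₁ x).trans (le_max_left _ _), (hB₂ x).trans (le_max_right _ _)⟩⟩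

/-- The product rule for a Lipschitz function and an `H¹` function. -/
lemma SmoothApprox.isWeakGrad_smul (h : SmoothApprox Ω u G v) (hΩ : IsOpen Ω)
    (hΩb : Bornology.IsBounded Ω) (hu : MemLp u 2 (volume.restrict Ω))
    (hG : MemLp G 2 (volume.restrict Ω)) {a : Plane → ℝ} {K : ℝ≥0} (ha : LipschitzWith K a)
    {B : ℝ} (hB : ∀ x, ‖a x‖ ≤ B) :
    MemLp (fun x => a x • u x) 2 (volume.restrict Ω) ∧
    MemLp (fun x => a x • G x + (fderiv ℝ a x).smulRight (u x)) 2 (volume.restrict Ω) ∧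
    IsWeakGrad Ω (fun x => a x • u x) (fun x => a x • G x + (fderiv ℝ a x).smulRight (u x)) := by
  have : IsFiniteMeasure (volume.restrict Ω) := ⟨by
    rw [Measure.restrict_apply_univ]; exact hΩb.measure_lt_top⟩
  set μ := volume.restrict Ω with hμ
  have ham : AEStronglyMeasurable a μ := ha.continuous.aestronglyMeasurable
  have hfm : AEStronglyMeasurable (fderiv ℝ a) μ :=
    (measurable_fderiv ℝ a).aestronglyMeasurable
  have hfb : ∀ x, ‖fderiv ℝ a x‖ ≤ K := fun x => norm_fderiv_le_of_lipschitz ℝ ha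
  have h1 : MemLp (fun x => a x • u x) 2 μ := memLp_bdd_smul ham hB hu
  have h4 : MemLp (fun x => a x • G x + (fderiv ℝ a x).smulRight (u x)) 2 μ :=
    memLp_smul_add_smulRight ham hB hG hfm hfb hu
  refine ⟨h1, h4, ?_⟩
  refine isWeakGrad_of_integrable (h1.integrable (by norm_num))
    (h4.integrable (by norm_num)) (EventuallyEq.refl _ _) fun φ hφ hφc hφΩ e => ?_
  obtain ⟨D, hD⟩ := exists_bound_test hφ hφc e
  have hD0 : 0 ≤ D := (norm_nonneg _).trans (hD 0).1
  have hB0 : 0 ≤ B := (norm_nonneg _).trans (hB 0)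
  have hφm : AEStronglyMeasurable φ μ := hφ.continuous.aestronglyMeasurable
  have hm1 : ∀ c : Plane, MemLp (fun x => (fderiv ℝ a x e * φ x) • c) 2 μ := memLp_smul_const
    ((aestronglyMeasurable_fderiv_apply μ e).mul hφm) (B := K * ‖e‖ * D) fun x => by
      rw [norm_mul]
      exact mul_le_mul (((fderiv ℝ a x).le_opNorm e).trans
        (mul_le_mul_of_nonneg_right (hfb x) (norm_nonneg e))) (hD x).1 (norm_nonneg _) (by positivity)
  have hm2 : ∀ c : Plane, MemLp (fun x => (a x * fderiv ℝ φ x e) • c) 2 μ := memLp_smul_const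
    (ham.mul (aestronglyMeasurable_fderiv_apply μ e)) (B := B * D) fun x => by
      rw [norm_mul]; exact mul_le_mul (hB x) (hD x).2 (norm_nonneg _) hB0
  have hm3 : ∀ c : Plane, MemLp (fun x => (a x * φ x) • c) 2 μ := memLp_smul_const
    (ham.mul hφm) (B := B * D) fun x => by
      rw [norm_mul]; exact mul_le_mul (hB x) (hD x).1 (norm_nonneg _) hB0
  have hint : ∀ {p q : Plane → Plane}, MemLp p 2 μ → MemLp q 2 μ →
      Integrable (fun x => ⟪p x, q x⟫) μ := fun hp hq => memLp_integrable_inner hp hq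
  -- Pairing with a constant vector `c` reduces to scalar integration by parts, valid for each
  -- smooth approximant; both sides converge in `L²`.
  have hk : ∀ c : Plane, ∫ x, ⟪(fderiv ℝ a x e * φ x) • c, u x⟫ ∂μ
      = -(∫ x, ⟪(a x * fderiv ℝ φ x e) • c, u x⟫ ∂μ + ∫ x, ⟪(a x * φ x) • c, G x e⟫ ∂μ) := by
    intro c
    have l1 := tendsto_integral_inner (fun _ : ℕ => hm1 c) h.memLp (hm1 c) hu
      (eLpNorm_self_sub μ _ 2) h.tendsto
    have l2 := tendsto_integral_inner (fun _ : ℕ => hm2 c) h.memLp (hm2 c) hu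
      (eLpNorm_self_sub μ _ 2) h.tendsto
    have l3 := tendsto_integral_inner (fun _ : ℕ => hm3 c)
      (fun k => memLp_clm_apply (h.memLp_fderiv k) e) (hm3 c) (memLp_clm_apply hG e)
      (eLpNorm_self_sub μ _ 2) (h.tendsto_fderiv_apply e)
    refine tendsto_nhds_unique l1 ((l2.add l3).neg.congr fun k => ?_)
    have hw : ContDiffOn ℝ ∞ (fun x => ⟪c, v k x⟫) Ω := contDiffOn_const.inner ℝ (h.smooth k)
    have := integral_fderiv_mul_eq hΩ ha hw hφ hφc hφΩ e
    simp only [inner_smul_left, conj_trivial]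
    rw [← integral_add]
    · rw [eq_comm]
      convert this using 1
      · exact integral_congr_ae (Eventually.of_forall fun x => by ring)
      · congr 1
        refine setIntegral_congr_fun hΩ.measurableSet fun x hx => ?_
        have hvd : DifferentiableAt ℝ (v k) x :=
          ((h.smooth k).contDiffAt (hΩ.mem_nhds hx)).differentiableAt (by simp)
        have : fderiv ℝ (fun x => ⟪c, v k x⟫) x e = ⟪c, fderiv ℝ (v k) x e⟫ := by
          rw [fderiv_inner_apply ℝ (differentiableAt_const c) hvd]; simp
        simp only [this]
        ring
    · simpa [inner_smul_left] using hint (hm2 c) (h.memLp k)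
    · simpa [inner_smul_left] using hint (hm3 c) (memLp_clm_apply (h.memLp_fderiv k) e)
  refine ext_inner_left ℝ fun c => ?_
  have hi1 : Integrable (fun x => fderiv ℝ φ x e • a x • u x) μ :=
    (memLp_bdd_smul (aestronglyMeasurable_fderiv_apply μ e) (fun x => (hD x).2) h1).integrable
      (by norm_num)
  have hi2 : Integrable (fun x => φ x • (a x • G x + (fderiv ℝ a x).smulRight (u x)) e) μ :=
    (memLp_bdd_smul hφm (fun x => (hD x).1) (memLp_clm_apply h4 e)).integrable (by norm_num)
  rw [inner_neg_right, ← integral_inner hi1, ← integral_inner hi2]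
  have e1 : ∫ x, ⟪c, fderiv ℝ φ x e • a x • u x⟫ ∂μ = ∫ x, ⟪(a x * fderiv ℝ φ x e) • c, u x⟫ ∂μ :=
    integral_congr_ae (Eventually.of_forall fun x => by
      simp only [inner_smul_left, inner_smul_right, conj_trivial]; ring)
  have e2 : ∫ x, ⟪c, φ x • (a x • G x + (fderiv ℝ a x).smulRight (u x)) e⟫ ∂μ
      = ∫ x, ⟪(a x * φ x) • c, G x e⟫ ∂μ + ∫ x, ⟪(fderiv ℝ a x e * φ x) • c, u x⟫ ∂μ := by
    rw [← integral_add (hint (hm3 c) (memLp_clm_apply hG e)) (hint (hm1 c) hu)]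
    refine integral_congr_ae (Eventually.of_forall fun x => ?_)
    simp only [inner_smul_left, inner_smul_right, conj_trivial, add_apply,
      smul_apply, ContinuousLinearMap.smulRight_apply, inner_add_right]
    ring
  rw [e1, e2]
  linarith [hk c]

/-- If `|u| = 1` then `u` is orthogonal to its derivatives. -/
lemma SmoothApprox.ae_inner_eq_zero (h : SmoothApprox Ω u G v) (hΩ : IsOpen Ω)
    (hΩb : Bornology.IsBounded Ω) (hu : MemLp u 2 (volume.restrict Ω))
    (hG : MemLp G 2 (volume.restrict Ω)) (hu1 : ∀ᵐ x ∂(volume.restrict Ω), ‖u x‖ = 1) (e : Plane) :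
    ∀ᵐ x ∂(volume.restrict Ω), ⟪u x, G x e⟫ = 0 := by
  have : IsFiniteMeasure (volume.restrict Ω) := ⟨by
    rw [Measure.restrict_apply_univ]; exact hΩb.measure_lt_top⟩
  set μ := volume.restrict Ω with hμ
  refine (ae_restrict_iff' hΩ.measurableSet).2 ?_
  have hGe := memLp_clm_apply hG e
  have hinti : Integrable (fun x => ⟪u x, G x e⟫) μ := memLp_integrable_inner hu hGe
  refine hΩ.ae_eq_zero_of_integral_contDiff_smul_eq_zero
    (IntegrableOn.locallyIntegrableOn hinti) fun φ hφ hφc hφΩ => ?_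
  obtain ⟨D, hD⟩ := exists_bound_test hφ hφc e
  have hφm : AEStronglyMeasurable φ μ := hφ.continuous.aestronglyMeasurable
  have hφ'm : AEStronglyMeasurable (fun x => fderiv ℝ φ x e) μ := aestronglyMeasurable_fderiv_apply μ e
  have hsm : ∀ {m : Plane → ℝ} {p : Plane → Plane}, AEStronglyMeasurable m μ →
      (∀ x, ‖m x‖ ≤ D) → MemLp p 2 μ → MemLp (fun x => m x • p x) 2 μ := memLp_bdd_smul
  have hst : ∀ {m : Plane → ℝ}, (∀ x, ‖m x‖ ≤ D) →
      Tendsto (fun k => eLpNorm ((fun x => m x • v k x) - fun x => m x • u x) 2 μ) atTop (𝓝 0) := by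
    intro m hmD
    have h1 : Tendsto (fun k => ENNReal.ofReal D * eLpNorm (v k - u) 2 μ) atTop (𝓝 0) := by
      simpa using ENNReal.Tendsto.const_mul h.tendsto (Or.inr ENNReal.ofReal_ne_top)
    refine tendsto_of_tendsto_of_tendsto_of_le_of_le tendsto_const_nhds h1 (fun _ => zero_le)
      fun k => eLpNorm_le_mul_eLpNorm_of_ae_le_mul (Eventually.of_forall fun x => ?_) 2
    simp only [Pi.sub_apply]
    rw [← smul_sub, norm_smul]
    exact mul_le_mul_of_nonneg_right (hmD x) (norm_nonneg _)
  have l1 := tendsto_integral_inner (fun k => hsm hφ'm (fun x => (hD x).2) (h.memLp k)) h.memLp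
    (hsm hφ'm (fun x => (hD x).2) hu) hu (hst fun x => (hD x).2) h.tendsto
  have l2 := tendsto_integral_inner (fun k => hsm hφm (fun x => (hD x).1) (h.memLp k))
    (fun k => memLp_clm_apply (h.memLp_fderiv k) e) (hsm hφm (fun x => (hD x).1) hu) hGe
    (hst fun x => (hD x).1) (h.tendsto_fderiv_apply e)
  have l3 := l1.add (l2.const_mul 2)
  -- With the constant `1` as Lipschitz factor, integration by parts for `|v_k|²` is the weak form
  -- of `∂|v|² = 2 v·∂v`. In the limit `|u|² = 1` leaves only the integral of a derivative of `φ`,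
  -- which vanishes.
  have hone : LipschitzWith 0 (fun _ : Plane => (1 : ℝ)) := LipschitzWith.const 1
  have hz : ∀ k, (∫ x, ⟪fderiv ℝ φ x e • v k x, v k x⟫ ∂μ)
      + 2 * ∫ x, ⟪φ x • v k x, fderiv ℝ (v k) x e⟫ ∂μ = 0 := by
    intro k
    have hw : ContDiffOn ℝ ∞ (fun x => ⟪v k x, v k x⟫) Ω := (h.smooth k).inner ℝ (h.smooth k)
    have := integral_fderiv_mul_eq hΩ hone hw hφ hφc hφΩ e
    simp only [fderiv_fun_const, Pi.zero_apply, _root_.zero_apply, zero_mul,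
      integral_zero, one_mul] at this
    rw [eq_comm, neg_eq_zero] at this
    rw [← this, ← integral_const_mul, ← integral_add
      (memLp_integrable_inner (hsm hφ'm (fun x => (hD x).2) (h.memLp k)) (h.memLp k))
      ((memLp_integrable_inner (hsm hφm (fun x => (hD x).1) (h.memLp k))
        (memLp_clm_apply (h.memLp_fderiv k) e)).const_mul 2)]
    refine setIntegral_congr_fun hΩ.measurableSet fun x hx => ?_
    have hvd : DifferentiableAt ℝ (v k) x :=
      ((h.smooth k).contDiffAt (hΩ.mem_nhds hx)).differentiableAt (by simp)
    simp only [fderiv_inner_apply ℝ hvd hvd, inner_smul_left, conj_trivial,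
      real_inner_comm (v k x) (fderiv ℝ (v k) x e)]
    ring
  simp only [hz] at l3
  have l4 := tendsto_nhds_unique l3 tendsto_const_nhds
  have l5 : ∫ x, ⟪fderiv ℝ φ x e • u x, u x⟫ ∂μ = 0 := by
    have := integral_fderiv_mul_eq hΩ hone (contDiffOn_const (c := (1 : ℝ))) hφ hφc hφΩ e
    simp only [fderiv_fun_const, Pi.zero_apply, _root_.zero_apply, zero_mul,
      integral_zero, one_mul, mul_one, mul_zero, add_zero] at this
    rw [eq_comm, neg_eq_zero] at this
    rw [← this]
    refine integral_congr_ae ?_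
    filter_upwards [hu1] with x hx
    rw [inner_smul_left, real_inner_self_eq_norm_sq, hx]; simp
  rw [l5, zero_add] at l4
  have l6 : ∫ x in Ω, φ x • ⟪u x, G x e⟫ = 0 := by
    have : ∫ x, ⟪φ x • u x, G x e⟫ ∂μ = 0 := by linarith
    rw [← this]
    exact integral_congr_ae (Eventually.of_forall fun x => by simp [inner_smul_left])
  rw [← l6, setIntegral_eq_integral_of_forall_compl_eq_zero fun x hx => by
    rw [image_eq_zero_of_notMem_tsupport fun hx' => hx (hφΩ hx'), zero_smul]]

/-- A bounded Lipschitz function belongs to `H¹`. -/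
lemma isWeakGrad_of_lipschitz (hΩ : IsOpen Ω) (hΩb : Bornology.IsBounded Ω) {a b : Plane → ℝ}
    {K : ℝ≥0} (ha : LipschitzWith K a) {B : ℝ} (hB : ∀ x, ‖a x‖ ≤ B)
    (hab : b =ᵐ[volume.restrict Ω] a) :
    MemLp b 2 (volume.restrict Ω) ∧ MemLp (fderiv ℝ a) 2 (volume.restrict Ω) ∧
      IsWeakGrad Ω b (fderiv ℝ a) := by
  have : IsFiniteMeasure (volume.restrict Ω) := ⟨by
    rw [Measure.restrict_apply_univ]; exact hΩb.measure_lt_top⟩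
  have h1 : MemLp a 2 (volume.restrict Ω) := MemLp.of_bound ha.continuous.aestronglyMeasurable B
    (Eventually.of_forall hB)
  have h2 : MemLp (fderiv ℝ a) 2 (volume.restrict Ω) := MemLp.of_bound
    (measurable_fderiv ℝ a).aestronglyMeasurable K
    (Eventually.of_forall fun x => norm_fderiv_le_of_lipschitz ℝ ha)
  refine ⟨(memLp_congr_ae hab).2 h1, h2, isWeakGrad_of_integrable
    (h1.integrable (by norm_num)) (h2.integrable (by norm_num)) hab fun φ hφ hφc hφΩ e => ?_⟩
  have := integral_fderiv_mul_eq hΩ ha (contDiffOn_const (c := (1 : ℝ))) hφ hφc hφΩ e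
  simp only [mul_one, fderiv_fun_const, Pi.zero_apply, _root_.zero_apply, mul_zero,
    add_zero] at this
  simp only [smul_eq_mul, mul_comm (φ _), mul_comm (fderiv ℝ φ _ e), this, neg_neg]

end Product

end

section

/-! ### Weighted estimates near the curve -/

lemma eLpNorm_two_sq {α E : Type*} [MeasurableSpace α] {μ : Measure α} [NormedAddCommGroup E]
    (f : α → E) : eLpNorm f 2 μ ^ 2 = ∫⁻ x, ‖f x‖ₑ ^ 2 ∂μ := by
  have := eLpNorm_nnreal_pow_eq_lintegral (μ := μ) (f := f) (p := 2) two_ne_zero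
  simpa only [NNReal.coe_ofNat, ENNReal.rpow_ofNat, ENNReal.coe_ofNat] using this

lemma tendsto_lintegral_enorm_sq {α E : Type*} [MeasurableSpace α] {μ : Measure α}
    [NormedAddCommGroup E] {F : ℕ → α → E}
    (hF : Tendsto (fun k => eLpNorm (F k) 2 μ) atTop (𝓝 0)) :
    Tendsto (fun k => ∫⁻ x, ‖F k x‖ₑ ^ 2 ∂μ) atTop (𝓝 0) := by
  simp_rw [← eLpNorm_two_sq]
  simpa using ENNReal.Tendsto.pow (n := 2) hF

lemma enorm_sq_le {E : Type*} [NormedAddCommGroup E] (a b : E) :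
    ‖a‖ₑ ^ 2 ≤ 2 * ‖a - b‖ₑ ^ 2 + 2 * ‖b‖ₑ ^ 2 := by
  refine le_trans (pow_le_pow_left₀ zero_le ?_ 2) (ennreal_add_sq_le _ _)
  simpa using enorm_add_le (a - b) b

lemma lintegral_exp_neg_abs {b : ℝ} (hb : 0 < b) :
    ∫⁻ r : ℝ, ENNReal.ofReal (Real.exp (-(b * |r|))) = ENNReal.ofReal (2 / b) := by
  have h1 : ∫ r : ℝ, Real.exp (-(b * |r|)) = 2 / b := by
    rw [integral_comp_abs (f := fun r => Real.exp (-(b * r)))]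
    have := integral_exp_mul_Ioi (neg_lt_zero.2 hb) 0
    simp only [neg_mul] at this
    rw [this]
    simp; ring
  rw [← h1, ofReal_integral_eq_lintegral_ofReal]
  -- Integrability is read off from the value: a non-integrable function would have integral `0`,
  -- not `2/b`.
  · by_contra h
    rw [integral_undef h] at h1
    have : 0 < 2 / b := by positivity
    linarith
  · exact Eventually.of_forall fun r => (Real.exp_pos _).le

/-- The weight `ε⁻¹ exp(- c s / ε)`. -/
def layerWeight (c ε s : ℝ) : ℝ≥0∞ := ENNReal.ofReal (1 / ε * Real.exp (-(c * (s / ε))))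

lemma measurable_layerWeight (c ε : ℝ) : Measurable (layerWeight c ε) := by
  unfold layerWeight; fun_prop

lemma lintegral_layerWeight_le {c ε : ℝ} (hc : 0 < c) (hε : 0 < ε) :
    ∫⁻ r : ℝ, layerWeight c ε |r| ≤ ENNReal.ofReal (2 / c) := by
  have h1 : ∀ r : ℝ, layerWeight c ε |r|
      = ENNReal.ofReal (1 / ε) * ENNReal.ofReal (Real.exp (-(c / ε * |r|))) := fun r => by
    rw [layerWeight, ENNReal.ofReal_mul (by positivity)]
    congr 4; ring
  simp_rw [h1]
  rw [lintegral_const_mul _ (by fun_prop), lintegral_exp_neg_abs (by positivity),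
    ← ENNReal.ofReal_mul (by positivity)]
  refine ENNReal.ofReal_le_ofReal (le_of_eq ?_)
  field_simp

/-- Half of the exponential absorbs `|r|/ε`, and the other half has integral of order `ε`. -/
lemma lintegral_layerWeight_mul_le {c ε : ℝ} (hc : 0 < c) (hε : 0 < ε) :
    ∫⁻ r : ℝ, layerWeight c ε |r| * ENNReal.ofReal |r| ≤ ENNReal.ofReal (8 / c ^ 2 * ε) := by
  have h1 : ∀ r : ℝ, layerWeight c ε |r| * ENNReal.ofReal |r|
      ≤ ENNReal.ofReal (2 / c) * ENNReal.ofReal (Real.exp (-(c / (2 * ε) * |r|))) := fun r => by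
    rw [layerWeight, ← ENNReal.ofReal_mul (by positivity), ← ENNReal.ofReal_mul (by positivity)]
    refine ENNReal.ofReal_le_ofReal ?_
    have h2 := mul_exp_neg_le (c := c / 2) (y := |r| / ε) (by positivity)
    have h3 : Real.exp (-(c * (|r| / ε))) = Real.exp (-(c / 2 * (|r| / ε))) *
        Real.exp (-(c / (2 * ε) * |r|)) := by
      rw [← Real.exp_add]; congr 1; field_simp; ring
    calc _ = |r| / ε * Real.exp (-(c / 2 * (|r| / ε))) * Real.exp (-(c / (2 * ε) * |r|)) := by
          rw [h3]; ring
      _ ≤ 1 / (c / 2) * Real.exp (-(c / (2 * ε) * |r|)) := by gcongr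
      _ = _ := by field_simp
  refine (lintegral_mono h1).trans ?_
  rw [lintegral_const_mul _ (by fun_prop), lintegral_exp_neg_abs (by positivity),
    ← ENNReal.ofReal_mul (by positivity)]
  refine ENNReal.ofReal_le_ofReal (le_of_eq ?_)
  field_simp
  norm_num

/-- Away from the curve the weight is exponentially small, hence `O(ε)` without any information on
the vector field. -/
lemma layerWeight_le {c ε ρ s : ℝ} (hc : 0 < c) (hε : 0 < ε) (hρ : 0 < ρ) (hs : ρ ≤ s) :
    layerWeight c ε s ≤ ENNReal.ofReal ((2 / (c * ρ)) ^ 2 * ε) := by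
  refine ENNReal.ofReal_le_ofReal ?_
  have h1 := mul_exp_neg_le (c := c * ρ / 2) (y := 1 / ε) (by positivity)
  have h2 : Real.exp (-(c * (s / ε))) ≤ Real.exp (-(c * ρ / 2 * (1 / ε))) ^ 2 := by
    rw [← Real.exp_nat_mul]
    refine Real.exp_le_exp.2 ?_
    have : ρ * (1 / ε) ≤ s / ε := by rw [mul_one_div]; gcongr
    have := mul_le_mul_of_nonneg_left this hc.le
    push_cast; linarith
  calc _ ≤ 1 / ε * Real.exp (-(c * ρ / 2 * (1 / ε))) ^ 2 := by gcongr
    _ = (1 / ε * Real.exp (-(c * ρ / 2 * (1 / ε)))) ^ 2 * ε := by rw [mul_pow]; field_simp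
    _ ≤ (1 / (c * ρ / 2)) ^ 2 * ε := by gcongr
    _ = _ := by field_simp

namespace IsSmoothSimpleClosedCurve

variable {γ : ℝ → Plane}

lemma volume_tube_lt_top (h : IsSmoothSimpleClosedCurve γ) (δ : ℝ) :
    volume {x | Metric.infDist x (range γ) ≤ δ} < (⊤ : ℝ≥0∞) := by
  have hb : volume (Metric.thickening (δ + 1) (range γ)) < (⊤ : ℝ≥0∞) :=
    h.isCompact_range.isBounded.thickening.measure_lt_top
  refine (measure_mono fun x (hx : Metric.infDist x (range γ) ≤ δ) => ?_).trans_lt hb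
  refine Metric.mem_thickening_iff.2 ?_
  exact (Metric.infDist_lt_iff (range_nonempty γ)).1 (hx.trans_lt (lt_add_one δ))

/-- The weight has bounded mass on the tube. -/
lemma exists_layer_bound (h : IsSmoothSimpleClosedCurve γ) {c : ℝ} (hc : 0 < c) (δ : ℝ) :
    ∃ C : ℝ, 0 ≤ C ∧ ∀ ε, 0 < ε → ε ≤ 1 →
      ∫⁻ x in {x | Metric.infDist x (range γ) ≤ δ}, layerWeight c ε (Metric.infDist x (range γ))
        ≤ ENNReal.ofReal C := by
  obtain ⟨C, ρ, hρ, hC⟩ := h.exists_comparableOn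
  set V := volume {x | Metric.infDist x (range γ) ≤ δ} with hV
  have hVt : V < ⊤ := h.volume_tube_lt_top δ
  refine ⟨C * (2 / c) + (2 / (c * ρ)) ^ 2 * V.toReal, by positivity, fun ε hε hε1 => ?_⟩
  have hsub : {x | Metric.infDist x (range γ) ≤ δ} ⊆ {x | Metric.infDist x (range γ) < ρ} ∪
      ({x | Metric.infDist x (range γ) ≤ δ} ∩ {x | ρ ≤ Metric.infDist x (range γ)}) := fun x hx =>
    (lt_or_ge (Metric.infDist x (range γ)) ρ).imp id fun h' => ⟨hx, h'⟩
  refine (lintegral_mono_set hsub).trans ((lintegral_union_le _ _ _).trans ?_)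
  rw [ENNReal.ofReal_add (by positivity) (by positivity)]
  have hmeas : MeasurableSet ({x : Plane | Metric.infDist x (range γ) ≤ δ} ∩
      {x | ρ ≤ Metric.infDist x (range γ)}) :=
    (isClosed_le (Metric.continuous_infDist_pt _) continuous_const).measurableSet.inter
      (isClosed_le continuous_const (Metric.continuous_infDist_pt _)).measurableSet
  refine add_le_add ?_ ?_
  · refine (h.setLIntegral_infDist_le hC (measurable_layerWeight c ε)).trans ?_
    rw [ENNReal.ofReal_mul NNReal.zero_le_coe, ENNReal.ofReal_coe_nnreal]
    gcongr
    exact (setLIntegral_le_lintegral _ _).trans (lintegral_layerWeight_le hc hε)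
  · calc _ ≤ ∫⁻ x in {x | Metric.infDist x (range γ) ≤ δ} ∩ {x | ρ ≤ Metric.infDist x (range γ)},
          ENNReal.ofReal ((2 / (c * ρ)) ^ 2) := by
          refine setLIntegral_mono' hmeas fun x hx => (layerWeight_le hc hε hρ hx.2).trans
            (ENNReal.ofReal_le_ofReal (mul_le_of_le_one_right (by positivity) hε1))
      _ ≤ ENNReal.ofReal ((2 / (c * ρ)) ^ 2) * V := by
          rw [setLIntegral_const]
          gcongr
          exact measure_mono inter_subset_left
      _ = _ := by rw [ENNReal.ofReal_mul (by positivity), ENNReal.ofReal_toReal hVt.ne]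

/-- Since the limit trace has no normal component, that of `v_k` on the curve is at most `|v_k(γ) -
w|` and tends to `0`; only the gradient term of the trace inequality survives. The bound `κ` on the
weight serves only to replace `v_k` by `u` in the limit and does not enter the result. -/
lemma setLIntegral_trace_le_of_approx (h : IsSmoothSimpleClosedCurve γ) {n : ℝ → Plane}
    (hn : IsInnerNormal γ n) {C : ℝ≥0} {ρ : ℝ}
    (hC : ComparableOn (normalCoord γ) C (Icc 0 1 ×ˢ Ioo (-ρ) ρ)) (hρ : 0 < ρ) {k : ℝ → ℝ≥0∞}
    (hk : Measurable k) {κ : ℝ≥0∞} (hκ : κ ≠ (⊤ : ℝ≥0∞)) (hkκ : ∀ s, 0 ≤ s → k s ≤ κ)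
    (hk0 : ∫⁻ r in Ioo (-ρ) ρ, k |r| ≠ (⊤ : ℝ≥0∞))
    (hk1 : ∫⁻ r in Ioo (-ρ) ρ, k |r| * ENNReal.ofReal |r| ≠ (⊤ : ℝ≥0∞)) {Ω : Set Plane} (hΩo : IsOpen Ω)
    (hΩ : ∀ x, Metric.infDist x (range γ) < ρ → x ∈ Ω) {u : Plane → Plane}
    {G : Plane → Plane →L[ℝ] Plane} {v : ℕ → Plane → Plane} (hv : SmoothApprox Ω u G v)
    (hu : MemLp u 2 (volume.restrict Ω)) (hG : MemLp G 2 (volume.restrict Ω)) {w : ℝ → Plane}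
    (hw : ∀ᵐ t ∂(volume.restrict (Ioc (0 : ℝ) 1)), ⟪w t, n t⟫ = 0)
    (hvw : Tendsto (fun k => eLpNorm (fun t => v k (γ t) - w t) 2 (volume.restrict (Ioc 0 1)))
      atTop (𝓝 0)) :
    ∫⁻ x in {x | Metric.infDist x (range γ) < ρ},
        k (Metric.infDist x (range γ)) * ‖⟪u x, gradient (signedDistTo (range γ)) x⟫‖ₑ ^ 2
      ≤ 8 * C ^ 2 * (∫⁻ r in Ioo (-ρ) ρ, k |r| * ENNReal.ofReal |r|) * ∫⁻ x in Ω, ‖G x‖ₑ ^ 2 := by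
  set K₀ := ∫⁻ r in Ioo (-ρ) ρ, k |r| with hK₀
  set K₁ := ∫⁻ r in Ioo (-ρ) ρ, k |r| * ENNReal.ofReal |r| with hK₁
  set D : Set Plane := {x | Metric.infDist x (range γ) < ρ} with hD
  have hDm : MeasurableSet D :=
    (isOpen_lt (Metric.continuous_infDist_pt _) continuous_const).measurableSet
  set g := gradient (signedDistTo (range γ)) with hg
  have hg1 : ∀ x, ‖g x‖ ≤ 1 := fun x => by
    rw [hg, gradient, LinearIsometryEquiv.norm_map]
    exact_mod_cast norm_fderiv_le_of_lipschitz ℝ (lipschitzWith_signedDistTo (range γ))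
  set a : ℕ → ℝ≥0∞ := fun j => ∫⁻ t in Ioc (0 : ℝ) 1, ‖v j (γ t) - w t‖ₑ ^ 2 with ha
  set b : ℕ → ℝ≥0∞ := fun j => ∫⁻ x in Ω, ‖(fderiv ℝ (v j) - G) x‖ₑ ^ 2 with hb
  set e : ℕ → ℝ≥0∞ := fun j => ∫⁻ x in Ω, ‖(v j - u) x‖ₑ ^ 2 with he
  set I := ∫⁻ x in Ω, ‖G x‖ₑ ^ 2 with hI
  have ha0 : Tendsto a atTop (𝓝 0) := tendsto_lintegral_enorm_sq hvw
  have hb0 : Tendsto b atTop (𝓝 0) := tendsto_lintegral_enorm_sq hv.tendsto_fderiv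
  have he0 : Tendsto e atTop (𝓝 0) := tendsto_lintegral_enorm_sq hv.tendsto
  have hinner : ∀ (p q : Plane), ‖q‖ ≤ 1 → ‖⟪p, q⟫‖ₑ ≤ ‖p‖ₑ := fun p q hq => by
    rw [enorm_le_iff_norm_le]
    exact (norm_inner_le_norm p q).trans (mul_le_of_le_one_right (norm_nonneg p) hq)
  -- The constant 8 comes from three factors of 2: comparing `u` with `v_j`, the trace inequality
  -- itself, and comparing the gradient of `v_j` with `G`.
  have hstep : ∀ j, ∫⁻ x in D, k (Metric.infDist x (range γ)) * ‖⟪u x, g x⟫‖ₑ ^ 2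
      ≤ 4 * C * K₀ * a j + 8 * C ^ 2 * K₁ * b j + 8 * C ^ 2 * K₁ * I + 2 * κ * e j := by
    intro j
    have h1 : ∀ x, k (Metric.infDist x (range γ)) * ‖⟪u x, g x⟫‖ₑ ^ 2
        ≤ 2 * (k (Metric.infDist x (range γ)) * ‖⟪v j x, g x⟫‖ₑ ^ 2)
          + 2 * κ * ‖(v j - u) x‖ₑ ^ 2 := fun x => by
      have h2 : ‖⟪u x, g x⟫‖ₑ ^ 2 ≤ 2 * ‖⟪v j x, g x⟫‖ₑ ^ 2 + 2 * ‖(v j - u) x‖ₑ ^ 2 := by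
        refine le_trans (pow_le_pow_left₀ zero_le ?_ 2) (ennreal_add_sq_le _ _)
        have h3 : ⟪u x, g x⟫ = ⟪v j x, g x⟫ - ⟪(v j - u) x, g x⟫ := by
          rw [← inner_sub_left]; simp
        rw [h3]
        exact (enorm_sub_le).trans (add_le_add_right (hinner _ _ (hg1 x)) _)
      calc _ ≤ k (Metric.infDist x (range γ)) *
            (2 * ‖⟪v j x, g x⟫‖ₑ ^ 2 + 2 * ‖(v j - u) x‖ₑ ^ 2) := by gcongr
        _ = 2 * (k (Metric.infDist x (range γ)) * ‖⟪v j x, g x⟫‖ₑ ^ 2)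
          + 2 * k (Metric.infDist x (range γ)) * ‖(v j - u) x‖ₑ ^ 2 := by ring
        _ ≤ _ := by gcongr; exact hkκ _ Metric.infDist_nonneg
    have hm : AEMeasurable (fun x => 2 * κ * ‖(v j - u) x‖ₑ ^ 2) (volume.restrict D) := by
      have : AEStronglyMeasurable (v j - u) (volume.restrict D) :=
        ((hv.memLp j).1.sub hu.1).mono_measure (Measure.restrict_mono hΩ le_rfl)
      exact (this.enorm.pow_const 2).const_mul _
    have htr := h.setLIntegral_trace_le hC hρ hk hΩo hΩ (hv.smooth j)
    have hT : ∫⁻ t in Ioc (0 : ℝ) 1, ‖⟪v j (γ t), unitNormal γ t⟫‖ₑ ^ 2 ≤ a j := by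
      refine lintegral_mono_ae ?_
      filter_upwards [hw] with t ht
      have h3 : ⟪v j (γ t), unitNormal γ t⟫ = ⟪v j (γ t) - w t, unitNormal γ t⟫ := by
        rw [inner_sub_left, h.inner_unitNormal_eq_zero hn ht, sub_zero]
      rw [h3]
      exact pow_le_pow_left₀ zero_le (hinner _ _ (h.norm_unitNormal t).le) 2
    have hB : ∫⁻ x in Ω, ‖fderiv ℝ (v j) x‖ₑ ^ 2 ≤ 2 * b j + 2 * I := by
      have hGm : AEMeasurable (fun x => ‖(fderiv ℝ (v j) - G) x‖ₑ ^ 2) (volume.restrict Ω) :=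
        ((hv.memLp_fderiv j).1.sub hG.1).enorm.pow_const 2
      rw [← lintegral_const_mul'' _ hGm, ← lintegral_const_mul' _ _ (by simp),
        ← lintegral_add_left' (hGm.const_mul 2)]
      refine lintegral_mono fun x => ?_
      exact enorm_sq_le (fderiv ℝ (v j) x) (G x)
    calc _ ≤ ∫⁻ x in D, (2 * (k (Metric.infDist x (range γ)) * ‖⟪v j x, g x⟫‖ₑ ^ 2)
          + 2 * κ * ‖(v j - u) x‖ₑ ^ 2) := lintegral_mono h1
      _ = 2 * (∫⁻ x in D, k (Metric.infDist x (range γ)) * ‖⟪v j x, g x⟫‖ₑ ^ 2)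
          + 2 * κ * ∫⁻ x in D, ‖(v j - u) x‖ₑ ^ 2 := by
          rw [lintegral_add_right' _ hm, lintegral_const_mul' _ _ (by simp),
            lintegral_const_mul' _ _ (ENNReal.mul_ne_top (by simp) hκ)]
      _ ≤ 2 * (2 * C * K₀ * a j + 2 * C ^ 2 * K₁ * (2 * b j + 2 * I)) + 2 * κ * e j := by
          gcongr
          · refine htr.trans ?_
            gcongr
          · exact lintegral_mono_set hΩ
      _ = _ := by ring
  have hCt : (C : ℝ≥0∞) ≠ (⊤ : ℝ≥0∞) := ENNReal.coe_ne_top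
  have hlim : Tendsto (fun j => 4 * C * K₀ * a j + 8 * C ^ 2 * K₁ * b j + 8 * C ^ 2 * K₁ * I
      + 2 * κ * e j) atTop (𝓝 (4 * C * K₀ * 0 + 8 * C ^ 2 * K₁ * 0 + 8 * C ^ 2 * K₁ * I
      + 2 * κ * 0)) := by
    refine Tendsto.add (Tendsto.add (Tendsto.add ?_ ?_) tendsto_const_nhds) ?_
    · exact ENNReal.Tendsto.const_mul ha0 (Or.inr (by finiteness))
    · exact ENNReal.Tendsto.const_mul hb0 (Or.inr (by finiteness))
    · exact ENNReal.Tendsto.const_mul he0 (Or.inr (by finiteness))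
  simp only [mul_zero, zero_add, add_zero] at hlim
  exact ge_of_tendsto' hlim hstep

/-- The weighted trace inequality: the normal component of a unit vector field whose trace is
tangential is small near the curve. -/
lemma exists_trace_bound (h : IsSmoothSimpleClosedCurve γ) {n : ℝ → Plane}
    (hn : IsInnerNormal γ n) {c δ : ℝ} (hc : 0 < c) (hδ : 0 < δ) :
    ∃ C : ℝ, 0 ≤ C ∧ ∀ (Ω : Set Plane), IsOpen Ω → (∀ x, Metric.infDist x (range γ) ≤ δ → x ∈ Ω) →
      ∀ (u : Plane → Plane) (G : Plane → Plane →L[ℝ] Plane) (v : ℕ → Plane → Plane)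
        (w : ℝ → Plane), SmoothApprox Ω u G v → MemLp u 2 (volume.restrict Ω) →
        MemLp G 2 (volume.restrict Ω) → (∀ᵐ x ∂(volume.restrict Ω), ‖u x‖ = 1) →
        (∀ᵐ t ∂(volume.restrict (Ioc (0 : ℝ) 1)), ⟪w t, n t⟫ = 0) →
        Tendsto (fun k => eLpNorm (fun t => v k (γ t) - w t) 2 (volume.restrict (Ioc 0 1)))
          atTop (𝓝 0) → ∀ ε, 0 < ε → ε ≤ 1 →
        ∫⁻ x in {x | Metric.infDist x (range γ) ≤ δ}, layerWeight c ε (Metric.infDist x (range γ))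
          * ‖⟪u x, gradient (signedDistTo (range γ)) x⟫‖ₑ ^ 2
        ≤ ENNReal.ofReal (C * ε) * (1 + ∫⁻ x in Ω, ‖G x‖ₑ ^ 2) := by
  obtain ⟨C, ρ', hρ', hC'⟩ := h.exists_comparableOn
  set ρ := min ρ' δ with hρd
  have hρ : 0 < ρ := by positivity
  have hC : ComparableOn (normalCoord γ) C (Icc 0 1 ×ˢ Ioo (-ρ) ρ) :=
    hC'.mono (prod_mono_right (Ioo_subset_Ioo (neg_le_neg (min_le_left _ _)) (min_le_left _ _)))
  set S : Set Plane := {x | Metric.infDist x (range γ) ≤ δ} with hS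
  have hVt : volume S < ⊤ := h.volume_tube_lt_top δ
  refine ⟨8 * C ^ 2 * (8 / c ^ 2) + (2 / (c * ρ)) ^ 2 * (volume S).toReal, by positivity, ?_⟩
  intro Ω hΩo hΩ u G v w hv hu hG hu1 hw hvw ε hε hε1
  set I := ∫⁻ x in Ω, ‖G x‖ₑ ^ 2 with hI
  have hsub : S ⊆ {x | Metric.infDist x (range γ) < ρ} ∪
      (S ∩ {x | ρ ≤ Metric.infDist x (range γ)}) := fun x hx =>
    (lt_or_ge (Metric.infDist x (range γ)) ρ).imp id fun h' => ⟨hx, h'⟩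
  refine (lintegral_mono_set hsub).trans ((lintegral_union_le _ _ _).trans ?_)
  have hw0 := lintegral_layerWeight_le hc hε
  have hw1 := lintegral_layerWeight_mul_le hc hε
  -- The crude bound `1/ε` on the weight is harmless, as it multiplies only an error that vanishes
  -- in the limit at fixed `ε`.
  have hnear := h.setLIntegral_trace_le_of_approx hn hC hρ (measurable_layerWeight c ε)
    (κ := ENNReal.ofReal (1 / ε)) (by simp)
    (fun s hs => ENNReal.ofReal_le_ofReal (mul_le_of_le_one_right (by positivity)
      (Real.exp_le_one_iff.2 (by simp; positivity))))
    (((setLIntegral_le_lintegral _ _).trans hw0).trans_lt (by simp)).ne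
    (((setLIntegral_le_lintegral _ _).trans hw1).trans_lt (by simp)).ne hΩo
    (fun x hx => hΩ x (hx.le.trans (min_le_right _ _))) hv hu hG hw hvw
  -- Beyond distance `ρ` the estimate uses only `|u·∇d| ≤ 1`; this part is the reason for the `1 +`
  -- in the conclusion.
  have hfar : ∫⁻ x in S ∩ {x | ρ ≤ Metric.infDist x (range γ)},
      layerWeight c ε (Metric.infDist x (range γ))
          * ‖⟪u x, gradient (signedDistTo (range γ)) x⟫‖ₑ ^ 2
      ≤ ENNReal.ofReal ((2 / (c * ρ)) ^ 2 * ε) * volume S := by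
    have hmeas : MeasurableSet (S ∩ {x | ρ ≤ Metric.infDist x (range γ)}) :=
      (isClosed_le (Metric.continuous_infDist_pt _) continuous_const).measurableSet.inter
        (isClosed_le continuous_const (Metric.continuous_infDist_pt _)).measurableSet
    calc _ ≤ ∫⁻ x in S ∩ {x | ρ ≤ Metric.infDist x (range γ)},
          ENNReal.ofReal ((2 / (c * ρ)) ^ 2 * ε) := by
          refine lintegral_mono_ae ?_
          filter_upwards [self_mem_ae_restrict hmeas, ae_restrict_of_ae_restrict_of_subset
            (fun x hx => hΩ x hx.1 : S ∩ {x | ρ ≤ Metric.infDist x (range γ)} ⊆ Ω) hu1] with x hx hx1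
          refine (mul_le_of_le_one_right zero_le ?_).trans (layerWeight_le hc hε hρ hx.2)
          refine pow_le_one₀ zero_le ?_
          have h1 : ‖gradient (signedDistTo (range γ)) x‖ ≤ 1 := by
            rw [gradient, LinearIsometryEquiv.norm_map]
            exact_mod_cast norm_fderiv_le_of_lipschitz ℝ (lipschitzWith_signedDistTo (range γ))
          have h2 := norm_inner_le_norm (𝕜 := ℝ) (u x) (gradient (signedDistTo (range γ)) x)
          rw [hx1, one_mul] at h2
          rw [← ofReal_norm, ← ENNReal.ofReal_one]
          exact ENNReal.ofReal_le_ofReal (h2.trans h1)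
      _ ≤ _ := by
          rw [setLIntegral_const]
          gcongr
          exact inter_subset_left
  calc _ ≤ 8 * (C : ℝ≥0∞) ^ 2 * ENNReal.ofReal (8 / c ^ 2 * ε) * I
        + ENNReal.ofReal ((2 / (c * ρ)) ^ 2 * ε) * volume S := by
        refine add_le_add (hnear.trans ?_) hfar
        gcongr
        exact (setLIntegral_le_lintegral _ _).trans hw1
    _ ≤ ENNReal.ofReal (8 * C ^ 2 * (8 / c ^ 2) * ε) * (1 + I)
        + ENNReal.ofReal ((2 / (c * ρ)) ^ 2 * (volume S).toReal * ε) * (1 + I) := by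
        refine add_le_add ?_ ?_
        · have : ENNReal.ofReal (8 * C ^ 2 * (8 / c ^ 2) * ε)
              = 8 * (C : ℝ≥0∞) ^ 2 * ENNReal.ofReal (8 / c ^ 2 * ε) := by
            rw [mul_assoc, ENNReal.ofReal_mul (by positivity), ENNReal.ofReal_mul (by positivity),
              ENNReal.ofReal_pow (by positivity), ENNReal.ofReal_coe_nnreal]
            simp
          rw [this]
          gcongr
          exact le_add_self
        · have : ENNReal.ofReal ((2 / (c * ρ)) ^ 2 * (volume S).toReal * ε)
              = ENNReal.ofReal ((2 / (c * ρ)) ^ 2 * ε) * volume S := by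
            rw [mul_right_comm, ENNReal.ofReal_mul (by positivity), ENNReal.ofReal_toReal hVt.ne]
          rw [this]
          exact le_mul_of_one_le_right zero_le le_self_add
    _ = _ := by
        rw [← add_mul, ← ENNReal.ofReal_add (by positivity) (by positivity), ← add_mul]

end IsSmoothSimpleClosedCurve

end

section

/-! ### Pointwise algebra of gradients -/

lemma frobSq_eq (A : Plane →L[ℝ] Plane) : frobSq A =
    (A (EuclideanSpace.single 0 1) 0 ^ 2 + A (EuclideanSpace.single 1 1) 0 ^ 2)
      + (A (EuclideanSpace.single 0 1) 1 ^ 2 + A (EuclideanSpace.single 1 1) 1 ^ 2) := by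
  simp only [frobSq, Fin.sum_univ_two]

lemma frobSq_nonneg (A : Plane →L[ℝ] Plane) : 0 ≤ frobSq A := by
  rw [frobSq_eq]; positivity

lemma divOf_sq_le (A : Plane →L[ℝ] Plane) : divOf A ^ 2 ≤ 2 * frobSq A := by
  rw [frobSq_eq, divOf, Fin.sum_univ_two]
  nlinarith [sq_nonneg (A (EuclideanSpace.single 0 1) 0 - A (EuclideanSpace.single 1 1) 1),
    sq_nonneg (A (EuclideanSpace.single 1 1) 0), sq_nonneg (A (EuclideanSpace.single 0 1) 1)]

lemma norm_sq_le_frobSq (A : Plane →L[ℝ] Plane) : ‖A‖ ^ 2 ≤ frobSq A := by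
  have h : ‖A‖ ≤ Real.sqrt (frobSq A) := by
    refine A.opNorm_le_bound (Real.sqrt_nonneg _) fun x => ?_
    rw [← Real.sqrt_sq (norm_nonneg (A x)), ← Real.sqrt_sq (norm_nonneg x),
      ← Real.sqrt_mul (frobSq_nonneg A)]
    refine Real.sqrt_le_sqrt ?_
    have hx : x = x 0 • EuclideanSpace.single 0 (1 : ℝ) + x 1 • EuclideanSpace.single 1 (1 : ℝ) := by
      ext i; fin_cases i <;> simp
    have hA : A x = x 0 • A (EuclideanSpace.single 0 1) + x 1 • A (EuclideanSpace.single 1 1) := by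
      conv_lhs => rw [hx, map_add, map_smul, map_smul]
    rw [EuclideanSpace.norm_sq_eq, EuclideanSpace.norm_sq_eq, Fin.sum_univ_two, Fin.sum_univ_two, hA,
      frobSq_eq]
    simp only [PiLp.add_apply, PiLp.smul_apply, smul_eq_mul, Real.norm_eq_abs, sq_abs]
    nlinarith [sq_nonneg (x 0 * A (EuclideanSpace.single 1 1) 0 - x 1 * A (EuclideanSpace.single 0 1) 0),
      sq_nonneg (x 0 * A (EuclideanSpace.single 1 1) 1 - x 1 * A (EuclideanSpace.single 0 1) 1)]
  calc ‖A‖ ^ 2 ≤ Real.sqrt (frobSq A) ^ 2 := pow_le_pow_left₀ (norm_nonneg _) h 2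
    _ = _ := Real.sq_sqrt (frobSq_nonneg A)

/-- The cross term is a combination of the products `u·∂_j u`, which vanish; the rank-one part `u ⊗
q` has Frobenius norm `1`. -/
lemma frobSq_smul_add_smulRight {G : Plane →L[ℝ] Plane} {u q : Plane} {l : Plane →L[ℝ] ℝ} {a s : ℝ}
    (hl : ∀ v, l v = s * ⟪q, v⟫) (hq : ‖q‖ = 1) (hu : ‖u‖ = 1)
    (hG : ∀ j : Fin 2, ⟪u, G (EuclideanSpace.single j 1)⟫ = 0) :
    frobSq (a • G + l.smulRight u) = a ^ 2 * frobSq G + s ^ 2 := by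
  have hu2 : u 0 ^ 2 + u 1 ^ 2 = 1 := by
    have := EuclideanSpace.norm_sq_eq u
    rw [hu, Fin.sum_univ_two] at this; simp at this; linarith
  have hq2 : q 0 ^ 2 + q 1 ^ 2 = 1 := by
    have := EuclideanSpace.norm_sq_eq q
    rw [hq, Fin.sum_univ_two] at this; simp at this; linarith
  have h0 := hG 0
  have h1 := hG 1
  rw [PiLp.inner_apply, Fin.sum_univ_two] at h0 h1
  simp only [RCLike.inner_apply, conj_trivial] at h0 h1
  have e0 : l (EuclideanSpace.single 0 1) = s * q 0 := by
    rw [hl, EuclideanSpace.inner_single_right]; simp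
  have e1 : l (EuclideanSpace.single 1 1) = s * q 1 := by
    rw [hl, EuclideanSpace.inner_single_right]; simp
  simp only [frobSq_eq, add_apply, smul_apply, ContinuousLinearMap.smulRight_apply, PiLp.add_apply,
    PiLp.smul_apply, smul_eq_mul, e0, e1]
  linear_combination 2 * a * s * q 0 * h0 + 2 * a * s * q 1 * h1
    + s ^ 2 * (q 0 ^ 2 + q 1 ^ 2) * hu2 + s ^ 2 * hq2

lemma divOf_smul_add_smulRight (G : Plane →L[ℝ] Plane) {u q : Plane} {l : Plane →L[ℝ] ℝ} (a : ℝ)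
    {s : ℝ} (hl : ∀ v, l v = s * ⟪q, v⟫) :
    divOf (a • G + l.smulRight u) = a * divOf G + s * ⟪u, q⟫ := by
  have e0 : l (EuclideanSpace.single 0 1) = s * q 0 := by
    rw [hl, EuclideanSpace.inner_single_right]; simp
  have e1 : l (EuclideanSpace.single 1 1) = s * q 1 := by
    rw [hl, EuclideanSpace.inner_single_right]; simp
  rw [PiLp.inner_apply, Fin.sum_univ_two]
  simp only [divOf, Fin.sum_univ_two, add_apply, smul_apply, ContinuousLinearMap.smulRight_apply,
    PiLp.add_apply, PiLp.smul_apply, smul_eq_mul, e0, e1, RCLike.inner_apply, conj_trivial]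
  ring

lemma integrable_frobSq {G : Plane → Plane →L[ℝ] Plane} {μ : Measure Plane} (hG : MemLp G 2 μ) :
    Integrable (fun x => frobSq (G x)) μ := by
  have h : ∀ i j : Fin 2, Integrable (fun x => G x (EuclideanSpace.single j 1) i ^ 2) μ := fun i j =>
    ((EuclideanSpace.proj (𝕜 := ℝ) i).comp_memLp' (memLp_clm_apply hG _)).integrable_sq
  exact integrable_finsetSum _ fun i _ => integrable_finsetSum _ fun j _ => h i j

/-- If `f` is not integrable its Bochner integral is `0`, so no integrability of the energy
densities has to be checked. -/
lemma integral_le_of_ae_le {α : Type*} [MeasurableSpace α] {μ : Measure α} {f g : α → ℝ}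
    (h : f ≤ᵐ[μ] g) (hg : Integrable g μ) (hg0 : 0 ≤ ∫ x, g x ∂μ) :
    ∫ x, f x ∂μ ≤ ∫ x, g x ∂μ := by
  by_cases hf : Integrable f μ
  · exact integral_mono_ae hf hg h
  · rwa [integral_undef hf]

/-- A ball of radius `r` about a point of `I` misses the frontier, and being connected it stays in
`Ω`. -/
lemma mem_of_infDist_lt {Ω I : Set Plane} (hΩ : IsOpen Ω) (hne : I.Nonempty)
    (hIΩ : I ⊆ Ω) {r : ℝ} (hr : ∀ x ∈ I, ∀ y ∈ frontier Ω, r ≤ dist x y) {x : Plane}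
    (hx : Metric.infDist x I < r) : x ∈ Ω := by
  obtain ⟨y, hy, hxy⟩ := (Metric.infDist_lt_iff hne).1 hx
  by_contra hxΩ
  have hconn : IsPreconnected (Metric.ball y r) := (convex_ball y r).isPreconnected
  have hr0 : 0 < r := dist_nonneg.trans_lt hxy
  have hcl : ∀ z ∈ Metric.ball y r, z ∉ Ω → z ∈ (closure Ω)ᶜ := fun z hz hzΩ hzc => by
    have := hr y hy z (hΩ.frontier_eq ▸ ⟨hzc, hzΩ⟩)
    rw [Metric.mem_ball, dist_comm] at hz
    linarith
  obtain ⟨z, -, hz1, hz2⟩ := hconn Ω (closure Ω)ᶜ hΩ isClosed_closure.isOpen_compl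
    (fun z hz => or_iff_not_imp_left.2 (hcl z hz)) ⟨y, Metric.mem_ball_self hr0, hIΩ hy⟩
    ⟨x, hxy, hcl x hxy hxΩ⟩
  exact hz2 (subset_closure hz1)

lemma fderiv_comp_real {q : ℝ → ℝ} (hq : Differentiable ℝ q) {d : Plane → ℝ} {x : Plane}
    (hd : DifferentiableAt ℝ d x) (v : Plane) :
    fderiv ℝ (fun y => q (d y)) x v = deriv q (d x) * ⟪gradient d x, v⟫ := by
  have h1 := ((hq (d x)).hasDerivAt.comp_hasFDerivAt x hd.hasFDerivAt).fderiv
  simp only [Function.comp_def] at h1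
  rw [h1, gradient, InnerProductSpace.toDual_symm_apply]
  simp

lemma lipschitzWith_comp_of_deriv_le {q : ℝ → ℝ} (hq : Differentiable ℝ q) {B : ℝ}
    (hB : ∀ r, |deriv q r| ≤ B) {d : Plane → ℝ} (hd : LipschitzWith 1 d) :
    LipschitzWith (Real.toNNReal B) fun x => q (d x) := by
  have h1 : LipschitzWith (Real.toNNReal B) q := lipschitzWith_of_nnnorm_deriv_le hq fun r => by
    rw [← NNReal.coe_le_coe, coe_nnnorm, Real.norm_eq_abs]
    exact (hB r).trans (Real.le_coe_toNNReal B)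
  simpa [Function.comp_def] using h1.comp hd

namespace IsLayerProfile

variable {f g φ θ : ℝ → ℝ} {δ c K ε : ℝ} {p : ℝ → ℝ}

/-- `g` is controlled only on `[0,∞)`, so it is replaced by `s ↦ g|s|`, continuous on all of `ℝ`;
this covers points where the profile is `0`. -/
lemma hasDerivAt_integral (hp : IsLayerProfile f g φ θ δ c K ε p) (hfg : IsPotential f g) (r : ℝ) :
    HasDerivAt (fun r => ∫ s in (0 : ℝ)..p r, g s) (g (p r) * deriv p r) r := by
  have hg : Continuous fun s => g |s| :=
    hfg.g_continuousOn.comp_continuous continuous_abs fun s => abs_nonneg s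
  have h1 : (fun r => ∫ s in (0 : ℝ)..p r, g s) = fun r => ∫ s in (0 : ℝ)..p r, g |s| :=
    funext fun r => intervalIntegral.integral_congr fun s hs => by
      rw [uIcc_of_le (hp.mem r).1] at hs
      simp only [abs_of_nonneg hs.1]
  have h2 : HasDerivAt (fun y => ∫ s in (0 : ℝ)..y, g |s|) (g (p r)) (p r) := by
    have := intervalIntegral.integral_hasDerivAt_right (hg.intervalIntegrable 0 (p r))
      (hg.stronglyMeasurableAtFilter _ _) hg.continuousAt
    simpa [abs_of_nonneg (hp.mem r).1] using this
  rw [h1]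
  exact h2.comp r (hp.contDiff.differentiable one_ne_zero r).hasDerivAt

lemma potential_eq_zero (hp : IsLayerProfile f g φ θ δ c K ε p) (hfg : IsPotential f g) {r : ℝ}
    (hr : δ ≤ |r|) : f (p r) = 0 := by
  rw [hfg.f_eq _ (hp.mem r).1]
  rcases le_abs.1 hr with h | h
  · simp [hp.outer_pos r h, hfg.g_one]
  · simp [hp.outer_neg r (by linarith), hfg.g_zero]

end IsLayerProfile

end

section

/-! ### The competitor built from a layer profile -/

variable {f g φ θ : ℝ → ℝ} {δ c K ε : ℝ} {p : ℝ → ℝ} {γ : ℝ → Plane}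

lemma IsSmoothSimpleClosedCurve.ae_norm_gradient (h : IsSmoothSimpleClosedCurve γ) :
    ∀ᵐ x : Plane, DifferentiableAt ℝ (signedDistTo (range γ)) x ∧
      ‖gradient (signedDistTo (range γ)) x‖ = 1 := by
  have h0 : ∀ᵐ x : Plane, x ∉ range γ := measure_eq_zero_iff_ae_notMem.1 h.volume_range
  filter_upwards [h0, (lipschitzWith_signedDistTo (range γ)).ae_differentiableAt] with x hx hd
  exact ⟨hd, h.norm_gradient ((h.isCompact_range.isClosed.notMem_iff_infDist_pos
    (range_nonempty γ)).1 hx) hd⟩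

namespace IsLayerProfile

lemma abs_deriv_le (hp : IsLayerProfile f g φ θ δ c K ε p) (hc : 0 < c) (hK : 0 < K) (hε : 0 < ε)
    (r : ℝ) : |deriv p r| ≤ K / ε :=
  (hp.deriv_le r).trans (mul_le_of_le_one_right (by positivity)
    (Real.exp_le_one_iff.2 (by simp; positivity)))

/-- One factor `|p'|` is bounded by `K/ε` and the other keeps its exponential, which produces
exactly the layer weight. -/
lemma deriv_sq_le (hp : IsLayerProfile f g φ θ δ c K ε p) (hc : 0 < c) (hK : 0 < K) (hε : 0 < ε)
    (r : ℝ) : ε * deriv p r ^ 2 ≤ K ^ 2 * (1 / ε * Real.exp (-(c * (|r| / ε)))) := by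
  have h1 := hp.deriv_le r
  have h2 := hp.abs_deriv_le hc hK hε r
  rw [abs_div, abs_of_pos hε] at h1
  calc ε * deriv p r ^ 2 = ε * (|deriv p r| * |deriv p r|) := by rw [← sq_abs]; ring
    _ ≤ ε * (K / ε * (K / ε * Real.exp (-(c * (|r| / ε))))) := by gcongr
    _ = _ := by field_simp

/-- The weak gradients of `p(d) u` and of `ψ[p(d) u]`, where `d` is the signed distance. -/
lemma weakGrad_competitor (hp : IsLayerProfile f g φ θ δ c K ε p) (hfg : IsPotential f g)
    (hc : 0 < c) (hK : 0 < K) (hε : 0 < ε) (h : IsSmoothSimpleClosedCurve γ) {Ω : Set Plane}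
    (hΩ : IsOpen Ω) (hΩb : Bornology.IsBounded Ω) {u : Plane → Plane} {v : ℕ → Plane → Plane}
    (hu : MemH1Circle Ω u) (hv : SmoothApprox Ω u (weakGrad Ω u) v) :
    MemH1 Ω (fun x => p (signedDistTo (range γ) x) • u x) ∧
    MemH1 Ω (psi g fun x => p (signedDistTo (range γ) x) • u x) ∧
    ∀ᵐ x ∂(volume.restrict Ω), ‖u x‖ = 1 ∧
      frobSq (weakGrad Ω (fun x => p (signedDistTo (range γ) x) • u x) x)
        = p (signedDistTo (range γ) x) ^ 2 * frobSq (weakGrad Ω u x)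
          + deriv p (signedDistTo (range γ) x) ^ 2 ∧
      divOf (weakGrad Ω (fun x => p (signedDistTo (range γ) x) • u x) x)
        = p (signedDistTo (range γ) x) * divOf (weakGrad Ω u x)
          + deriv p (signedDistTo (range γ) x) * ⟪u x, gradient (signedDistTo (range γ)) x⟫ ∧
      weakGrad Ω (psi g fun x => p (signedDistTo (range γ) x) • u x) x (xi (range γ) φ δ x)
        = φ (signedDistTo (range γ) x / δ) * (g (p (signedDistTo (range γ) x))
          * deriv p (signedDistTo (range γ) x)) := by
  set d := signedDistTo (range γ) with hd
  have hdL : LipschitzWith 1 d := lipschitzWith_signedDistTo _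
  have hG := hu.1.memLp_weakGrad hΩ
  have hpd : Differentiable ℝ p := hp.contDiff.differentiable one_ne_zero
  have hΨ := hp.hasDerivAt_integral hfg
  set Ψ : ℝ → ℝ := fun r => ∫ s in (0 : ℝ)..p r, g s with hΨd
  obtain ⟨_, C, -, hC⟩ := hfg.exists_bounds
  have hC' : ∀ r, |g (p r)| ≤ |C| := fun r => by
    have hm := hp.mem r
    rw [abs_of_nonneg (hfg.g_nonneg _ hm.1)]
    refine (hC _ hm).2.trans ((le_abs_self _).trans ?_)
    rw [abs_mul]
    refine mul_le_of_le_one_right (abs_nonneg _) (abs_le.2 ⟨?_, ?_⟩) <;>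
      nlinarith [hm.1, hm.2]
  have hΨB : ∀ r, ‖Ψ r‖ ≤ |C| * 1 := fun r => by
    have hm := hp.mem r
    refine (intervalIntegral.norm_integral_le_of_norm_le_const (C := |C|) fun s hs => ?_).trans ?_
    · rw [uIoc_of_le hm.1] at hs
      have hs1 : s ∈ Icc (0 : ℝ) 1 := ⟨hs.1.le, hs.2.trans hm.2⟩
      rw [Real.norm_eq_abs, abs_of_nonneg (hfg.g_nonneg _ hs1.1)]
      refine (hC _ hs1).2.trans ((le_abs_self _).trans ?_)
      rw [abs_mul]
      refine mul_le_of_le_one_right (abs_nonneg _) (abs_le.2 ⟨?_, ?_⟩) <;>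
        nlinarith [hs1.1, hs1.2]
    · rw [sub_zero, abs_of_nonneg hm.1]
      exact mul_le_mul_of_nonneg_left hm.2 (abs_nonneg _)
  have haL := lipschitzWith_comp_of_deriv_le hpd (hp.abs_deriv_le hc hK hε) hdL
  have hbL := lipschitzWith_comp_of_deriv_le (q := Ψ) (fun r => (hΨ r).differentiableAt)
    (B := |C| * (K / ε)) (fun r => by
      rw [(hΨ r).deriv, abs_mul]
      exact mul_le_mul (hC' r) (hp.abs_deriv_le hc hK hε r) (abs_nonneg _) (abs_nonneg _)) hdL
  obtain ⟨h1, h2, h3⟩ := hv.isWeakGrad_smul hΩ hΩb hu.1.1 hG haL (B := 1) fun x => by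
    rw [Real.norm_eq_abs, abs_of_nonneg (hp.mem _).1]; exact (hp.mem _).2
  -- Because `|u| = 1`, `ψ` sees only the profile, and it is a Lipschitz function of the distance.
  have hψ : psi g (fun x => p (d x) • u x) =ᵐ[volume.restrict Ω] fun x => Ψ (d x) := by
    filter_upwards [hu.2] with x hx
    rw [psi, norm_smul, hx, mul_one, Real.norm_eq_abs, abs_of_nonneg (hp.mem _).1]
  obtain ⟨h4, h5, h6⟩ := isWeakGrad_of_lipschitz hΩ hΩb hbL (fun x => hΨB (d x)) hψ
  refine ⟨⟨h1, _, h3, h2⟩, ⟨h4, _, h6, h5⟩, ?_⟩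
  filter_upwards [hu.2, h3.weakGrad_ae_eq hΩ, h6.weakGrad_ae_eq hΩ,
    ae_restrict_of_ae h.ae_norm_gradient,
    hv.ae_inner_eq_zero hΩ hΩb hu.1.1 hG hu.2 (EuclideanSpace.single 0 1),
    hv.ae_inner_eq_zero hΩ hΩb hu.1.1 hG hu.2 (EuclideanSpace.single 1 1)]
    with x hx1 hx2 hx3 hx4 hx5 hx6
  have hl := fderiv_comp_real hpd hx4.1
  refine ⟨hx1, ?_, ?_, ?_⟩
  · rw [hx2]
    refine frobSq_smul_add_smulRight hl hx4.2 hx1 fun j => ?_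
    fin_cases j
    · exact hx5
    · exact hx6
  · rw [hx2]
    exact divOf_smul_add_smulRight _ _ hl
  · rw [hx3, fderiv_comp_real (fun r => (hΨ r).differentiableAt) hx4.1, (hΨ _).deriv, xi,
      inner_smul_right, real_inner_self_eq_norm_sq, ← hd, hx4.2]
    ring

end IsLayerProfile

lemma integrableOn_of_setLIntegral_le {α : Type*} [MeasurableSpace α] {μ : Measure α} {T : Set α}
    {r : α → ℝ} (hr : AEStronglyMeasurable r (μ.restrict T)) (h0 : ∀ x, 0 ≤ r x) {C : ℝ}
    (hC : 0 ≤ C) (h : ∫⁻ x in T, ENNReal.ofReal (r x) ∂μ ≤ ENNReal.ofReal C) :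
    IntegrableOn r T μ ∧ ∫ x in T, r x ∂μ ≤ C := by
  refine ⟨⟨hr, ?_⟩, ?_⟩
  · rw [hasFiniteIntegral_iff_ofReal (Eventually.of_forall h0)]
    exact h.trans_lt ENNReal.ofReal_lt_top
  · rw [integral_eq_lintegral_of_nonneg_ae (Eventually.of_forall h0) hr]
    exact ENNReal.toReal_le_of_le_ofReal hC h

lemma setIntegral_indicator_of_subset {α : Type*} [MeasurableSpace α] {μ : Measure α}
    {Ω T : Set α} (hT : MeasurableSet T) (hTΩ : T ⊆ Ω) {r : α → ℝ} (hr : IntegrableOn r T μ) :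
    IntegrableOn (T.indicator r) Ω μ ∧ ∫ x in Ω, T.indicator r x ∂μ = ∫ x in T, r x ∂μ :=
  ⟨((integrable_indicator_iff hT).2 hr).integrableOn, by
    rw [setIntegral_indicator hT, inter_eq_self_of_subset_right hTΩ]⟩

end

/-! ### Energy estimates for the competitor -/

section

variable {f g φ θ : ℝ → ℝ} {δ c K ε : ℝ} {p : ℝ → ℝ} {γ : ℝ → Plane}

lemma lintegral_enorm_sq_le_frobSq {Ω : Set Plane} {G : Plane → Plane →L[ℝ] Plane}
    (hG : MemLp G 2 (volume.restrict Ω)) {B : ℝ} (hB : ∫ x in Ω, frobSq (G x) ≤ B) :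
    ∫⁻ x in Ω, ‖G x‖ₑ ^ 2 ≤ ENNReal.ofReal B :=
  calc ∫⁻ x in Ω, ‖G x‖ₑ ^ 2 ≤ ∫⁻ x in Ω, ENNReal.ofReal (frobSq (G x)) := by
        refine lintegral_mono fun x => ?_
        rw [← ofReal_norm, ← ENNReal.ofReal_pow (norm_nonneg _)]
        exact ENNReal.ofReal_le_ofReal (norm_sq_le_frobSq _)
    _ = ENNReal.ofReal (∫ x in Ω, frobSq (G x)) :=
        (ofReal_integral_eq_lintegral_ofReal (integrable_frobSq hG)
          (Eventually.of_forall fun x => frobSq_nonneg _)).symm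
    _ ≤ _ := ENNReal.ofReal_le_ofReal hB

lemma integral_frobSq_le_of_h1Norm_le {Ω : Set Plane} {u : Plane → Plane} {M : ℝ}
    (h : h1Norm Ω u ≤ M) : ∫ x in Ω, frobSq (weakGrad Ω u x) ≤ M ^ 2 := by
  have h0 : 0 ≤ ∫ x in Ω, ‖u x‖ ^ 2 := integral_nonneg fun x => by positivity
  have := (Real.sqrt_le_iff.1 h).2
  linarith

namespace IsLayerProfile

/-- The energy bounds for `p(d) u`. -/
lemma energy_le (hp : IsLayerProfile f g φ θ δ c K ε p) (hfg : IsPotential f g)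
    (hc : 0 < c) (hK : 0 < K) (hε : 0 < ε) (hε1 : ε ≤ 1) (h : IsSmoothSimpleClosedCurve γ)
    {Ω : Set Plane} (hΩ : IsOpen Ω) (hΩb : Bornology.IsBounded Ω) {u : Plane → Plane}
    {v : ℕ → Plane → Plane} (hu : MemH1Circle Ω u) (hv : SmoothApprox Ω u (weakGrad Ω u) v)
    (hTΩ : ∀ x, Metric.infDist x (range γ) ≤ δ → x ∈ Ω) {μ B C₁ C₂ : ℝ} (hμ : 0 < μ)
    (hB : ∫ x in Ω, frobSq (weakGrad Ω u x) ≤ B) (hC₁ : 0 ≤ C₁) (hC₂ : 0 ≤ C₂)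
    (h₁ : ∫⁻ x in {x | Metric.infDist x (range γ) ≤ δ},
        layerWeight c ε (Metric.infDist x (range γ))
          * ‖⟪u x, gradient (signedDistTo (range γ)) x⟫‖ₑ ^ 2
        ≤ ENNReal.ofReal (C₁ * ε) * (1 + ∫⁻ x in Ω, ‖weakGrad Ω u x‖ₑ ^ 2))
    (h₂ : ∫⁻ x in {x | Metric.infDist x (range γ) ≤ δ},
        layerWeight c ε (Metric.infDist x (range γ)) ≤ ENNReal.ofReal C₂) :
    energy Ω μ f ε (fun x => p (signedDistTo (range γ) x) • u x)
        ≤ (2 * μ + 1 / 2) * B + μ * K ^ 2 * (C₁ * (1 + B)) + (K ^ 2 / 2 + K) * C₂ ∧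
    modulatedEnergy Ω (range γ) μ f g φ δ ε (fun x => p (signedDistTo (range γ) x) • u x)
        + bulkError Ω (range γ) g δ (fun x => p (signedDistTo (range γ) x) • u x)
      ≤ ((2 * μ + 1 / 2) * B + μ * K ^ 2 * (C₁ * (1 + B))
        + 2 * (K * (volume {x | Metric.infDist x (range γ) ≤ δ}).toReal)) * ε := by
  obtain ⟨-, -, hae⟩ := hp.weakGrad_competitor hfg hc hK hε h hΩ hΩb hu hv
  set d := signedDistTo (range γ) with hd
  set T : Set Plane := {x | Metric.infDist x (range γ) ≤ δ} with hT
  set U : Plane → Plane := fun x => p (d x) • u x with hU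
  set F : Plane → ℝ := fun x => frobSq (weakGrad Ω u x) with hF
  have hD : ∀ x, |d x| = Metric.infDist x (range γ) := fun x => abs_signedDistTo _ x
  have hTm : MeasurableSet T :=
    (isClosed_le (Metric.continuous_infDist_pt _) continuous_const).measurableSet
  have hG := hu.1.memLp_weakGrad hΩ
  have hFi : Integrable F (volume.restrict Ω) := integrable_frobSq hG
  have hB0 : 0 ≤ B := (integral_nonneg fun x => frobSq_nonneg _).trans hB
  have hF0 : ∀ x, 0 ≤ F x := fun x => frobSq_nonneg _
  set W : Plane → ℝ := fun x => 1 / ε * Real.exp (-(c * (|d x| / ε))) with hW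
  have hW0 : ∀ x, 0 ≤ W x := fun x => by positivity
  have hdc : Continuous d := (lipschitzWith_signedDistTo _).continuous
  have hWc : Continuous W := by fun_prop
  have hlw : ∀ x, layerWeight c ε (Metric.infDist x (range γ)) = ENNReal.ofReal (W x) := fun x => by
    rw [layerWeight, ← hD]
  set R : Plane → ℝ := fun x => W x * ⟪u x, gradient d x⟫ ^ 2 with hR
  have hR0 : ∀ x, 0 ≤ R x := fun x => by positivity
  have hgm : Measurable (gradient d) :=
    (InnerProductSpace.toDual ℝ Plane).symm.continuous.measurable.comp (measurable_fderiv ℝ d)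
  have hRm : AEStronglyMeasurable R (volume.restrict T) :=
    hWc.aestronglyMeasurable.mul (((hu.1.1.1.mono_measure (Measure.restrict_mono hTΩ le_rfl)).inner
      hgm.aestronglyMeasurable).pow 2)
  have hRe : ∀ x, layerWeight c ε (Metric.infDist x (range γ)) * ‖⟪u x, gradient d x⟫‖ₑ ^ 2
      = ENNReal.ofReal (R x) := fun x => by
    rw [hlw, ← ofReal_norm, ← ENNReal.ofReal_pow (norm_nonneg _), ← ENNReal.ofReal_mul (hW0 x),
      Real.norm_eq_abs, sq_abs]
  simp_rw [hRe] at h₁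
  simp_rw [hlw] at h₂
  obtain ⟨hWi, hWB⟩ := integrableOn_of_setLIntegral_le hWc.aestronglyMeasurable hW0 hC₂ h₂
  obtain ⟨hRi, hRB⟩ := integrableOn_of_setLIntegral_le (C := C₁ * ε * (1 + B)) hRm hR0
    (by positivity) (h₁.trans (by
      rw [ENNReal.ofReal_mul (p := C₁ * ε) (by positivity), ENNReal.ofReal_add zero_le_one hB0,
        ENNReal.ofReal_one]
      gcongr
      exact lintegral_enorm_sq_le_frobSq hG hB))
  obtain ⟨hWi', hWB'⟩ := setIntegral_indicator_of_subset hTm hTΩ hWi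
  obtain ⟨hRi', hRB'⟩ := setIntegral_indicator_of_subset hTm hTΩ hRi
  have h1i : IntegrableOn (fun _ => (1 : ℝ)) T := by
    rw [integrableOn_const_iff (by simp)]
    exact Or.inr (h.volume_tube_lt_top δ)
  obtain ⟨h1i', h1B'⟩ := setIntegral_indicator_of_subset hTm hTΩ h1i
  rw [← hWB'] at hWB
  rw [← hRB'] at hRB
  have h1B : ∫ x in Ω, T.indicator (fun _ => (1 : ℝ)) x = (volume T).toReal := by
    rw [h1B']; simp [Measure.real]
  have hp2 : ∀ x, p (d x) ^ 2 ≤ 1 := fun x => pow_le_one₀ (hp.mem _).1 (hp.mem _).2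
  -- Outside the closed tube the profile sits at a well with zero derivative, so all layer terms are
  -- supported in `T`.
  have hoff : ∀ x ∉ T, deriv p (d x) = 0 ∧ f (p (d x)) = 0 := fun x hx => by
    have hx' : δ ≤ |d x| := by rw [hD]; exact (not_le.1 hx).le
    exact ⟨hp.deriv_outer _ hx', hp.potential_eq_zero hfg hx'⟩
  have hdT : ∀ x, ε * deriv p (d x) ^ 2 ≤ K ^ 2 * T.indicator W x := fun x => by
    by_cases hx : x ∈ T
    · rw [indicator_of_mem hx]; exact hp.deriv_sq_le hc hK hε _
    · rw [indicator_of_notMem hx, (hoff x hx).1]; simp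
  have hqT : ∀ x, ε * (deriv p (d x) ^ 2 * ⟪u x, gradient d x⟫ ^ 2) ≤ K ^ 2 * T.indicator R x :=
    fun x => by
    by_cases hx : x ∈ T
    · rw [indicator_of_mem hx, hR, ← mul_assoc, ← mul_assoc]
      exact mul_le_mul_of_nonneg_right (hp.deriv_sq_le hc hK hε _) (sq_nonneg _)
    · rw [indicator_of_notMem hx, (hoff x hx).1]; simp
  have hfT : ∀ x, 1 / ε * f (p (d x)) ≤ K * T.indicator W x := fun x => by
    by_cases hx : x ∈ T
    · rw [indicator_of_mem hx, hW]
      have := hp.potential_le (d x)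
      rw [abs_div, abs_of_pos hε] at this
      calc _ ≤ 1 / ε * (K * Real.exp (-(c * (|d x| / ε)))) := by gcongr
        _ = _ := by ring
    · rw [indicator_of_notMem hx, (hoff x hx).2]; simp
  have hdef : ∀ x, ε / 2 * deriv p (d x) ^ 2 + 1 / ε * f (p (d x))
      - φ (d x / δ) * (g (p (d x)) * deriv p (d x)) ≤ K * ε * T.indicator (fun _ => 1) x :=
    fun x => by
    by_cases hx : x ∈ T
    · rw [indicator_of_mem hx, mul_one]; exact hp.defect_le _
    · rw [indicator_of_notMem hx, (hoff x hx).1, (hoff x hx).2]; simp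
  have hnorm : ∀ x, ‖u x‖ = 1 → ‖U x‖ = p (d x) := fun x hx => by
    rw [hU, norm_smul, hx, mul_one, Real.norm_eq_abs, abs_of_nonneg (hp.mem _).1]
  -- The square of the sum is split by `(a+b)² ≤ 2a² + 2b²`: the regular part costs `ε|∇u|²`, the
  -- layer part is the weighted normal component `R` controlled by the trace inequality.
  have hdiv : ∀ᵐ x ∂(volume.restrict Ω), ε / 2 * μ * divOf (weakGrad Ω U x) ^ 2
      ≤ 2 * μ * ε * F x + μ * K ^ 2 * T.indicator R x := by
    filter_upwards [hae] with x hx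
    rw [hx.2.2.1]
    have e1 : (p (d x) * divOf (weakGrad Ω u x) + deriv p (d x) * ⟪u x, gradient d x⟫) ^ 2
        ≤ 4 * F x + 2 * (deriv p (d x) ^ 2 * ⟪u x, gradient d x⟫ ^ 2) := by
      have e2 : p (d x) ^ 2 * divOf (weakGrad Ω u x) ^ 2 ≤ 1 * (2 * F x) :=
        mul_le_mul (hp2 x) (divOf_sq_le _) (sq_nonneg _) zero_le_one
      nlinarith [sq_nonneg (p (d x) * divOf (weakGrad Ω u x)
        - deriv p (d x) * ⟪u x, gradient d x⟫)]
    have e3 := mul_le_mul_of_nonneg_left (hqT x) hμ.le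
    have e4 := mul_le_mul_of_nonneg_left e1 (show 0 ≤ ε / 2 * μ by positivity)
    linarith
  have hgrad : ∀ᵐ x ∂(volume.restrict Ω), ε / 2 * frobSq (weakGrad Ω U x)
      ≤ ε / 2 * F x + ε / 2 * deriv p (d x) ^ 2 := by
    filter_upwards [hae] with x hx
    rw [hx.2.1, ← mul_add]
    have : p (d x) ^ 2 * F x ≤ F x := mul_le_of_le_one_left (hF0 x) (hp2 x)
    gcongr
  constructor
  -- For the full energy it suffices that the layer weight has bounded mass, since only a bound
  -- uniform in `ε` is required.
  · have hint₀ : Integrable (fun x => (2 * μ + 1 / 2) * F x + μ * K ^ 2 * T.indicator R x)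
        (volume.restrict Ω) := (hFi.const_mul _).add (hRi'.const_mul _)
    have hint : Integrable (fun x => (2 * μ + 1 / 2) * F x + μ * K ^ 2 * T.indicator R x
        + (K ^ 2 / 2 + K) * T.indicator W x) (volume.restrict Ω) :=
      hint₀.add (hWi'.const_mul _)
    have hcalc : ∫ x in Ω, ((2 * μ + 1 / 2) * F x + μ * K ^ 2 * T.indicator R x
        + (K ^ 2 / 2 + K) * T.indicator W x) = (2 * μ + 1 / 2) * (∫ x in Ω, F x)
          + μ * K ^ 2 * (∫ x in Ω, T.indicator R x)
          + (K ^ 2 / 2 + K) * ∫ x in Ω, T.indicator W x := by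
      rw [integral_add hint₀ (hWi'.const_mul _),
        integral_add (hFi.const_mul _) (hRi'.const_mul _), integral_const_mul, integral_const_mul,
        integral_const_mul]
    have hRB2 : ∫ x in Ω, T.indicator R x ≤ C₁ * (1 + B) :=
      hRB.trans (mul_le_mul_of_nonneg_right (mul_le_of_le_one_right hC₁ hε1) (by positivity))
    refine (integral_le_of_ae_le ?_ hint (integral_nonneg fun x => ?_)).trans ?_
    · filter_upwards [hae, hdiv, hgrad] with x hx hx1 hx2
      rw [hnorm x hx.1]
      have e1 : 2 * μ * ε * F x ≤ 2 * μ * F x := by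
        have := mul_le_mul_of_nonneg_left hε1 (show 0 ≤ 2 * μ * F x by have := hF0 x; positivity)
        linarith
      have e2 : ε / 2 * F x ≤ 1 / 2 * F x := by gcongr; exact hF0 x
      have e3 := hdT x
      have e4 := hfT x
      linarith
    · have e1 := hF0 x
      have e2 : 0 ≤ T.indicator R x := indicator_nonneg (fun x _ => hR0 x) x
      have e3 : 0 ≤ T.indicator W x := indicator_nonneg (fun x _ => hW0 x) x
      positivity
    · rw [hcalc]
      gcongr
  · have hint1 : Integrable (fun x => 2 * μ * ε * F x + μ * K ^ 2 * T.indicator R x)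
        (volume.restrict Ω) := (hFi.const_mul _).add (hRi'.const_mul _)
    have hint2 : Integrable (fun x => ε / 2 * F x + K * ε * T.indicator (fun _ => 1) x)
        (volume.restrict Ω) := (hFi.const_mul _).add (h1i'.const_mul _)
    have hm1 : ∫ x in Ω, ε / 2 * μ * divOf (weakGrad Ω U x) ^ 2
        ≤ 2 * μ * ε * B + μ * K ^ 2 * (C₁ * ε * (1 + B)) := by
      refine (integral_le_of_ae_le hdiv hint1 (integral_nonneg fun x => ?_)).trans ?_
      · have e1 := hF0 x
        have e2 : 0 ≤ T.indicator R x := indicator_nonneg (fun x _ => hR0 x) x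
        positivity
      · rw [integral_add (hFi.const_mul _) (hRi'.const_mul _), integral_const_mul,
          integral_const_mul]
        gcongr
    -- Here `ξ·∇ψ` cancels the `O(1)` layer energy pointwise, up to a defect `Kε` on the tube.
    have hm2 : ∫ x in Ω, (ε / 2 * frobSq (weakGrad Ω U x) + 1 / ε * f ‖U x‖
        - weakGrad Ω (psi g U) x (xi (range γ) φ δ x))
        ≤ ε / 2 * B + K * ε * (volume T).toReal := by
      refine (integral_le_of_ae_le ?_ hint2 (integral_nonneg fun x => ?_)).trans ?_
      · filter_upwards [hae, hgrad] with x hx hx1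
        rw [hnorm x hx.1, hx.2.2.2]
        have := hdef x
        linarith
      · have e1 := hF0 x
        have e2 : 0 ≤ T.indicator (fun _ => (1 : ℝ)) x :=
          indicator_nonneg (fun x _ => zero_le_one) x
        positivity
      · rw [integral_add (hFi.const_mul _) (h1i'.const_mul _), integral_const_mul,
          integral_const_mul, h1B]
        gcongr
    have hm3 : bulkError Ω (range γ) g δ U ≤ K * ε * (volume T).toReal := by
      have htube : tube Ω (range γ) δ ⊆ T := fun x hx => by
        have h5 := hx.2
        rw [← hd, hD] at h5
        exact h5.le
      have htm : MeasurableSet (tube Ω (range γ) δ) :=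
        (hΩ.inter (isOpen_lt (continuous_abs.comp hdc) continuous_const)).measurableSet
      have hci : IntegrableOn (fun _ => K * ε) T := h1i.const_mul (K * ε) |>.congr (by simp)
      refine (integral_le_of_ae_le (g := fun _ => K * ε) ?_ (hci.mono_set htube)
        (integral_nonneg fun x => by positivity)).trans ?_
      · filter_upwards [ae_restrict_of_ae_restrict_of_subset (fun x hx => hx.1) hu.2,
          ae_restrict_mem htm] with x hx hxt
        have h5 := hp.bulk_le (d x)
        rw [psi, hnorm x hx]
        have h6 : (plusRegion Ω (range γ)).indicator (fun _ => (1 : ℝ)) x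
            = if 0 < d x then 1 else 0 := by
          classical
          rw [indicator_apply]
          congr 1
          exact propext ⟨fun h => h.2, fun h => ⟨hxt.1, h⟩⟩
        rw [h6]
        exact h5
      · rw [setIntegral_const, smul_eq_mul, mul_comm]
        exact mul_le_mul_of_nonneg_left (ENNReal.toReal_mono (h.volume_tube_lt_top δ).ne
          (measure_mono htube)) (by positivity)
    rw [modulatedEnergy]
    linarith

end IsLayerProfile

end

end AnisoGL

end

theorem mainTheorem5
    -- the potential, the anisotropy and the cut-off profile
    (f g φ : ℝ → ℝ) (hfg : IsPotential f g) (hφ : IsCutoffProfile φ) (μ : ℝ) (hμ : 0 < μ)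
    -- the curve with its inner normal, and the width of its neighbourhood
    (γ n : ℝ → Plane) (hγ : IsSmoothSimpleClosedCurve γ) (hn : IsInnerNormal γ n)
    (δ₀ : ℝ) (hδ₀ : δ₀ ∈ Ioo (0 : ℝ) 1) (hproj : HasSmoothProjection (range γ) (4 * δ₀)) :
    ∃ θ : ℝ → ℝ, IsHeteroclinic f θ ∧
      ∀ M : ℝ, ∃ c₁ : ℝ, 0 < c₁ ∧
        ∀ Ω : Set Plane, IsOpen Ω → IsConnected Ω → Bornology.IsBounded Ω → range γ ⊆ Ω →
          (∀ x ∈ range γ, ∀ y ∈ frontier Ω, 4 * δ₀ ≤ dist x y) →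
          ∀ u : Plane → Plane, MemH1Circle Ω u → h1Norm Ω u ≤ M →
            (∃ w : ℝ → Plane, IsTraceOn Ω γ u w ∧
              ∀ᵐ t ∂(volume.restrict (Ioc (0 : ℝ) 1)), ⟪w t, n t⟫ = 0) →
            ∃ uε : ℝ → Plane → Plane, ∀ ε : ℝ, 0 < ε → ε ≤ 1 →
              -- regularity, including the weak differentiability of `ψ_ε`
              MemH1 Ω (uε ε) ∧ MemLp (uε ε) ∞ (volume.restrict Ω) ∧ MemH1 Ω (psi g (uε ε)) ∧
              -- the values away from the curve
              (∀ x ∈ plusRegion Ω (range γ) \ tube Ω (range γ) δ₀, uε ε x = u x) ∧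
              (∀ x ∈ minusRegion Ω (range γ) \ tube Ω (range γ) δ₀, uε ε x = 0) ∧
              -- the heteroclinic profile near the curve
              (∀ x ∈ tube Ω (range γ) (δ₀ / 2),
                uε ε x = θ (signedDistTo (range γ) x / ε) • u x) ∧
              -- well-preparedness
              energy Ω μ f ε (uε ε) ≤ c₁ ∧
              eLpNorm (uε ε) ∞ (volume.restrict Ω) ≤ 1 ∧
              modulatedEnergy Ω (range γ) μ f g φ δ₀ ε (uε ε)
                + bulkError Ω (range γ) g δ₀ (uε ε) ≤ c₁ * ε := by
  obtain ⟨θ, hθ, hθd, c, hc, hneg, hpos⟩ := hfg.exists_heteroclinic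
  obtain ⟨K, hK, hprof⟩ := hfg.exists_layerProfile hφ hθ hθd hc hneg hpos hδ₀.1
  obtain ⟨C₁, hC₁, hb₁⟩ := hγ.exists_trace_bound hn hc hδ₀.1
  obtain ⟨C₂, hC₂, hb₂⟩ := hγ.exists_layer_bound hc δ₀
  choose! p hp using hprof
  refine ⟨θ, hθ, fun M => ?_⟩
  set V := (volume {x | Metric.infDist x (range γ) ≤ δ₀}).toReal
  -- A single constant dominating both energy bounds, with `M²` as bound on the gradient energy; the
  -- `+ 1` guarantees positivity.
  refine ⟨(2 * μ + 1 / 2) * M ^ 2 + μ * K ^ 2 * (C₁ * (1 + M ^ 2)) + (K ^ 2 / 2 + K) * C₂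
    + 2 * (K * V) + 1, by positivity, ?_⟩
  rintro Ω hΩ - hΩb hγΩ hdist u hu hM ⟨w, hw, hwn⟩
  obtain ⟨v, hv, hvw⟩ := exists_smoothApprox hΩ hu.1 hw
  -- The distance `4δ₀` to the boundary leaves room for the closed tube of radius `δ₀`.
  have hTΩ : ∀ x, Metric.infDist x (range γ) ≤ δ₀ → x ∈ Ω := fun x hx =>
    mem_of_infDist_lt hΩ (range_nonempty γ) hγΩ hdist (hx.trans_lt (by linarith [hδ₀.1]))
  have hB := integral_frobSq_le_of_h1Norm_le hM
  refine ⟨fun ε x => p ε (signedDistTo (range γ) x) • u x, fun ε hε hε1 => ?_⟩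
  have hpε := hp ε hε hε1
  obtain ⟨hU, hψ, -⟩ := hpε.weakGrad_competitor hfg hc hK hε hγ hΩ hΩb hu hv
  obtain ⟨hA, hE⟩ := hpε.energy_le hfg hc hK hε hε1 hγ hΩ hΩb hu hv hTΩ hμ hB hC₁ hC₂
    (hb₁ Ω hΩ hTΩ u _ v w hv hu.1.1 (hu.1.memLp_weakGrad hΩ) hu.2 hwn hvw ε hε hε1)
    (hb₂ ε hε hε1)
  have hle : ∀ᵐ x ∂(volume.restrict Ω), ‖p ε (signedDistTo (range γ) x) • u x‖ ≤ 1 := by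
    filter_upwards [hu.2] with x hx
    rw [norm_smul, hx, mul_one, Real.norm_eq_abs, abs_of_nonneg (hpε.mem _).1]
    exact (hpε.mem _).2
  refine ⟨hU, memLp_top_of_bound hU.1.1 1 hle, hψ, fun x hx => ?_, fun x hx => ?_, fun x hx => ?_,
    hA.trans ?_, ?_, hE.trans ?_⟩
  · have h1 : δ₀ ≤ |signedDistTo (range γ) x| := not_lt.1 fun h => hx.2 ⟨hx.1.1, h⟩
    rw [abs_of_pos hx.1.2] at h1
    simp only [hpε.outer_pos _ h1, one_smul]
  · have h1 : δ₀ ≤ |signedDistTo (range γ) x| := not_lt.1 fun h => hx.2 ⟨hx.1.1, h⟩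
    rw [abs_of_neg hx.1.2] at h1
    simp only [hpε.outer_neg _ (le_neg_of_le_neg h1), zero_smul]
  · simp only [hpε.inner _ hx.2.le]
  · have : 0 ≤ 2 * (K * V) := by positivity
    linarith
  · simpa using eLpNormEssSup_le_of_ae_bound hle
  · have : 0 ≤ (K ^ 2 / 2 + K) * C₂ := by positivity
    exact mul_le_mul_of_nonneg_right (by linarith) hε.le
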